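/- Let $\|\cdot\|$ be the Frobenius norm on $\mathcal X=\mathbb R^{d\times r}$ and the Euclidean norm on $\mathcal Y=\mathbb R^m$. Let $\mathcal M=\{x\in\mathcal X: x^\top x=I_r\}$ be the Stiefel manifold, $c(x)=x^\top x-I_r$, $A(x)=x(\tfrac32 I_r-\tfrac12x^\top x)$, $C>\tfrac12+\sup_{x\in\mathcal M}\|x\|$, $X=\{x:\|x\|\le C\}$ and $\bar X=A(X)$. Assume the following. - $h:\mathcal Y\to\mathbb R\cup\{+\infty\}$ is proper, closed and $\zeta$-weakly convex ($\zeta\ge 0$ and $h+\tfrac{\zeta}{2}\|\cdot\|^2$ is convex), its domain $Y=\{h<\infty\}$ is closed (possibly unbounded), and $h$ is locally Lipschitz on $Y$. - $f:\mathcal X\times\mathcal Y\to\mathbb R$ is differentiable on an open set containing $\bar X\times Y$, and $\nabla_xf,\nabla_yf$ are Lipschitz on $\bar X\times Y$. - For some $\mu>0$ and all $x\in\bar X$, $f_r(x,\cdot)=f(x,\cdot)-h$ is $\mu$-strongly concave on $Y$. Consider $\min_{x\in\mathcal M}\max_{y\in\mathcal Y}f_r(x,y)$. For $u\in\mathcal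 M$ put $\operatorname{grad}_xf(u,y)=\nabla_xf(u,y)-u\operatorname{sym}(u^\top\nabla_xf(u,y))$, where $\operatorname{sym}(B)=\tfrac12(B+B^\top)$. Put $F(x)=\max_yf_r(x,y)$, $\bar F=\min_{x\in X}F(A(x))$, $\tilde f(x,y)=f(A(x),y)+\tfrac\rho4\|c(x)\|^2$ and $\hat f(x,y;z)=\tilde f(x,y)+\tfrac p2\|x-z\|^2$. The method sm-MGDA with parameters $\rho,C,p,\tau_1,\tau_2,\beta$ generates, for $t=0,1,2,\dots$, $$x_{t+1}=\mathcal P_X\big(x_t-\tau_1(\nabla_x\tilde f(x_t,y_t)+p(x_t-z_t))\big),\quad y_{t+1}=\mathrm{prox}_{\tau_2h}\big(y_t+\tau_2\nabla_yf(A(x_{t+1}),y_t)\big),\quad z_{t+1}=z_t+\beta(x_{t+1}-z_t),$$ at the cost of two evaluations of partial gradients of $f$ per iteration. Let $\alpha\in(0,1/2306)$ and $z_0\in\mathcal M$. **Theorem.** There are $\bar\rho>0$, a radius $R>0$, a constant $D>0$ and a function $\rho\mapsto\bar T_\rho\in\mathbb Z_+$ that is non-increasing on $(\bar\rho,\infty)$,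 all depending only on $f,h,\zeta,\mu,C,\alpha,z_0$, such that the following holds for every $\rho>\bar\rho$. Let $l>0$ be any number such that, for all $x_1,x_2\in X$ and all $y_1,y_2\in Y$ with $\|y_1\|,\|y_2\|\le R$, both $\|\nabla_x\tilde f(x_1,y_1)-\nabla_x\tilde f(x_2,y_2)\|$ and $\|\nabla_y\tilde f(x_1,y_1)-\nabla_y\tilde f(x_2,y_2)\|$ are at most $l(\|x_1-x_2\|+\|y_1-y_2\|)$. Run sm-MGDA with $p=2l$, any $\tau_1\in(0,\tfrac1{3l}]$, $\tau_2=\tfrac1{16}(\tfrac3{\tau_1}+\zeta)^{-1}$ and $\beta=\alpha\min\{\mu,l\}\tau_2$, from $z_0$, $y_0\in\operatorname{argmax}_{y}\{\min_{x\in X}\hat f(x,y;z_0)-h(y)\}$, and either $x_0=z_0$ or $x_0=\operatorname{argmin}_{x\in X}\max_{y}\{\hat f(x,y;z_0)-h(y)\}$. Let $\bar\kappa=\max\{1,l/\mu\}$. Then: 1. For every $N\ge\bar T_\rho$ and every $\epsilon>0$ there is an iterate $(x_\epsilon,y_\epsilon)=(x_t,y_t)$ with $t\ge N$, reached within $$K\Big(1+\frac{\bar\kappa}{\epsilon^2}\Big(\frac1{\tau_1}+\zeta\Big)\big(F(z_0)-\bar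 F\big)\Big)=\mathcal O(\bar\kappa/\epsilon^2)$$ gradient evaluations after iteration $N$, where $K$ depends only on $\alpha$, such that $x_\epsilon$ has a unique nearest point $u=\mathcal P_{\mathcal M}(x_\epsilon)$ in $\mathcal M$, $\|x_\epsilon-u\|\le\tfrac3\rho\epsilon$, $\|\operatorname{grad}_xf(u,y_\epsilon)\|\le D\epsilon$ and $\operatorname{dist}(0,-\nabla_yf(u,y_\epsilon)+\partial h(y_\epsilon))\le D\epsilon$. 2. Every limit point $(x^*,y^*)$ of $\{(x_t,y_t)\}_{t\ge 0}$ is a stationary point of the manifold problem: $x^*\in\mathcal M$, $y^*\in Y$, $\operatorname{grad}_xf(x^*,y^*)=0$ and $0\in-\nabla_yf(x^*,y^*)+\partial h(y^*)$. -/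

import Mathlib

open Filter Topology Set

noncomputable section

/-- `ℝ^{d × r}` with the Frobenius inner product and norm. -/
abbrev Mat (d r : ℕ) : Type := EuclideanSpace ℝ (Fin d × Fin r)

/-- `ℝ^m` with the Euclidean inner product and norm. -/
abbrev Vec (m : ℕ) : Type := EuclideanSpace ℝ (Fin m)

/-- The matrix with the entries of `x`. -/
def toM {d r : ℕ} (x : Mat d r) : Matrix (Fin d) (Fin r) ℝ :=
  Matrix.of fun i j => x (i, j)

/-- The element of `ℝ^{d × r}` with the entries of the matrix `M`. -/
def ofM {d r : ℕ} (M : Matrix (Fin d) (Fin r) ℝ) : Mat d r :=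
  WithLp.toLp 2 fun ij => M ij.1 ij.2

/-- The symmetrization `sym(M) = (M + Mᵀ) / 2`. -/
def symPart {r : ℕ} (M : Matrix (Fin r) (Fin r) ℝ) : Matrix (Fin r) (Fin r) ℝ :=
  (1 / 2 : ℝ) • (M + M.transpose)

/-! ### The Stiefel manifold and the constraint dissolving operator -/

/-- The Stiefel manifold `{x : xᵀ x = I_r}`. -/
def stiefel (d r : ℕ) : Set (Mat d r) :=
  {x | (toM x).transpose * toM x = 1}

/-- The defining function `c(x) = xᵀ x - I_r`. -/
def constr {d r : ℕ} (x : Mat d r) : Mat r r :=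
  ofM ((toM x).transpose * toM x - 1)

/-- `∇c(x)[u] = 2 x u`. -/
def constrGrad {d r : ℕ} (x : Mat d r) (u : Mat r r) : Mat d r :=
  ofM ((2 : ℝ) • (toM x * toM u))

/-- `A(x) = x (3/2 I_r - 1/2 xᵀ x)`. -/
def dissolve {d r : ℕ} (x : Mat d r) : Mat d r :=
  ofM (toM x * ((3 / 2 : ℝ) • (1 : Matrix (Fin r) (Fin r) ℝ)
    - (1 / 2 : ℝ) • ((toM x).transpose * toM x)))

/-- `∇A(x)[u] = u (3/2 I_r - 1/2 xᵀ x) - x sym(xᵀ u)`, the adjoint of the derivative of `A`. -/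
def dissolveGrad {d r : ℕ} (x u : Mat d r) : Mat d r :=
  ofM (toM u * ((3 / 2 : ℝ) • (1 : Matrix (Fin r) (Fin r) ℝ)
      - (1 / 2 : ℝ) • ((toM x).transpose * toM x))
    - toM x * symPart ((toM x).transpose * toM u))

/-- The Riemannian gradient on the Stiefel manifold at `x` of a function whose Euclidean
gradient at `x` is `u`: `u - x sym(xᵀ u)`. -/
def riemGrad {d r : ℕ} (x u : Mat d r) : Mat d r :=
  ofM (toM u - toM x * symPart ((toM x).transpose * toM u))

/-- `X = {x : ‖x‖ ≤ C}` (Frobenius norm). -/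
def ballX (d r : ℕ) (C : ℝ) : Set (Mat d r) := {x | ‖x‖ ≤ C}

/-- `X̄ = {A(x) : ‖x‖ ≤ C}`. -/
def barX (d r : ℕ) (C : ℝ) : Set (Mat d r) := dissolve '' ballX d r C

/-- `u` is a nearest point to `v` in the set `S`. -/
def IsNearest {E : Type*} [NormedAddCommGroup E] (S : Set E) (v u : E) : Prop :=
  u ∈ S ∧ ∀ w ∈ S, ‖v - u‖ ≤ ‖v - w‖

/-! ### The extended-valued regularizer -/

/-- `dom h = {y : h(y) < +∞}`. -/
def edom {m : ℕ} (h : Vec m → EReal) : Set (Vec m) := {y | h y < ⊤}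

/-- `h : ℝ^m → ℝ ∪ {+∞}` is proper, closed and `ζ`-weakly convex, with a closed domain, and is
locally Lipschitz on its domain. The domain need not be bounded. -/
structure RegularizerAssumption {m : ℕ} (h : Vec m → EReal) (ζ : ℝ) : Prop where
  ne_bot : ∀ y, h y ≠ ⊥
  proper : (edom h).Nonempty
  lsc : LowerSemicontinuous h
  zeta_nonneg : 0 ≤ ζ
  weaklyConvex : ConvexOn ℝ (edom h) fun y => (h y).toReal + ζ / 2 * ‖y‖ ^ 2
  closed_dom : IsClosed (edom h)
  locLipschitz : LocallyLipschitzOn (edom h) fun y => (h y).toReal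

/-- The (Fréchet) subdifferential `∂h(y)`; it is empty off the domain of `h`. -/
def subdiff {m : ℕ} (h : Vec m → EReal) (y : Vec m) : Set (Vec m) :=
  {g | y ∈ edom h ∧ ∀ ε > 0, ∀ᶠ w in 𝓝 y, w ∈ edom h →
    (h y).toReal + inner ℝ g (w - y) - ε * ‖w - y‖ ≤ (h w).toReal}

/-- `y = prox_{τ h}(v)`, i.e. `y` minimizes `w ↦ τ h(w) + 1/2 ‖w - v‖²`. -/
def IsProx {m : ℕ} (h : Vec m → EReal) (τ : ℝ) (v y : Vec m) : Prop :=
  y ∈ edom h ∧ ∀ w ∈ edom h,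
    τ * (h y).toReal + 1 / 2 * ‖y - v‖ ^ 2 ≤ τ * (h w).toReal + 1 / 2 * ‖w - v‖ ^ 2

/-! ### The coupling function -/

/-- Partial gradient `∇_x f(x, y)`. -/
def gradX {d r m : ℕ} (f : Mat d r → Vec m → ℝ) (x : Mat d r) (y : Vec m) : Mat d r :=
  gradient (fun u => f u y) x

/-- Partial gradient `∇_y f(x, y)`. -/
def gradY {d r m : ℕ} (f : Mat d r → Vec m → ℝ) (x : Mat d r) (y : Vec m) : Vec m :=
  gradient (fun w => f x w) y

/-- `f` is differentiable on an open set containing `X̄ × dom h`, and its partial gradients are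
Lipschitz on `X̄ × dom h`. -/
def SmoothAssumption {d r m : ℕ} (f : Mat d r → Vec m → ℝ) (h : Vec m → EReal) (C : ℝ) : Prop :=
  (∃ U : Set (Mat d r × Vec m), IsOpen U ∧ barX d r C ×ˢ edom h ⊆ U ∧
    DifferentiableOn ℝ (fun q : Mat d r × Vec m => f q.1 q.2) U) ∧
  ∃ Lxx Lxy Lyx Lyy : ℝ, 0 ≤ Lxx ∧ 0 ≤ Lxy ∧ 0 ≤ Lyx ∧ 0 ≤ Lyy ∧
    ∀ x₁ ∈ barX d r C, ∀ x₂ ∈ barX d r C, ∀ y₁ ∈ edom h, ∀ y₂ ∈ edom h,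
      ‖gradX f x₁ y₁ - gradX f x₂ y₂‖ ≤ Lxx * ‖x₁ - x₂‖ + Lxy * ‖y₁ - y₂‖ ∧
      ‖gradY f x₁ y₁ - gradY f x₂ y₂‖ ≤ Lyx * ‖x₁ - x₂‖ + Lyy * ‖y₁ - y₂‖

/-- `f_r(x, y) = f(x, y) - h(y)`, for `y ∈ dom h`. -/
def regF {d r m : ℕ} (f : Mat d r → Vec m → ℝ) (h : Vec m → EReal)
    (x : Mat d r) (y : Vec m) : ℝ :=
  f x y - (h y).toReal

/-- `f_r(x, ·)` is `μ`-strongly concave for every `x ∈ X̄`. -/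
def StronglyConcaveAssumption {d r m : ℕ} (f : Mat d r → Vec m → ℝ) (h : Vec m → EReal)
    (C μ : ℝ) : Prop :=
  ∀ x ∈ barX d r C, StrongConcaveOn (edom h) μ (regF f h x)

/-- The primal function `F(x) = max_y f_r(x, y)`. -/
def primal {d r m : ℕ} (f : Mat d r → Vec m → ℝ) (h : Vec m → EReal) (x : Mat d r) : ℝ :=
  sSup (regF f h x '' edom h)

/-- `F̄ = min_{x ∈ X} F(A(x))`. -/
def primalLower {d r m : ℕ} (f : Mat d r → Vec m → ℝ) (h : Vec m → EReal) (C : ℝ) : ℝ :=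
  sInf ((fun x => primal f h (dissolve x)) '' ballX d r C)

/-! ### The penalty function -/

/-- `f̃(x, y) = f(A(x), y) + ρ/4 ‖c(x)‖²`. -/
def pen {d r m : ℕ} (f : Mat d r → Vec m → ℝ) (ρ : ℝ) (x : Mat d r) (y : Vec m) : ℝ :=
  f (dissolve x) y + ρ / 4 * ‖constr x‖ ^ 2

/-- `∇_x f̃(x, y) = ∇A(x)[∇_x f(A(x), y)] + ρ/2 ∇c(x)[c(x)]`. -/
def penGradX {d r m : ℕ} (f : Mat d r → Vec m → ℝ) (ρ : ℝ) (x : Mat d r) (y : Vec m) : Mat d r :=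
  dissolveGrad x (gradX f (dissolve x) y) + (ρ / 2) • constrGrad x (constr x)

/-- `∇_y f̃(x, y) = ∇_y f(A(x), y)`. -/
def penGradY {d r m : ℕ} (f : Mat d r → Vec m → ℝ) (x : Mat d r) (y : Vec m) : Vec m :=
  gradY f (dissolve x) y

/-- `l` is a Lipschitz constant of `∇f̃` on `X × S`. -/
def PenLipschitz {d r m : ℕ} (f : Mat d r → Vec m → ℝ) (ρ C : ℝ) (S : Set (Vec m))
    (l : ℝ) : Prop :=
  ∀ x₁ ∈ ballX d r C, ∀ x₂ ∈ ballX d r C, ∀ y₁ ∈ S, ∀ y₂ ∈ S,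
    ‖penGradX f ρ x₁ y₁ - penGradX f ρ x₂ y₂‖ ≤ l * (‖x₁ - x₂‖ + ‖y₁ - y₂‖) ∧
    ‖penGradY f x₁ y₁ - penGradY f x₂ y₂‖ ≤ l * (‖x₁ - x₂‖ + ‖y₁ - y₂‖)

/-- `f̂(x, y; z) = f̃(x, y) + p/2 ‖x - z‖²`. -/
def fhat {d r m : ℕ} (f : Mat d r → Vec m → ℝ) (ρ p : ℝ)
    (x : Mat d r) (y : Vec m) (z : Mat d r) : ℝ :=
  pen f ρ x y + p / 2 * ‖x - z‖ ^ 2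

/-- `Φ(x; z) = max_y (f̂(x, y; z) - h(y))`. -/
def auxPrimal {d r m : ℕ} (f : Mat d r → Vec m → ℝ) (h : Vec m → EReal) (ρ p : ℝ)
    (x z : Mat d r) : ℝ :=
  sSup ((fun y => fhat f ρ p x y z - (h y).toReal) '' edom h)

/-- `Ψ_r(y; z) = min_{x ∈ X} f̂(x, y; z) - h(y)`, for `y ∈ dom h`. -/
def auxDual {d r m : ℕ} (f : Mat d r → Vec m → ℝ) (h : Vec m → EReal) (ρ p C : ℝ)
    (y : Vec m) (z : Mat d r) : ℝ :=
  sInf ((fun x => fhat f ρ p x y z) '' ballX d r C) - (h y).toReal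

/-- `Y^*(z) = argmax_y Ψ_r(y; z)`. -/
def argmaxDual {d r m : ℕ} (f : Mat d r → Vec m → ℝ) (h : Vec m → EReal) (ρ p C : ℝ)
    (z : Mat d r) : Set (Vec m) :=
  {y | y ∈ edom h ∧ ∀ w ∈ edom h, auxDual f h ρ p C w z ≤ auxDual f h ρ p C y z}

/-- `argmin_{x ∈ X} Φ(x; z)`, whose unique element is `x^*(z)`. -/
def argminPrimal {d r m : ℕ} (f : Mat d r → Vec m → ℝ) (h : Vec m → EReal) (ρ p C : ℝ)
    (z : Mat d r) : Set (Mat d r) :=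
  {x | x ∈ ballX d r C ∧ ∀ u ∈ ballX d r C, auxPrimal f h ρ p x z ≤ auxPrimal f h ρ p u z}

/-! ### The algorithm -/

/-- `(x_t, y_t, z_t)` obeys the recursion of the smoothed manifold gradient descent-ascent method
with constant step sizes `τ₁, τ₂`, smoothing parameters `p, β`, penalty parameter `ρ`, radius `C`
and no regularization of the dual step. -/
def IsSmMGDA {d r m : ℕ} (f : Mat d r → Vec m → ℝ) (h : Vec m → EReal) (ρ C p τ₁ τ₂ β : ℝ)
    (x : ℕ → Mat d r) (y : ℕ → Vec m) (z : ℕ → Mat d r) : Prop :=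
  ∀ t,
    IsNearest (ballX d r C)
      (x t - τ₁ • (penGradX f ρ (x t) (y t) + p • (x t - z t))) (x (t + 1)) ∧
    IsProx h τ₂ (y t + τ₂ • gradY f (dissolve (x (t + 1))) (y t)) (y (t + 1)) ∧
    z (t + 1) = z t + β • (x (t + 1) - z t)

/-- Number of evaluations of partial gradients of `f` needed to produce `(x_t, y_t, z_t)`: one
of `∇_x f` and one of `∇_y f` in each iteration. -/
def gradEvals (t : ℕ) : ℕ := 2 * t

/-! ### Stationarity for the manifold problem -/

/-- `(u, y)` lies in `M × dom h`, `‖grad_x f(u, y)‖ ≤ ε` and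
`dist(0, -∇_y f(u, y) + ∂h(y)) ≤ ε`. As `∂h(y)` is closed, the latter says that some element of
`-∇_y f(u, y) + ∂h(y)` has norm at most `ε`. -/
def IsApproxStationary {d r m : ℕ} (f : Mat d r → Vec m → ℝ) (h : Vec m → EReal) (ε : ℝ)
    (u : Mat d r) (y : Vec m) : Prop :=
  u ∈ stiefel d r ∧ y ∈ edom h ∧ ‖riemGrad u (gradX f u y)‖ ≤ ε ∧
    ∃ g ∈ subdiff h y, ‖-gradY f u y + g‖ ≤ ε

/-- `u ∈ M`, `y ∈ dom h`, `grad_x f(u, y) = 0` and `0 ∈ -∇_y f(u, y) + ∂h(y)`. -/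
def IsMinimaxStationary {d r m : ℕ} (f : Mat d r → Vec m → ℝ) (h : Vec m → EReal)
    (u : Mat d r) (y : Vec m) : Prop :=
  u ∈ stiefel d r ∧ y ∈ edom h ∧ riemGrad u (gradX f u y) = 0 ∧
    ∃ g ∈ subdiff h y, -gradY f u y + g = 0

end

noncomputable section

/-! With `p = 2l` the coupling `smoothed` (written `φ`) is `l`-strongly convex in `x` and
`μ`-strongly concave in `y`. Let `Ψ(y; z)` be its minimum over `x` and `P(z)` its saddle value. The
engine is the potential `V = φ(x, y; z) - 2 Ψ(y; z) + 2 P(z)`. It is the sum of `P(z)` and the two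
nonnegative gaps `φ - Ψ` and `P - Ψ`, so it is bounded below by `F̄`; the prescribed start gives `V
0 ≤ F(z₀)`.

Decrease (`CouplingBounds.one_step`): the primal, dual and centre steps change `V` by negative
squares plus cross terms. The only dangerous cross term involves the distance from the inner
minimizer to the saddle point; strong concavity bounds it by the step lengths (`dual_error`), and
choosing `β` proportional to `min μ l` makes it affordable. Summing the decreases over a range of
length `F(z₀) - F̄` yields the `κ̄/ε²` count.

Unbounded dual domain: `l` is a Lipschitz constant only on a ball. While `V ≤ F(z₀)`, strong
concavity keeps `y` in a ball independent of `ρ`, and one dual step at most doubles the distance to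
the current maximizer. The decrease and the confinement are therefore proved together by induction
(`AdmissibleRun.exists_potential`).

Feasibility: `V ≤ F(z₀)` also bounds `ρ ‖c‖²` at the saddle point and `l ‖x - x^*(z)‖²`. Since `l ≥
ρ/2` for large `ρ` (`exists_penLipschitz_lower`), every primal iterate has `‖c‖ ≤ 1/2`. It is then
interior to the ball, the projection is inactive, and small steps mean a small penalty gradient.
Along the normal direction `x c` the derivative of `A` is only quadratic in `c`, so a small penalty
gradient forces `‖c‖ ≤ 3ε/ρ` (`constr_le_of_penalty_gradient`), and the polar factor is the unique
nearest point (`exists_unique_nearest`). No burn-in is needed. -/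

theorem nonpos_of_forall_mul_le_sq_mul {a b : ℝ}
    (H : ∀ s : ℝ, 0 < s → s ≤ 1 → s * a ≤ s ^ 2 * b) : a ≤ 0 := by
  by_contra! ha
  have hb : 0 < |b| + a := by positivity
  -- This `s` makes `s * (|b| + a)` equal to `a / 2`, contradicting `a ≤ s * b`.
  have h := H (a / (2 * (|b| + a))) (by positivity) (by
    rw [div_le_one (by positivity)]; nlinarith [abs_nonneg b])
  set s := a / (2 * (|b| + a)) with hs
  have hs0 : 0 < s := by positivity
  have h2 : a ≤ s * b := by nlinarith
  have h3 : s * b ≤ s * (|b| + a) := by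
    apply mul_le_mul_of_nonneg_left _ hs0.le
    linarith [le_abs_self b]
  have h4 : s * (|b| + a) = a / 2 := by rw [hs]; field_simp
  linarith

/-! ### Strong concavity, descent lemma and projections in inner product spaces -/

section General

variable {F : Type*} [NormedAddCommGroup F] [InnerProductSpace ℝ F]

/-- A strongly concave function with a quadratic upper model at a point lies below the
corresponding sharp quadratic model. -/
theorem StrongConcaveOn.le_add_inner_sub {s : Set F} {m K : ℝ} {φ : F → ℝ}
    (hφ : StrongConcaveOn s m φ) {y ξ : F} (hy : y ∈ s)
    (H : ∀ w ∈ s, φ w ≤ φ y + inner ℝ ξ (w - y) + K * ‖w - y‖ ^ 2) :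
    ∀ w ∈ s, φ w ≤ φ y + inner ℝ ξ (w - y) - m / 2 * ‖w - y‖ ^ 2 := by
  intro w hw
  have key : φ w - (φ y + inner ℝ ξ (w - y) - m / 2 * ‖w - y‖ ^ 2) ≤ 0 := by
    -- Concavity on the segment towards `w` is compared with the quadratic model at the intermediate
    -- point: the claim is the first-order part in `t`, and `K` survives only at order `t²`.
    apply nonpos_of_forall_mul_le_sq_mul (b := (K + m / 2) * ‖w - y‖ ^ 2)
    intro t ht ht1
    have h1 := hφ.2 hw hy ht.le (sub_nonneg.2 ht1) (by ring)
    have hmem : t • w + (1 - t) • y ∈ s :=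
      hφ.1 hw hy ht.le (sub_nonneg.2 ht1) (by ring)
    have h2 := H _ hmem
    have e : t • w + (1 - t) • y - y = t • (w - y) := by
      simp only [smul_sub, sub_smul, one_smul]; abel
    rw [e, inner_smul_right, norm_smul, Real.norm_of_nonneg ht.le] at h2
    simp only [smul_eq_mul] at h1
    nlinarith
  linarith

theorem StrongConcaveOn.le_sub_of_isMax {s : Set F} {m : ℝ} {φ : F → ℝ}
    (hφ : StrongConcaveOn s m φ) {y : F} (hy : y ∈ s) (H : ∀ w ∈ s, φ w ≤ φ y) :
    ∀ w ∈ s, φ w ≤ φ y - m / 2 * ‖w - y‖ ^ 2 := by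
  intro w hw
  have := hφ.le_add_inner_sub (ξ := 0) (K := 0) hy (fun w hw => by simpa using H w hw) w hw
  simpa using this

theorem StrongConvexOn.add_le_of_isMin {s : Set F} {m : ℝ} {φ : F → ℝ}
    (hφ : StrongConvexOn s m φ) {y : F} (hy : y ∈ s) (H : ∀ w ∈ s, φ y ≤ φ w) :
    ∀ w ∈ s, φ y + m / 2 * ‖w - y‖ ^ 2 ≤ φ w := by
  intro w hw
  have h1 : StrongConcaveOn s m (-φ) := UniformConvexOn.neg hφ
  have := h1.le_sub_of_isMax hy (fun w hw => by simpa using H w hw) w hw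
  simp only [Pi.neg_apply] at this
  linarith

/-- A function with strong quadratic lower models is strongly convex. -/
theorem strongConvexOn_of_quadratic_lower {s : Set F} (hs : Convex ℝ s) {m : ℝ} {φ : F → ℝ}
    {g : F → F}
    (H : ∀ x ∈ s, ∀ w ∈ s, φ x + inner ℝ (g x) (w - x) + m / 2 * ‖w - x‖ ^ 2 ≤ φ w) :
    StrongConvexOn s m φ := by
  refine ⟨hs, fun x hx y hy a b ha hb hab => ?_⟩
  have hmem := hs hx hy ha hb hab
  set p := a • x + b • y with hp
  have h1 := H p hmem x hx
  have h2 := H p hmem y hy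
  have e1 : x - p = b • (x - y) := by
    have : b = 1 - a := by linarith
    subst this; rw [hp]; simp only [smul_sub, sub_smul, one_smul]; abel
  have e2 : y - p = (-a) • (x - y) := by
    have : a = 1 - b := by linarith
    subst this; rw [hp]; simp only [neg_smul, smul_sub, sub_smul, one_smul]; abel
  rw [e1, inner_smul_right, norm_smul, Real.norm_eq_abs, mul_pow, sq_abs] at h1
  rw [e2, inner_smul_right, norm_smul, Real.norm_eq_abs, mul_pow, sq_abs] at h2
  simp only [smul_eq_mul]
  have h3 := add_le_add (mul_le_mul_of_nonneg_left h1 ha) (mul_le_mul_of_nonneg_left h2 hb)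
  have : b = 1 - a := by linarith
  subst this
  nlinarith

/-- The two-sided descent lemma for a function with Lipschitz gradient on a convex set. -/
theorem abs_sub_sub_inner_le [CompleteSpace F] {s : Set F} (hs : Convex ℝ s) {φ : F → ℝ}
    {g : F → F} {L : ℝ}
    (hg : ∀ x ∈ s, HasGradientAt φ (g x) x)
    (hL : ∀ x ∈ s, ∀ w ∈ s, ‖g w - g x‖ ≤ L * ‖w - x‖) :
    ∀ x ∈ s, ∀ w ∈ s, |φ w - φ x - inner ℝ (g x) (w - x)| ≤ L / 2 * ‖w - x‖ ^ 2 := by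
  intro x hx w hw
  have hmem : ∀ t ∈ Icc (0 : ℝ) 1, x + t • (w - x) ∈ s := fun t ht =>
    hs.add_smul_sub_mem hx hw ht
  have hd : ∀ t ∈ Icc (0 : ℝ) 1, HasDerivAt (fun t : ℝ => φ (x + t • (w - x)))
      (inner ℝ (g (x + t • (w - x))) (w - x)) t := by
    intro t ht
    have h1 := (hg _ (hmem t ht)).hasFDerivAt
    have h2 : HasDerivAt (fun t : ℝ => x + t • (w - x)) (w - x) t := by
      simpa using ((hasDerivAt_id t).smul_const (w - x)).const_add x
    have h3 : HasDerivAt (fun t : ℝ => φ (x + t • (w - x))) _ t := h1.comp_hasDerivAt t h2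
    simpa using h3
  have hin : ∀ t ∈ Icc (0 : ℝ) 1,
      |inner ℝ (g (x + t • (w - x))) (w - x) - inner ℝ (g x) (w - x)| ≤ L * t * ‖w - x‖ ^ 2 := by
    intro t ht
    rw [← inner_sub_left]
    refine (abs_real_inner_le_norm _ _).trans ?_
    have := hL x hx _ (hmem t ht)
    rw [add_sub_cancel_left, norm_smul, Real.norm_of_nonneg ht.1] at this
    nlinarith [norm_nonneg (w - x)]
  -- The values `c = 1` and `c = -1` give the bounding parabolas from above and below.
  have hq : ∀ (c : ℝ) (t : ℝ), HasDerivAt (fun t : ℝ => t * inner ℝ (g x) (w - x)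
      + c * L / 2 * t ^ 2 * ‖w - x‖ ^ 2)
      (inner ℝ (g x) (w - x) + c * L * t * ‖w - x‖ ^ 2) t := by
    intro c t
    have h1 := (hasDerivAt_id t).mul_const (inner ℝ (g x) (w - x))
    have h2 := (((hasDerivAt_id t).pow 2).const_mul (c * L / 2)).mul_const (‖w - x‖ ^ 2)
    refine (h1.add h2 : HasDerivAt (fun t : ℝ => t * inner ℝ (g x) (w - x)
      + c * L / 2 * t ^ 2 * ‖w - x‖ ^ 2) _ t).congr_deriv ?_
    simp only [id_eq, one_mul, Nat.cast_ofNat, Nat.add_one_sub_one, pow_one, mul_one]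
    ring
  have hup : φ w - φ x - inner ℝ (g x) (w - x) ≤ L / 2 * ‖w - x‖ ^ 2 := by
    have hanti : AntitoneOn (fun t : ℝ => φ (x + t • (w - x)) -
        (t * inner ℝ (g x) (w - x) + 1 * L / 2 * t ^ 2 * ‖w - x‖ ^ 2)) (Icc 0 1) := by
      apply antitoneOn_of_deriv_nonpos (convex_Icc 0 1)
      · exact fun t ht => ((hd t ht).sub (hq 1 t)).continuousAt.continuousWithinAt
      · exact fun t ht => ((hd t (interior_subset ht)).sub
          (hq 1 t)).differentiableAt.differentiableWithinAt
      · intro t ht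
        erw [((hd t (interior_subset ht)).sub (hq 1 t)).deriv]
        have := (abs_le.1 (hin t (interior_subset ht))).2
        linarith
    have := hanti (left_mem_Icc.2 zero_le_one) (right_mem_Icc.2 zero_le_one) zero_le_one
    simp only [zero_smul, add_zero, one_smul, add_sub_cancel] at this
    linarith
  have hlo : -(L / 2 * ‖w - x‖ ^ 2) ≤ φ w - φ x - inner ℝ (g x) (w - x) := by
    have hmono : MonotoneOn (fun t : ℝ => φ (x + t • (w - x)) -
        (t * inner ℝ (g x) (w - x) + (-1) * L / 2 * t ^ 2 * ‖w - x‖ ^ 2)) (Icc 0 1) := by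
      apply monotoneOn_of_deriv_nonneg (convex_Icc 0 1)
      · exact fun t ht => ((hd t ht).sub (hq (-1) t)).continuousAt.continuousWithinAt
      · exact fun t ht => ((hd t (interior_subset ht)).sub
          (hq (-1) t)).differentiableAt.differentiableWithinAt
      · intro t ht
        erw [((hd t (interior_subset ht)).sub (hq (-1) t)).deriv]
        have := (abs_le.1 (hin t (interior_subset ht))).1
        linarith
    have := hmono (left_mem_Icc.2 zero_le_one) (right_mem_Icc.2 zero_le_one) zero_le_one
    simp only [zero_smul, add_zero, one_smul, add_sub_cancel] at this
    linarith
  exact abs_le.2 ⟨hlo, hup⟩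

/-- Mean value inequality for the difference of two functions. -/
theorem abs_sub_sub_sub_le_of_gradient [CompleteSpace F] {s : Set F} (hs : Convex ℝ s)
    {φ ψ : F → ℝ} {gφ gψ : F → F} {M : ℝ}
    (hφ : ∀ y ∈ s, HasGradientAt φ (gφ y) y) (hψ : ∀ y ∈ s, HasGradientAt ψ (gψ y) y)
    (hM : ∀ y ∈ s, ‖gφ y - gψ y‖ ≤ M) {y y' : F} (hy : y ∈ s) (hy' : y' ∈ s) :
    |(φ y' - φ y) - (ψ y' - ψ y)| ≤ M * ‖y' - y‖ := by
  have h := hs.norm_image_sub_le_of_norm_hasFDerivWithin_le (f := fun y => φ y - ψ y)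
    (f' := fun y => InnerProductSpace.toDual ℝ F (gφ y) - InnerProductSpace.toDual ℝ F (gψ y))
    (C := M)
    (fun y hy => ((hφ y hy).hasFDerivAt.sub (hψ y hy).hasFDerivAt).hasFDerivWithinAt)
    (fun y hy => by rw [← map_sub, LinearIsometryEquiv.norm_map]; exact hM y hy) hy hy'
  rw [Real.norm_eq_abs] at h
  convert h using 2
  ring

/-- A continuous strongly concave function attains its maximum on a closed set. -/
theorem StrongConcaveOn.exists_isMax [ProperSpace F] {s : Set F} (hc : IsClosed s)
    (hne : s.Nonempty) {m : ℝ} (hm : 0 < m) {φ : F → ℝ} (hφ : StrongConcaveOn s m φ)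
    (hcont : ContinuousOn φ s) : ∃ y ∈ s, ∀ w ∈ s, φ w ≤ φ y := by
  obtain ⟨y₀, hy₀⟩ := hne
  have hcomp : ∀ ρ, IsCompact (s ∩ Metric.closedBall y₀ ρ) := fun ρ =>
    (isCompact_closedBall y₀ ρ).inter_left hc
  have hmem : ∀ ρ, 0 ≤ ρ → y₀ ∈ s ∩ Metric.closedBall y₀ ρ := fun ρ hρ =>
    ⟨hy₀, Metric.mem_closedBall_self hρ⟩
  obtain ⟨y₁, -, hy₁⟩ := (hcomp 1).exists_isMaxOn ⟨y₀, hmem 1 zero_le_one⟩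
    (hcont.mono inter_subset_left)
  set M := φ y₁ with hMdef
  have hM0 : φ y₀ ≤ M := hy₁ (hmem 1 zero_le_one)
  -- Beyond this radius concavity, tested at the point at distance one from `y₀` where `φ ≤ M`,
  -- forces the value below `φ y₀`.
  set r := 1 + 2 * (M - φ y₀) / m with hr
  have hr1 : 1 ≤ r := by
    have : 0 ≤ 2 * (M - φ y₀) / m := by
      apply div_nonneg _ hm.le; linarith
    linarith
  obtain ⟨y₂, hy₂s, hy₂⟩ := (hcomp r).exists_isMaxOn ⟨y₀, hmem r (by linarith)⟩
    (hcont.mono inter_subset_left)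
  refine ⟨y₂, hy₂s.1, fun w hw => ?_⟩
  by_cases hd : ‖w - y₀‖ ≤ r
  · exact hy₂ ⟨hw, by rwa [Metric.mem_closedBall, dist_eq_norm]⟩
  · push Not at hd
    have hle : φ y₀ ≤ φ y₂ := hy₂ (hmem r (by linarith))
    refine le_trans ?_ hle
    set D := ‖w - y₀‖ with hD
    have hD1 : 1 < D := by linarith
    have hD0 : 0 < D := by linarith
    have hi : D⁻¹ ≤ 1 := inv_le_one_of_one_le₀ hD1.le
    have h1 := hφ.2 hw hy₀ (inv_nonneg.2 hD0.le) (sub_nonneg.2 hi) (by ring)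
    have hp := hφ.1 hw hy₀ (inv_nonneg.2 hD0.le) (sub_nonneg.2 hi) (by ring)
    have e : D⁻¹ • w + (1 - D⁻¹) • y₀ - y₀ = D⁻¹ • (w - y₀) := by
      simp only [smul_sub, sub_smul, one_smul]; abel
    have h2 : φ (D⁻¹ • w + (1 - D⁻¹) • y₀) ≤ M := by
      apply hy₁
      refine ⟨hp, ?_⟩
      rw [Metric.mem_closedBall, dist_eq_norm, e, norm_smul, norm_inv, Real.norm_of_nonneg hD0.le,
        ← hD, inv_mul_cancel₀ hD0.ne']
    simp only [smul_eq_mul, ← hD] at h1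
    have h3 : D * (D⁻¹ * φ w + (1 - D⁻¹) * φ y₀ + D⁻¹ * (1 - D⁻¹) * (m / 2 * D ^ 2)) ≤ D * M :=
      mul_le_mul_of_nonneg_left (h1.trans h2) hD0.le
    have h4 : D * (D⁻¹ * φ w + (1 - D⁻¹) * φ y₀ + D⁻¹ * (1 - D⁻¹) * (m / 2 * D ^ 2))
        = φ w + (D - 1) * φ y₀ + (D - 1) * (m / 2 * D) := by
      field_simp
    have h5 : 2 * (M - φ y₀) < m * (D - 1) := by
      have : 2 * (M - φ y₀) / m < D - 1 := by linarith
      rwa [div_lt_iff₀ hm, mul_comm (D - 1)] at this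
    nlinarith

/-- Variational inequality for a nearest point of a convex set. -/
theorem IsNearest.inner_nonpos {s : Set F} (hs : Convex ℝ s) {v u : F} (h : IsNearest s v u) :
    ∀ w ∈ s, inner ℝ (v - u) (w - u) ≤ 0 := by
  intro w hw
  apply nonpos_of_forall_mul_le_sq_mul (b := ‖w - u‖ ^ 2 / 2)
  intro t ht ht1
  have h1 := h.2 _ (hs.add_smul_sub_mem h.1 hw ⟨ht.le, ht1⟩)
  have e : v - (u + t • (w - u)) = (v - u) - t • (w - u) := by abel
  have h2 : ‖v - u‖ ^ 2 ≤ ‖(v - u) - t • (w - u)‖ ^ 2 := by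
    rw [← e]; gcongr
  rw [norm_sub_sq_real (v - u), inner_smul_right, norm_smul, Real.norm_of_nonneg ht.le] at h2
  nlinarith

end General

/-- Young's inequality applied to every cross term of a step. Here `e`, `k`, `w` are the primal,
dual and centre displacements, `s` and `q` the inverse step sizes, and `d` the distance from the
inner minimizer to the saddle point. -/
theorem step_budget {l s q ζ α μ τ β e k w d : ℝ} (hl : 0 ≤ l) (hs : 0 ≤ s) (hq0 : 0 ≤ q)
    (hζ : 0 ≤ ζ) (hα : 0 ≤ α) (hα1 : α < 1 / 2306) (hτ : 0 ≤ τ) (hβ : 0 ≤ β)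
    (hsl : 3 * l ≤ s) (hq : q = 48 * s + 16 * ζ)
    (hτq : τ * q = 1) (hβμ : β ≤ α * μ * τ) (hβ1 : β ≤ 1 / 18)
    (hd : 4 * μ * (l * d ^ 2) ≤ (s * e + 2 * q * k) ^ 2) :
    s / 8 * e ^ 2 + q / 2 * k ^ 2 + l * β / 2 * w ^ 2 ≤
      s / 2 * e ^ 2 + (q - ζ / 2 - l / 2) * k ^ 2 - 2 * (s * e + l * k) * k
        + (l * β * (2 - 9 * β) * w ^ 2 - 4 * l * β * w * d) := by
  have c4 : 4 * μ * (l * d ^ 2) ≤ 2 * s ^ 2 * e ^ 2 + 8 * q ^ 2 * k ^ 2 :=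
    hd.trans (by linarith [sq_nonneg (s * e - 2 * q * k)])
  -- The factor `μ` in `β ≤ α * μ * τ` cancels the `1/μ` of the dual error bound, and `τ * q = 1`
  -- cancels one factor `q`.
  have c5 : 4 * l * β * d ^ 2 ≤ α * (s * e ^ 2 / 24 + 8 * q * k ^ 2) := by
    have h4 : τ * s ≤ 1 / 48 := by
      have : τ * (48 * s) ≤ τ * q := by gcongr; linarith
      linarith
    calc 4 * l * β * d ^ 2 ≤ 4 * l * (α * μ * τ) * d ^ 2 := by gcongr
      _ = α * τ * (4 * μ * (l * d ^ 2)) := by ring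
      _ ≤ α * τ * (2 * s ^ 2 * e ^ 2 + 8 * q ^ 2 * k ^ 2) := by gcongr
      _ = α * ((τ * s) * (2 * s * e ^ 2) + (τ * q) * (8 * q * k ^ 2)) := by ring
      _ ≤ α * (1 / 48 * (2 * s * e ^ 2) + 1 * (8 * q * k ^ 2)) := by rw [hτq]; gcongr
      _ = _ := by ring
  have c6 : 4 * l * β * w * d ≤ l * β * w ^ 2 + 4 * l * β * d ^ 2 := by
    linarith [mul_nonneg (mul_nonneg hl hβ) (sq_nonneg (w - 2 * d))]
  have c7 : 3 / 2 * (l * β * w ^ 2) ≤ l * β * (2 - 9 * β) * w ^ 2 := by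
    have : 0 ≤ (1 / 2 - 9 * β) * (l * β * w ^ 2) := mul_nonneg (by linarith) (by positivity)
    linarith
  have c8 : 2 * s * e * k ≤ s * e ^ 2 / 4 + 4 * s * k ^ 2 := by
    linarith [mul_nonneg hs (sq_nonneg (e - 4 * k))]
  have c9 : α * (s * e ^ 2 / 24 + 8 * q * k ^ 2) ≤ 1 / 2306 * (s * e ^ 2 / 24 + 8 * q * k ^ 2) := by
    gcongr
  have c10 : 0 ≤ s * e ^ 2 := by positivity
  have c11 : q * k ^ 2 = 48 * (s * k ^ 2) + 16 * (ζ * k ^ 2) := by rw [hq]; ring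
  have c12 : 3 * (l * k ^ 2) ≤ s * k ^ 2 := by rw [← mul_assoc]; gcongr
  have c13 : 0 ≤ ζ * k ^ 2 := by positivity
  have c14 : 0 ≤ s * k ^ 2 := by positivity
  have c15 : 0 ≤ l * k ^ 2 := by positivity
  have c16 : 0 ≤ l * β * w ^ 2 := by positivity
  linarith

/-! ### One-step analysis of the smoothed saddle problem -/

section Abstract

variable {E F : Type*} [NormedAddCommGroup E] [InnerProductSpace ℝ E]
  [NormedAddCommGroup F] [InnerProductSpace ℝ F]

/-- `g` is a global weak subgradient of `h` at `y`, relative to `Y`. -/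
def IsWeakSubgradient (Y : Set F) (h : F → ℝ) (ζ : ℝ) (y g : F) : Prop :=
  y ∈ Y ∧ ∀ w ∈ Y, h y + inner ℝ g (w - y) - ζ / 2 * ‖w - y‖ ^ 2 ≤ h w

/-- `StrongConcaveOn.le_add_inner_sub` puts no sign condition on the modulus, so weak convexity can
be fed to it as strong concavity with modulus `-ζ`. -/
theorem strongConcaveOn_neg_of_weaklyConvex {Y : Set F} {h : F → ℝ} {ζ : ℝ}
    (hh : ConvexOn ℝ Y fun y => h y + ζ / 2 * ‖y‖ ^ 2) :
    StrongConcaveOn Y (-ζ) fun y => -h y := by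
  rw [strongConcaveOn_iff_convex]
  refine hh.neg.congr fun y _ => ?_
  simp only [Pi.neg_apply]
  ring

/-- Minimality provides a quadratic model of `-h` with the crude coefficient `τ⁻¹ / 2`; weak
convexity sharpens it to `ζ / 2`. The step `τ` need not be small. -/
theorem isWeakSubgradient_of_prox {Y : Set F} {h : F → ℝ} {ζ τ : ℝ} (hτ : 0 < τ)
    (hh : ConvexOn ℝ Y fun y => h y + ζ / 2 * ‖y‖ ^ 2) {v y : F} (hy : y ∈ Y)
    (hmin : ∀ w ∈ Y, τ * h y + 1 / 2 * ‖y - v‖ ^ 2 ≤ τ * h w + 1 / 2 * ‖w - v‖ ^ 2) :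
    IsWeakSubgradient Y h ζ y (τ⁻¹ • (v - y)) := by
  refine ⟨hy, fun w hw => ?_⟩
  have := (strongConcaveOn_neg_of_weaklyConvex hh).le_add_inner_sub
    (ξ := -(τ⁻¹ • (v - y))) (K := τ⁻¹ / 2) hy (fun w hw => by
      have h1 := hmin w hw
      have e : w - v = (w - y) - (v - y) := by abel
      have e2 : y - v = -(v - y) := by abel
      rw [e, e2, norm_neg, norm_sub_sq_real (w - y), real_inner_comm] at h1
      rw [inner_neg_left, inner_smul_left]
      have h2 := mul_le_mul_of_nonneg_left h1 (inv_nonneg.2 hτ.le)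
      rw [mul_add, mul_add, inv_mul_cancel_left₀ hτ.ne', inv_mul_cancel_left₀ hτ.ne'] at h2
      simp only [conj_trivial]
      linarith) w hw
  rw [inner_neg_left] at this
  linarith

/-- The prox-gradient step contracts towards a maximizer, up to the Lipschitz factor. -/
theorem prox_gradient_dist_le {Y : Set F} {h : F → ℝ} {ζ τ L : ℝ} (hτ : 0 < τ)
    {y y₁ yo G Go : F}
    (h1 : IsWeakSubgradient Y h ζ y₁ (τ⁻¹ • (y + τ • G - y₁)))
    (ho : IsWeakSubgradient Y h ζ yo Go) (hG : ‖G - Go‖ ≤ L * ‖y - yo‖) :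
    (1 - τ * ζ) * ‖y₁ - yo‖ ≤ (1 + τ * L) * ‖y - yo‖ := by
  have a1 := h1.2 yo ho.1
  have a2 := ho.2 y₁ h1.1
  have e : τ⁻¹ • (y + τ • G - y₁) = τ⁻¹ • (y - yo) - τ⁻¹ • (y₁ - yo) + G := by
    rw [← smul_sub, show y - yo - (y₁ - yo) = y - y₁ by abel,
      show y + τ • G - y₁ = (y - y₁) + τ • G by abel, smul_add, smul_smul,
      inv_mul_cancel₀ hτ.ne', one_smul]
  have e3 : yo - y₁ = -(y₁ - yo) := by abel
  rw [e, e3, inner_neg_right, norm_neg, inner_add_left, inner_sub_left, inner_smul_left,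
    inner_smul_left, real_inner_self_eq_norm_sq] at a1
  simp only [conj_trivial] at a1
  have b1 : inner ℝ (y - yo) (y₁ - yo) ≤ ‖y - yo‖ * ‖y₁ - yo‖ := real_inner_le_norm _ _
  have b2 : inner ℝ (G - Go) (y₁ - yo) ≤ L * ‖y - yo‖ * ‖y₁ - yo‖ :=
    (real_inner_le_norm _ _).trans (mul_le_mul_of_nonneg_right hG (norm_nonneg _))
  rw [inner_sub_left] at b2
  have hτi : 0 < τ⁻¹ := inv_pos.2 hτ
  -- Adding the two weak subgradient inequalities gives monotonicity up to `ζ`; the values of `h`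
  -- cancel.
  have key : (τ⁻¹ - ζ) * ‖y₁ - yo‖ ^ 2 ≤ (τ⁻¹ + L) * ‖y - yo‖ * ‖y₁ - yo‖ := by
    nlinarith
  have key2 : (1 - τ * ζ) * ‖y₁ - yo‖ ^ 2 ≤ (1 + τ * L) * ‖y - yo‖ * ‖y₁ - yo‖ := by
    have := mul_le_mul_of_nonneg_left key hτ.le
    have h3 : τ * τ⁻¹ = 1 := mul_inv_cancel₀ hτ.ne'
    calc (1 - τ * ζ) * ‖y₁ - yo‖ ^ 2 = τ * ((τ⁻¹ - ζ) * ‖y₁ - yo‖ ^ 2) := by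
          rw [← h3]; ring
      _ ≤ _ := this
      _ = _ := by rw [← h3]; ring
  rcases (norm_nonneg (y₁ - yo)).eq_or_lt with h0 | h0
  · have hL : 0 ≤ L * ‖y - yo‖ := (norm_nonneg _).trans hG
    rw [← h0]; nlinarith [norm_nonneg (y - yo)]
  · rw [pow_two, ← mul_assoc] at key2
    exact le_of_mul_le_mul_right key2 h0

/-- Quantitative smoothness and convexity properties of a coupling `g` on `X × S` and of
`g - h` on `X × Y`. -/
structure CouplingBounds (X : Set E) (Y S : Set F) (g : E → F → ℝ) (gx : E → F → E)
    (gy : E → F → F) (h : F → ℝ) (l μ ζ : ℝ) : Prop where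
  convX : Convex ℝ X
  sub : S ⊆ Y
  quadX : ∀ x ∈ X, ∀ x' ∈ X, ∀ y ∈ S,
    |g x' y - g x y - inner ℝ (gx x y) (x' - x)| ≤ l / 2 * ‖x' - x‖ ^ 2
  quadY : ∀ x ∈ X, ∀ y ∈ S, ∀ y' ∈ S,
    |g x y' - g x y - inner ℝ (gy x y) (y' - y)| ≤ l / 2 * ‖y' - y‖ ^ 2
  lipY : ∀ x ∈ X, ∀ x' ∈ X, ∀ y ∈ S, ∀ y' ∈ S,
    ‖gy x y - gy x' y'‖ ≤ l * (‖x - x'‖ + ‖y - y'‖)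
  cross : ∀ x ∈ X, ∀ x' ∈ X, ∀ y ∈ S, ∀ y' ∈ S,
    |(g x y' - g x y) - (g x' y' - g x' y)| ≤ l * ‖x - x'‖ * ‖y' - y‖
  concave : ∀ x ∈ X, StrongConcaveOn Y μ fun y => g x y - h y
  convex : ConvexOn ℝ Y fun y => h y + ζ / 2 * ‖y‖ ^ 2

/-- The regularized coupling with a proximal term centred at `z`. -/
def smoothed (g : E → F → ℝ) (h : F → ℝ) (l : ℝ) (x : E) (y : F) (z : E) : ℝ :=
  g x y + l * ‖x - z‖ ^ 2 - h y

/-- `a` minimizes `smoothed g h l · y z` over `X`. -/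
def IsInnerMin (X : Set E) (g : E → F → ℝ) (h : F → ℝ) (l : ℝ) (y : F) (z a : E) : Prop :=
  a ∈ X ∧ ∀ x ∈ X, smoothed g h l a y z ≤ smoothed g h l x y z

/-- `(a, b)` is a saddle point of `smoothed g h l · · z` on `X × Y`, with `b ∈ S`. -/
structure IsSaddle (X : Set E) (Y S : Set F) (g : E → F → ℝ) (h : F → ℝ) (l : ℝ) (z a : E)
    (b : F) : Prop where
  min : IsInnerMin X g h l b z a
  memS : b ∈ S
  max : ∀ y ∈ Y, smoothed g h l a y z ≤ smoothed g h l a b z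

variable {X : Set E} {Y S : Set F} {g : E → F → ℝ} {gx : E → F → E} {gy : E → F → F}
  {h : F → ℝ} {l μ ζ : ℝ}

theorem norm_sub_sq_expand (x x' z : E) :
    ‖x' - z‖ ^ 2 = ‖x - z‖ ^ 2 + 2 * inner ℝ (x - z) (x' - x) + ‖x' - x‖ ^ 2 := by
  rw [show x' - z = (x - z) + (x' - x) by abel, norm_add_sq_real]

namespace CouplingBounds

/-- The term `l * ‖x - z‖ ^ 2` turns curvature between `-l` and `l` into curvature between `l` and
`3 * l`; the latter is the source of the restriction `τ₁ ≤ 1 / (3 * l)`. -/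
theorem smoothed_quad (H : CouplingBounds X Y S g gx gy h l μ ζ) {x x' z : E} {y : F}
    (hx : x ∈ X) (hx' : x' ∈ X) (hy : y ∈ S) :
    smoothed g h l x y z + inner ℝ (gx x y + (2 * l) • (x - z)) (x' - x) + l / 2 * ‖x' - x‖ ^ 2
        ≤ smoothed g h l x' y z ∧
      smoothed g h l x' y z ≤
        smoothed g h l x y z + inner ℝ (gx x y + (2 * l) • (x - z)) (x' - x)
          + 3 * l / 2 * ‖x' - x‖ ^ 2 := by
  have h1 := abs_le.1 (H.quadX x hx x' hx' y hy)
  rw [inner_add_left, inner_smul_left]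
  simp only [smoothed, conj_trivial]
  rw [norm_sub_sq_expand x x' z]
  constructor <;> nlinarith

theorem smoothed_strongConvexOn (H : CouplingBounds X Y S g gx gy h l μ ζ) {z : E} {y : F}
    (hy : y ∈ S) : StrongConvexOn X l fun x => smoothed g h l x y z :=
  strongConvexOn_of_quadratic_lower (g := fun x => gx x y + (2 * l) • (x - z)) H.convX
    fun _ hx _ hw => (H.smoothed_quad hx hw hy).1

theorem growth (H : CouplingBounds X Y S g gx gy h l μ ζ) {x z a : E} {y : F}
    (hy : y ∈ S) (ha : IsInnerMin X g h l y z a) (hx : x ∈ X) :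
    smoothed g h l a y z + l / 2 * ‖x - a‖ ^ 2 ≤ smoothed g h l x y z :=
  (H.smoothed_strongConvexOn hy).add_le_of_isMin ha.1 ha.2 x hx

theorem smoothed_strongConcaveOn (H : CouplingBounds X Y S g gx gy h l μ ζ) {x z : E}
    (hx : x ∈ X) : StrongConcaveOn Y μ fun y => smoothed g h l x y z := by
  have := (H.concave x hx)
  refine ⟨this.1, fun y hy y' hy' a b ha hb hab => ?_⟩
  have h1 := this.2 hy hy' ha hb hab
  simp only [smoothed, smul_eq_mul] at h1 ⊢
  have : b = 1 - a := by linarith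
  subst this
  nlinarith

theorem saddle_growth (H : CouplingBounds X Y S g gx gy h l μ ζ) {z a : E} {b y : F}
    (hs : IsSaddle X Y S g h l z a b) (hy : y ∈ Y) :
    smoothed g h l a y z ≤ smoothed g h l a b z - μ / 2 * ‖y - b‖ ^ 2 :=
  (H.smoothed_strongConcaveOn hs.min.1).le_sub_of_isMax (H.sub hs.memS) hs.max y hy

/-- The projected gradient step decreases the smoothed coupling. -/
theorem primal_decrease (H : CouplingBounds X Y S g gx gy h l μ ζ) {x x₁ z : E} {y : F} {τ : ℝ}
    (hl : 0 < l) (hτ : 0 < τ) (hτl : τ ≤ 1 / (3 * l))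
    (hx : x ∈ X) (hy : y ∈ S)
    (hx₁ : IsNearest X (x - τ • (gx x y + (2 * l) • (x - z))) x₁) :
    smoothed g h l x₁ y z ≤ smoothed g h l x y z - τ⁻¹ / 2 * ‖x₁ - x‖ ^ 2 := by
  have h1 := (H.smoothed_quad (z := z) hx hx₁.1 hy).2
  have h2 := hx₁.inner_nonpos H.convX x hx
  set G := gx x y + (2 * l) • (x - z)
  have e1 : x - τ • G - x₁ = -(x₁ - x) - τ • G := by abel
  have e2 : x - x₁ = -(x₁ - x) := by abel
  rw [e1, e2, inner_neg_right, inner_sub_left, inner_neg_left, inner_smul_left,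
    real_inner_self_eq_norm_sq] at h2
  simp only [conj_trivial] at h2
  have h3 : inner ℝ G (x₁ - x) ≤ -(τ⁻¹ * ‖x₁ - x‖ ^ 2) := by
    have : τ⁻¹ * (τ * inner ℝ G (x₁ - x)) ≤ τ⁻¹ * (-‖x₁ - x‖ ^ 2) :=
      mul_le_mul_of_nonneg_left (by linarith) (inv_nonneg.2 hτ.le)
    rw [← mul_assoc, inv_mul_cancel₀ hτ.ne'] at this
    linarith
  have h4 : 3 * l ≤ τ⁻¹ := by
    rw [le_inv_comm₀ (by positivity) hτ]; simpa using hτl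
  nlinarith [sq_nonneg ‖x₁ - x‖]

/-- Error bound for the projected gradient step. -/
theorem primal_error (H : CouplingBounds X Y S g gx gy h l μ ζ) {x x₁ z a : E} {y : F} {τ : ℝ}
    (hl : 0 < l) (hτ : 0 < τ) (hτl : τ ≤ 1 / (3 * l))
    (hx : x ∈ X) (hy : y ∈ S)
    (hx₁ : IsNearest X (x - τ • (gx x y + (2 * l) • (x - z))) x₁)
    (ha : IsInnerMin X g h l y z a) :
    l * ‖x₁ - a‖ ≤ τ⁻¹ * ‖x₁ - x‖ := by
  have h1 := (H.smoothed_quad (z := z) hx hx₁.1 hy).2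
  have h1' := (H.smoothed_quad (z := z) hx ha.1 hy).1
  have h2 := hx₁.inner_nonpos H.convX a ha.1
  have h3 := H.growth hy ha hx₁.1
  set G := gx x y + (2 * l) • (x - z)
  set e := x - x₁ with he
  set u := x₁ - a with hu
  have e1 : x - τ • G - x₁ = e - τ • G := by rw [he]; abel
  have e2 : a - x₁ = -u := by rw [hu]; abel
  have e3 : a - x = -(u + e) := by rw [hu, he]; abel
  have e4 : x₁ - x = -e := by rw [he]; abel
  rw [e1, e2, inner_neg_right, inner_sub_left, inner_smul_left] at h2
  rw [e4, inner_neg_right, norm_neg] at h1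
  rw [e3, inner_neg_right, inner_add_right, norm_neg, norm_add_sq_real] at h1'
  simp only [conj_trivial] at h2
  rw [e4, norm_neg]
  set s := τ⁻¹ with hs
  have hsl : 3 * l ≤ s := by
    rw [hs, le_inv_comm₀ (by positivity) hτ]; simpa using hτl
  have h4 : inner ℝ G u ≤ s * inner ℝ e u := by
    have : τ⁻¹ * (τ * inner ℝ G u) ≤ τ⁻¹ * inner ℝ e u :=
      mul_le_mul_of_nonneg_left (by linarith) (inv_nonneg.2 hτ.le)
    rwa [← mul_assoc, inv_mul_cancel₀ hτ.ne', one_mul] at this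
  have h5 : inner ℝ e u ≤ ‖e‖ * ‖u‖ := real_inner_le_norm _ _
  rw [real_inner_comm u e] at h5 h4
  -- Sum of the upper model at `x₁`, the lower model at `a`, the growth at `a` and the projection
  -- inequality tested at `a`.
  have h6 : l * ‖u‖ ^ 2 ≤ (s - l) * (‖e‖ * ‖u‖) + l * ‖e‖ ^ 2 := by
    have := mul_le_mul_of_nonneg_left h5 (show 0 ≤ s - l by linarith)
    nlinarith
  -- If the bound failed then `‖e‖ ≤ ‖u‖`, so `l * ‖e‖ ^ 2` is absorbed by `-l * ‖e‖ * ‖u‖` and the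
  -- failing bound follows after all.
  by_contra! hcon
  have n1 := norm_nonneg e
  have n2 := norm_nonneg u
  have hs0 : 0 < s := by linarith
  have hle : ‖e‖ ≤ ‖u‖ := by
    have : l * ‖e‖ ≤ s * ‖e‖ := mul_le_mul_of_nonneg_right (by linarith) n1
    have : l * ‖e‖ ≤ l * ‖u‖ := by linarith
    exact le_of_mul_le_mul_left this hl
  have hupos : 0 < ‖u‖ := by
    by_contra! h0
    have : ‖u‖ = 0 := le_antisymm h0 n2
    rw [this, mul_zero] at hcon
    nlinarith
  have : l * ‖u‖ ^ 2 ≤ s * ‖e‖ * ‖u‖ := by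
    nlinarith [mul_le_mul_of_nonneg_left hle (mul_nonneg hl.le n1)]
  nlinarith [mul_lt_mul_of_pos_right hcon hupos]

/-- Adding the two growth inequalities cancels `h` and leaves a mixed second difference, which
`cross` bounds. Growth and `cross` share the constant `l`, so the Lipschitz constant is one. -/
theorem innerMin_lipschitz (H : CouplingBounds X Y S g gx gy h l μ ζ) (hl : 0 < l)
    {z a a' : E} {y y' : F} (hy : y ∈ S) (hy' : y' ∈ S) (ha : IsInnerMin X g h l y z a)
    (ha' : IsInnerMin X g h l y' z a') : ‖a' - a‖ ≤ ‖y' - y‖ := by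
  have h1 := H.growth hy ha ha'.1
  have h2 := H.growth hy' ha' ha.1
  have h3 := (abs_le.1 (H.cross a' ha'.1 a ha.1 y hy y' hy')).1
  rw [norm_sub_rev a a'] at h2
  simp only [smoothed] at h1 h2
  have h4 : l * ‖a' - a‖ * ‖a' - a‖ ≤ l * ‖a' - a‖ * ‖y' - y‖ := by nlinarith
  rcases (norm_nonneg (a' - a)).eq_or_lt with h0 | h0
  · rw [← h0]; exact norm_nonneg _
  · exact le_of_mul_le_mul_left h4 (by positivity)

/-- Only the proximal terms survive the addition of the two growth inequalities; their coupling `2 *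
l`, divided by the growth `l`, gives the factor two. -/
theorem innerMin_lipschitz_center (H : CouplingBounds X Y S g gx gy h l μ ζ) (hl : 0 < l)
    {z z' a a' : E} {y : F} (hy : y ∈ S) (ha : IsInnerMin X g h l y z a)
    (ha' : IsInnerMin X g h l y z' a') : ‖a' - a‖ ≤ 2 * ‖z' - z‖ := by
  have h1 := H.growth hy ha ha'.1
  have h2 := H.growth hy ha' ha.1
  rw [norm_sub_rev a a'] at h2
  simp only [smoothed] at h1 h2
  have e1 := norm_sub_sq_expand a a' z
  have e2 := norm_sub_sq_expand a a' z'
  have e3 : inner ℝ (a - z) (a' - a) - inner ℝ (a - z') (a' - a) =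
      inner ℝ (z' - z) (a' - a) := by
    rw [← inner_sub_left]; congr 1; abel
  have h3 : inner ℝ (z' - z) (a' - a) ≤ ‖z' - z‖ * ‖a' - a‖ := real_inner_le_norm _ _
  have h4 : l * ‖a' - a‖ * ‖a' - a‖ ≤ l * ‖a' - a‖ * (2 * ‖z' - z‖) := by nlinarith
  rcases (norm_nonneg (a' - a)).eq_or_lt with h0 | h0
  · rw [← h0]; positivity
  · exact le_of_mul_le_mul_left h4 (by positivity)

/-- The dual step increases the smoothed dual function enough to pay for the change of the
smoothed coupling. -/
theorem dual_step (H : CouplingBounds X Y S g gx gy h l μ ζ)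
    {x₁ z a a₁ : E} {y y₁ : F} {τ : ℝ} (hτ : 0 < τ)
    (hx₁ : x₁ ∈ X) (hy : y ∈ S) (hy₁ : y₁ ∈ S)
    (ha : IsInnerMin X g h l y z a) (ha₁ : IsInnerMin X g h l y₁ z a₁)
    (hsub : IsWeakSubgradient Y h ζ y₁ (τ⁻¹ • (y + τ • gy x₁ y - y₁))) :
    (τ⁻¹ - ζ / 2 - l / 2) * ‖y₁ - y‖ ^ 2 - 2 * l * ‖x₁ - a₁‖ * ‖y₁ - y‖ ≤
      smoothed g h l x₁ y z - smoothed g h l x₁ y₁ z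
        + 2 * (smoothed g h l a₁ y₁ z - smoothed g h l a y z) := by
  -- Testing minimality at `a₁` leaves the `y`-increment at `a₁`, which `cross` moves to `x₁` with
  -- error `l * ‖x₁ - a₁‖ * ‖y₁ - y‖`. The weight two leaves one net copy of the ascent at `x₁`
  -- after the change of the coupling is paid.
  have h1 := ha.2 a₁ ha₁.1
  have h2 := (abs_le.1 (H.cross x₁ hx₁ a₁ ha₁.1 y hy y₁ hy₁)).2
  have h3 := (abs_le.1 (H.quadY x₁ hx₁ y hy y₁ hy₁)).1
  have h4 := hsub.2 y (H.sub hy)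
  have e : τ⁻¹ • (y + τ • gy x₁ y - y₁) = -(τ⁻¹ • (y₁ - y)) + gy x₁ y := by
    rw [show y + τ • gy x₁ y - y₁ = -(y₁ - y) + τ • gy x₁ y by abel, smul_add, smul_smul,
      inv_mul_cancel₀ hτ.ne', one_smul, smul_neg]
  rw [e, show y - y₁ = -(y₁ - y) by abel, inner_neg_right, norm_neg, inner_add_left,
    inner_neg_left, inner_smul_left, real_inner_self_eq_norm_sq] at h4
  simp only [conj_trivial] at h4
  simp only [smoothed] at h1 ⊢
  nlinarith

/-- Dual error bound. -/
theorem dual_error (H : CouplingBounds X Y S g gx gy h l μ ζ) (hl : 0 < l) (hμ : 0 < μ)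
    {x₁ z a₁ xs : E} {y y₁ ys : F} {τ M : ℝ} (hτ : 0 < τ)
    (hx₁ : x₁ ∈ X) (hy : y ∈ S) (hy₁ : y₁ ∈ S)
    (ha₁ : IsInnerMin X g h l y₁ z a₁) (hs : IsSaddle X Y S g h l z xs ys)
    (hsub : IsWeakSubgradient Y h ζ y₁ (τ⁻¹ • (y + τ • gy x₁ y - y₁)))
    (hquad : ∀ w ∈ Y, g a₁ w ≤ g a₁ y₁ + inner ℝ (gy a₁ y₁) (w - y₁) + M * ‖w - y₁‖ ^ 2) :
    4 * μ * (l * ‖xs - a₁‖ ^ 2) ≤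
      (l * (‖x₁ - a₁‖ + ‖y₁ - y‖) + τ⁻¹ * ‖y₁ - y‖) ^ 2 := by
  have h1 := H.growth hs.memS hs.min ha₁.1
  have h2 := H.growth hy₁ ha₁ hs.min.1
  have h3 := H.saddle_growth hs (H.sub hy₁)
  rw [norm_sub_rev a₁ xs] at h1
  set ξ := gy a₁ y₁ - τ⁻¹ • (y + τ • gy x₁ y - y₁) with hξ
  -- The vector `ξ` combines the gradient at `y₁` with the weak subgradient from the prox step;
  -- strong concavity replaces the crude coefficient `M + ζ / 2` by `-μ / 2`.
  have h4 := (H.smoothed_strongConcaveOn (z := z) ha₁.1).le_add_inner_sub (ξ := ξ)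
    (K := M + ζ / 2) (H.sub hy₁) (fun w hw => by
      have b1 := hquad w hw
      have b2 := hsub.2 w hw
      rw [hξ, inner_sub_left]
      simp only [smoothed]
      nlinarith) ys (H.sub hs.memS)
  rw [norm_sub_rev ys y₁] at h4
  have h5 : inner ℝ ξ (ys - y₁) ≤ ‖ξ‖ * ‖y₁ - ys‖ := by
    rw [norm_sub_rev y₁ ys]; exact real_inner_le_norm _ _
  -- Growth in `x` at both minimizers and strong concavity in `y` at both `xs` and `a₁`, summed
  -- around the four corners.
  have h6 : l * ‖xs - a₁‖ ^ 2 + μ * ‖y₁ - ys‖ ^ 2 ≤ ‖ξ‖ * ‖y₁ - ys‖ := by nlinarith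
  have h7 : ‖ξ‖ ≤ l * (‖x₁ - a₁‖ + ‖y₁ - y‖) + τ⁻¹ * ‖y₁ - y‖ := by
    have e : ξ = (gy a₁ y₁ - gy x₁ y) + τ⁻¹ • (y₁ - y) := by
      rw [hξ, show y + τ • gy x₁ y - y₁ = -(y₁ - y) + τ • gy x₁ y by abel, smul_add, smul_smul,
        inv_mul_cancel₀ hτ.ne', one_smul, smul_neg]
      abel
    rw [e]
    refine (norm_add_le _ _).trans (add_le_add ?_ ?_)
    · have := H.lipY a₁ ha₁.1 x₁ hx₁ y₁ hy₁ y hy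
      rwa [norm_sub_rev a₁ x₁] at this
    · rw [norm_smul, Real.norm_of_nonneg (inv_nonneg.2 hτ.le)]
  -- Eliminates the dual distance by completing the square.
  have h8 : 4 * μ * (l * ‖xs - a₁‖ ^ 2) ≤ ‖ξ‖ ^ 2 := by
    nlinarith [sq_nonneg (‖ξ‖ - 2 * μ * ‖y₁ - ys‖)]
  exact h8.trans (by gcongr)

/-- Effect of moving the proximal centre. -/
theorem center_step (H : CouplingBounds X Y S g gx gy h l μ ζ) (hl : 0 < l)
    {x₁ z z₁ a₁ a₂ xs xs₁ : E} {y₁ ys ys₁ : F} {β : ℝ} (hβ : 0 ≤ β)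
    (hy₁ : y₁ ∈ S)
    (ha₁ : IsInnerMin X g h l y₁ z a₁) (ha₂ : IsInnerMin X g h l y₁ z₁ a₂)
    (hs : IsSaddle X Y S g h l z xs ys) (hs₁ : IsSaddle X Y S g h l z₁ xs₁ ys₁)
    (hz : z₁ = z + β • (x₁ - z)) :
    l * β * (2 - 9 * β) * ‖x₁ - z‖ ^ 2 - 4 * l * β * ‖x₁ - z‖ * ‖xs - a₁‖ ≤
      smoothed g h l x₁ y₁ z - smoothed g h l x₁ y₁ z₁
        + 2 * (smoothed g h l a₂ y₁ z₁ - smoothed g h l a₁ y₁ z)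
        + 2 * (smoothed g h l xs ys z - smoothed g h l xs₁ ys₁ z₁) := by
  -- Each optimal value is compared at a common test point, so only differences of `l * ‖v - z‖ ^ 2`
  -- remain, at `v = a₂` and `v = xs`. Their first-order parts differ by `inner ℝ (a₂ - xs) w`.
  have h1 := ha₁.2 a₂ ha₂.1
  have h2 := hs₁.min.2 xs hs.min.1
  have h3 := hs.max ys₁ (H.sub hs₁.memS)
  have h4 := H.innerMin_lipschitz_center hl hy₁ ha₁ ha₂
  set w := x₁ - z with hw
  have e0 : z₁ - z = β • w := by rw [hz]; abel
  rw [e0, norm_smul, Real.norm_of_nonneg hβ] at h4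
  have e1 : ‖x₁ - z₁‖ ^ 2 = (1 - β) ^ 2 * ‖w‖ ^ 2 := by
    rw [show x₁ - z₁ = (1 - β) • w by rw [hz, hw]; simp only [sub_smul, one_smul]; abel,
      norm_smul, mul_pow, Real.norm_eq_abs, sq_abs]
  have e2 : ∀ v : E, ‖v - z₁‖ ^ 2 = ‖v - z‖ ^ 2 - 2 * β * inner ℝ (v - z) w
      + β ^ 2 * ‖w‖ ^ 2 := by
    intro v
    rw [show v - z₁ = (v - z) - β • w by rw [← e0]; abel, norm_sub_sq_real, inner_smul_right,
      norm_smul, mul_pow, Real.norm_eq_abs, sq_abs]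
    ring
  -- The drift `2 * β * ‖w‖` of the inner minimizer contributes eight of the nine in `2 - 9 * β`;
  -- expanding `(1 - β) ^ 2` contributes the other.
  have e3 : inner ℝ (a₂ - z) w - inner ℝ (xs - z) w ≤ (2 * β * ‖w‖ + ‖xs - a₁‖) * ‖w‖ := by
    rw [← inner_sub_left]
    refine (real_inner_le_norm _ _).trans (mul_le_mul_of_nonneg_right ?_ (norm_nonneg _))
    rw [show a₂ - z - (xs - z) = (a₂ - a₁) - (xs - a₁) by abel]
    refine (norm_sub_le _ _).trans ?_
    linarith
  have e4 := mul_le_mul_of_nonneg_left e3 (show 0 ≤ 4 * l * β by positivity)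
  simp only [smoothed] at *
  rw [e1]
  rw [e2 a₂]
  rw [e2 xs] at h2
  nlinarith

/-- The one-step decrease of the potential function. -/
theorem one_step (H : CouplingBounds X Y S g gx gy h l μ ζ) (hl : 0 < l) (hμ : 0 < μ)
    (hζ : 0 ≤ ζ) {α τ₁ τ₂ β M : ℝ} (hα : 0 < α) (hα1 : α < 1 / 2306)
    (hτ₁ : 0 < τ₁) (hτl : τ₁ ≤ 1 / (3 * l)) (hτ₂ : τ₂ = 1 / 16 * (3 / τ₁ + ζ)⁻¹)
    (hβ : β = α * min μ l * τ₂)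
    {x x₁ z z₁ a a₁ a₂ xs xs₁ : E} {y y₁ ys ys₁ : F}
    (hx : x ∈ X) (hy : y ∈ S) (hy₁ : y₁ ∈ S)
    (ha : IsInnerMin X g h l y z a) (ha₁ : IsInnerMin X g h l y₁ z a₁)
    (ha₂ : IsInnerMin X g h l y₁ z₁ a₂)
    (hs : IsSaddle X Y S g h l z xs ys) (hs₁ : IsSaddle X Y S g h l z₁ xs₁ ys₁)
    (hx₁ : IsNearest X (x - τ₁ • (gx x y + (2 * l) • (x - z))) x₁)
    (hsub : IsWeakSubgradient Y h ζ y₁ (τ₂⁻¹ • (y + τ₂ • gy x₁ y - y₁)))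
    (hz : z₁ = z + β • (x₁ - z))
    (hquad : ∀ w ∈ Y, g a₁ w ≤ g a₁ y₁ + inner ℝ (gy a₁ y₁) (w - y₁) + M * ‖w - y₁‖ ^ 2) :
    τ₁⁻¹ / 8 * ‖x₁ - x‖ ^ 2 + τ₂⁻¹ / 2 * ‖y₁ - y‖ ^ 2 + l * β / 2 * ‖x₁ - z‖ ^ 2 ≤
      (smoothed g h l x y z - 2 * smoothed g h l a y z + 2 * smoothed g h l xs ys z) -
      (smoothed g h l x₁ y₁ z₁ - 2 * smoothed g h l a₂ y₁ z₁
        + 2 * smoothed g h l xs₁ ys₁ z₁) := by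
  set s := τ₁⁻¹ with hsdef
  have hs0 : 0 < s := inv_pos.2 hτ₁
  have hsl : 3 * l ≤ s := by
    rw [hsdef, le_inv_comm₀ (by positivity) hτ₁]; simpa using hτl
  have hden : 0 < 3 / τ₁ + ζ := by positivity
  have hτ₂0 : 0 < τ₂ := by rw [hτ₂]; positivity
  set q := τ₂⁻¹ with hqdef
  have hq : q = 48 * s + 16 * ζ := by
    rw [hqdef, hτ₂, mul_inv, inv_inv, hsdef]; field_simp; ring
  have hq0 : 0 < q := inv_pos.2 hτ₂0
  have hτq : τ₂ * q = 1 := mul_inv_cancel₀ hτ₂0.ne'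
  have hmin0 : 0 < min μ l := lt_min hμ hl
  have hβ0 : 0 < β := by rw [hβ]; positivity
  have hβμ : β ≤ α * μ * τ₂ := by
    rw [hβ]; gcongr; exact min_le_left _ _
  have hβl : β ≤ α * l * τ₂ := by
    rw [hβ]; gcongr; exact min_le_right _ _
  have hlτ : l * τ₂ ≤ 1 / 144 := by
    have : 144 * l ≤ q := by linarith
    nlinarith
  have hβ1 : β ≤ 1 / 18 := by
    have : α * l * τ₂ ≤ 1 / 2306 * (1 / 144) := by rw [mul_assoc]; gcongr
    linarith
  have b1 := H.primal_decrease hl hτ₁ hτl hx hy hx₁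
  have b2 := H.dual_step hτ₂0 hx₁.1 hy hy₁ ha ha₁ hsub
  have b3 := H.center_step hl hβ0.le hy₁ ha₁ ha₂ hs hs₁ hz
  have b4 := H.dual_error hl hμ hτ₂0 hx₁.1 hy hy₁ ha₁ hs hsub hquad
  have b5 := H.primal_error hl hτ₁ hτl hx hy hx₁ ha
  have b6 := H.innerMin_lipschitz hl hy hy₁ ha ha₁
  have b7 : ‖x₁ - a₁‖ ≤ ‖x₁ - a‖ + ‖a₁ - a‖ := by
    rw [show x₁ - a₁ = (x₁ - a) - (a₁ - a) by abel]; exact norm_sub_le _ _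
  set e := ‖x₁ - x‖
  set k := ‖y₁ - y‖
  set w := ‖x₁ - z‖
  set d := ‖xs - a₁‖
  have he : 0 ≤ e := norm_nonneg _
  have hk : 0 ≤ k := norm_nonneg _
  have hw : 0 ≤ w := norm_nonneg _
  have hd : 0 ≤ d := norm_nonneg _
  have b8 : l * ‖x₁ - a₁‖ ≤ s * e + l * k := by
    have : l * ‖x₁ - a₁‖ ≤ l * (‖x₁ - a‖ + k) := by gcongr; linarith
    linarith
  have c2 : 2 * l * ‖x₁ - a₁‖ * k ≤ 2 * (s * e + l * k) * k := by
    rw [mul_assoc 2 l]; gcongr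
  have c3 : l * (‖x₁ - a₁‖ + k) + q * k ≤ s * e + 2 * q * k := by
    have : 2 * l * k ≤ q * k := by gcongr; linarith
    linarith
  have c4 : 4 * μ * (l * d ^ 2) ≤ (s * e + 2 * q * k) ^ 2 := b4.trans (by gcongr)
  have := step_budget (w := w) hl.le hs0.le hq0.le hζ hα.le hα1 hτ₂0.le hβ0.le hsl hq hτq hβμ hβ1 c4
  linarith

/-- A minimizer of the smoothed primal function gives a saddle point. -/
theorem isSaddle_of_isMin (H : CouplingBounds X Y S g gx gy h l μ ζ) {yhat : E → F}
    (hS : ∀ x ∈ X, yhat x ∈ S) (hmax : ∀ x ∈ X, ∀ y ∈ Y, g x y - h y ≤ g x (yhat x) - h (yhat x))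
    (hyhat : ContinuousOn yhat X) (hcont : ∀ x ∈ X, ContinuousOn (fun y => g x y - h y) Y)
    {z a : E} (ha : a ∈ X)
    (hmin : ∀ x ∈ X, smoothed g h l a (yhat a) z ≤ smoothed g h l x (yhat x) z) (hl : 0 ≤ l) :
    IsSaddle X Y S g h l z a (yhat a) := by
  have hmax' : ∀ x ∈ X, ∀ y ∈ Y, smoothed g h l x y z ≤ smoothed g h l x (yhat x) z := by
    intro x hx y hy
    have := hmax x hx y hy
    simp only [smoothed]; linarith
  refine ⟨⟨ha, fun x hx => ?_⟩, hS a ha, hmax' a ha⟩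
  have hseg : ∀ t ∈ Icc (0 : ℝ) 1, a + t • (x - a) ∈ X := fun t ht =>
    H.convX.add_smul_sub_mem ha hx ht
  have hc1 : ContinuousOn (fun t : ℝ => yhat (a + t • (x - a))) (Icc 0 1) :=
    hyhat.comp (by fun_prop) hseg
  have hc2 : ContinuousOn (fun t : ℝ => g x (yhat (a + t • (x - a))) - h (yhat (a + t • (x - a))))
      (Icc 0 1) := (hcont x hx).comp hc1 fun t ht => H.sub (hS _ (hseg t ht))
  have hlim : Tendsto (fun t : ℝ => smoothed g h l x (yhat (a + t • (x - a))) z) (𝓝[Ioc 0 1] 0)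
      (𝓝 (smoothed g h l x (yhat a) z)) := by
    have h1 := (hc2 0 (left_mem_Icc.2 zero_le_one)).mono_left (nhdsWithin_mono _ Ioc_subset_Icc_self)
    have h2 := h1.add_const (l * ‖x - z‖ ^ 2)
    simp only [zero_smul, add_zero] at h2
    refine (h2.congr fun t => ?_).trans_eq ?_
    · simp only [smoothed]; ring
    · congr 1; simp only [smoothed]; ring
  have : (𝓝[Ioc (0 : ℝ) 1] 0).NeBot := by
    rw [← mem_closure_iff_nhdsWithin_neBot, closure_Ioc zero_ne_one]
    exact left_mem_Icc.2 zero_le_one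
  -- A minimax argument by a one-sided limit: convexity along the segment, with the maximizer at the
  -- intermediate point as dual variable, yields `φ(a, ŷ(a)) ≤ φ(x, ŷ(xt))`; then `t → 0`.
  refine ge_of_tendsto hlim ?_
  filter_upwards [self_mem_nhdsWithin] with t ht
  have htm : t ∈ Icc (0 : ℝ) 1 := Ioc_subset_Icc_self ht
  set xt := a + t • (x - a) with hxt
  have hxtm := hseg t htm
  have h1 := hmin xt hxtm
  have h2 := hmax' a ha (yhat xt) (H.sub (hS xt hxtm))
  have h3 := ((H.smoothed_strongConvexOn (z := z) (hS xt hxtm)).convexOn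
    (fun r => by positivity)).2 hx ha ht.1.le (sub_nonneg.2 ht.2) (by ring)
  have e : t • x + (1 - t) • a = xt := by
    rw [hxt]; simp only [smul_sub, sub_smul, one_smul]; abel
  rw [e] at h3
  simp only [smul_eq_mul] at h3
  have h4 : t * smoothed g h l a (yhat a) z ≤ t * smoothed g h l x (yhat xt) z := by
    linarith [mul_le_mul_of_nonneg_left h2 (sub_nonneg.2 ht.2)]
  exact le_of_mul_le_mul_left h4 ht.1

/-- Distances to the saddle point are controlled by the potential. -/
theorem dist_le_of_potential (H : CouplingBounds X Y S g gx gy h l μ ζ)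
    {x z a xs : E} {y ys : F} {B P : ℝ} (hx : x ∈ X) (hy : y ∈ S)
    (ha : IsInnerMin X g h l y z a) (hs : IsSaddle X Y S g h l z xs ys)
    (hB : smoothed g h l x y z - 2 * smoothed g h l a y z + 2 * smoothed g h l xs ys z ≤ B)
    (hP : P ≤ smoothed g h l xs ys z) :
    l * ‖x - xs‖ ^ 2 ≤ 4 * (B - P) := by
  -- The potential minus the saddle value is the sum of two gaps over the inner minimum, each with
  -- quadratic growth from `a`; the triangle inequality then passes through `a`.
  have h1 := H.growth hy ha hx
  have h2 := H.growth hy ha hs.min.1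
  have h3 := hs.max y (H.sub hy)
  have h4 : ‖x - xs‖ ^ 2 ≤ 2 * ‖x - a‖ ^ 2 + 2 * ‖xs - a‖ ^ 2 := by
    rw [show x - xs = (x - a) - (xs - a) by abel, norm_sub_sq_real]
    have := norm_add_sq_real (x - a) (xs - a)
    nlinarith [sq_nonneg ‖(x - a) + (xs - a)‖]
  rcases le_or_gt 0 l with hl | hl
  · nlinarith [mul_le_mul_of_nonneg_left h4 hl]
  · have := ha.2 x hx
    have := ha.2 xs hs.min.1
    nlinarith [sq_nonneg ‖x - xs‖]

/-- The dual gap alone carries the growth. Only `y ∈ Y` is assumed, not `y ∈ S`, because this bound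
serves to confine the dual iterates to `S`. -/
theorem dual_dist_le_of_potential (H : CouplingBounds X Y S g gx gy h l μ ζ)
    {x z a xs : E} {y ys : F} {B P : ℝ} (hx : x ∈ X) (hy : y ∈ Y)
    (ha : IsInnerMin X g h l y z a) (hs : IsSaddle X Y S g h l z xs ys)
    (hB : smoothed g h l x y z - 2 * smoothed g h l a y z + 2 * smoothed g h l xs ys z ≤ B)
    (hP : P ≤ smoothed g h l xs ys z) :
    μ / 2 * ‖y - ys‖ ^ 2 ≤ B - P := by
  have h1 := ha.2 x hx
  have h2 := ha.2 xs hs.min.1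
  have h3 := H.saddle_growth hs hy
  linarith

end CouplingBounds

end Abstract

/-! ### Matrix calculus for the dissolving operator and the penalty -/

section Matrices

variable {d r s : ℕ}

@[simp] theorem toM_ofM (M : Matrix (Fin d) (Fin r) ℝ) : toM (ofM M) = M := rfl

@[simp] theorem ofM_toM (x : Mat d r) : ofM (toM x) = x := rfl

theorem ofM_add (M N : Matrix (Fin d) (Fin r) ℝ) : ofM (M + N) = ofM M + ofM N := rfl

theorem ofM_sub (M N : Matrix (Fin d) (Fin r) ℝ) : ofM (M - N) = ofM M - ofM N := rfl

theorem ofM_smul (a : ℝ) (M : Matrix (Fin d) (Fin r) ℝ) : ofM (a • M) = a • ofM M := rfl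

theorem toM_add (x y : Mat d r) : toM (x + y) = toM x + toM y := rfl

theorem toM_smul (a : ℝ) (x : Mat d r) : toM (a • x) = a • toM x := rfl

theorem inner_eq_trace (x y : Mat d r) :
    inner ℝ x y = ((toM x).transpose * toM y).trace := by
  simp only [PiLp.inner_apply, Matrix.trace, Matrix.diag_apply, Matrix.mul_apply,
    Matrix.transpose_apply, toM, Matrix.of_apply]
  rw [Fintype.sum_prod_type, Finset.sum_comm]
  simp [mul_comm]

theorem norm_sq_eq_trace (x : Mat d r) : ‖x‖ ^ 2 = ((toM x).transpose * toM x).trace := by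
  rw [← inner_eq_trace, real_inner_self_eq_norm_sq]

open scoped Matrix.Norms.Frobenius in
theorem norm_ofM_eq (M : Matrix (Fin d) (Fin r) ℝ) : ‖ofM M‖ = ‖M‖ := by
  rw [Matrix.frobenius_norm_def, EuclideanSpace.norm_eq, Real.sqrt_eq_rpow, Fintype.sum_prod_type]
  simp [ofM]

theorem norm_ofM_mul_le (M : Matrix (Fin d) (Fin r) ℝ) (N : Matrix (Fin r) (Fin s) ℝ) :
    ‖ofM (M * N)‖ ≤ ‖ofM M‖ * ‖ofM N‖ := by
  rw [norm_ofM_eq, norm_ofM_eq, norm_ofM_eq]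
  exact Matrix.frobenius_norm_mul M N

/-- Matrix multiplication as a continuous bilinear map. -/
def mulL (d r s : ℕ) : Mat d r →L[ℝ] Mat r s →L[ℝ] Mat d s :=
  (LinearMap.mk₂ ℝ (fun x y => ofM (toM x * toM y))
    (fun x x' y => by rw [toM_add, Matrix.add_mul, ofM_add])
    (fun a x y => by rw [toM_smul, Matrix.smul_mul, ofM_smul])
    (fun x y y' => by rw [toM_add, Matrix.mul_add, ofM_add])
    (fun a x y => by rw [toM_smul, Matrix.mul_smul, ofM_smul])).mkContinuous₂ 1
    fun x y => by rw [one_mul]; exact norm_ofM_mul_le _ _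

theorem mulL_apply (x : Mat d r) (y : Mat r s) : mulL d r s x y = ofM (toM x * toM y) := rfl

/-- Matrix transposition as a continuous linear map. -/
def transposeL (d r : ℕ) : Mat d r →L[ℝ] Mat r d :=
  LinearMap.toContinuousLinearMap
    { toFun := fun x => ofM (toM x).transpose
      map_add' := fun _ _ => rfl
      map_smul' := fun _ _ => rfl }

theorem transposeL_apply (x : Mat d r) : transposeL d r x = ofM (toM x).transpose := rfl

theorem constr_eq (x : Mat d r) :
    constr x = mulL r d r (transposeL d r x) x - ofM 1 := rfl

/-- In terms of bounded multilinear operations, smoothness becomes automatic. -/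
theorem dissolve_eq (x : Mat d r) :
    dissolve x = (3 / 2 : ℝ) • x
      - (1 / 2 : ℝ) • mulL d r r x (mulL r d r (transposeL d r x) x) := by
  simp only [dissolve, mulL_apply, transposeL_apply, toM_ofM, Matrix.mul_sub, Matrix.mul_smul,
    Matrix.mul_one, ofM_sub, ofM_smul, ofM_toM]

theorem dissolveGrad_eq (x u : Mat d r) :
    dissolveGrad x u = (3 / 2 : ℝ) • u
      - (1 / 2 : ℝ) • mulL d r r u (mulL r d r (transposeL d r x) x)
      - (1 / 2 : ℝ) • mulL d r r x (mulL r d r (transposeL d r x) u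
          + transposeL r r (mulL r d r (transposeL d r x) u)) := by
  simp only [dissolveGrad, symPart, mulL_apply, transposeL_apply, toM_ofM, Matrix.mul_sub,
    Matrix.mul_smul, Matrix.mul_one, ofM_sub, ofM_smul, ofM_toM, toM_add]

theorem contDiff_dissolve : ContDiff ℝ 1 (dissolve : Mat d r → Mat d r) := by
  simp only [funext dissolve_eq]
  fun_prop

theorem contDiff_constr : ContDiff ℝ 1 (constr : Mat d r → Mat r r) := by
  simp only [funext constr_eq]
  fun_prop

theorem contDiff_dissolveGrad :
    ContDiff ℝ 1 (fun p : Mat d r × Mat d r => dissolveGrad p.1 p.2) := by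
  simp only [dissolveGrad_eq]
  fun_prop

theorem hasFDerivAt_gram (x : Mat d r) :
    ∃ L : Mat d r →L[ℝ] Mat r r,
      HasFDerivAt (fun x => mulL r d r (transposeL d r x) x) L x ∧
      ∀ v, L v = ofM ((toM v).transpose * toM x + (toM x).transpose * toM v) := by
  refine ⟨_, (mulL r d r).hasFDerivAt_of_bilinear (transposeL d r).hasFDerivAt
    (hasFDerivAt_id x), fun v => ?_⟩
  simp [mulL_apply, transposeL_apply, ofM_add, add_comm]

theorem hasFDerivAt_constr (x : Mat d r) :
    ∃ L : Mat d r →L[ℝ] Mat r r, HasFDerivAt constr L x ∧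
      ∀ v, L v = ofM ((toM v).transpose * toM x + (toM x).transpose * toM v) := by
  obtain ⟨L, hL, h⟩ := hasFDerivAt_gram x
  exact ⟨L, (hL.sub_const (ofM 1)).congr_of_eventuallyEq (Eventually.of_forall constr_eq), h⟩

theorem hasFDerivAt_dissolve (x : Mat d r) :
    ∃ L : Mat d r →L[ℝ] Mat d r, HasFDerivAt dissolve L x ∧
      ∀ v, L v = ofM (toM v * ((3 / 2 : ℝ) • (1 : Matrix (Fin r) (Fin r) ℝ)
        - (1 / 2 : ℝ) • ((toM x).transpose * toM x))
        - (1 / 2 : ℝ) • (toM x * ((toM v).transpose * toM x + (toM x).transpose * toM v))) := by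
  obtain ⟨L, hL, h⟩ := hasFDerivAt_gram x
  have h1 := ((mulL d r r).hasFDerivAt_of_bilinear (hasFDerivAt_id x) hL).const_smul (1 / 2 : ℝ)
  have h2 := ((hasFDerivAt_id (𝕜 := ℝ) x).const_smul (3 / 2 : ℝ)).sub h1
  refine ⟨_, h2.congr_of_eventuallyEq (Eventually.of_forall dissolve_eq), fun v => ?_⟩
  simp only [id_eq, _root_.sub_apply, _root_.smul_apply,
    ContinuousLinearMap.id_apply, _root_.add_apply,
    ContinuousLinearMap.precompR_apply, ContinuousLinearMap.precompL_apply,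
    ContinuousLinearMap.compL_apply, ContinuousLinearMap.comp_apply, h, mulL_apply,
    transposeL_apply, toM_ofM]
  simp only [Matrix.mul_sub, Matrix.mul_add, Matrix.mul_smul, Matrix.mul_one, ofM_sub, ofM_smul, ofM_add,
    ofM_toM, smul_add]
  abel

/-- `dissolveGrad x` is the adjoint of the derivative of `dissolve` at `x`. -/
theorem inner_dissolveGrad (x u v : Mat d r) :
    inner ℝ (dissolveGrad x u) v =
      inner ℝ u (ofM (toM v * ((3 / 2 : ℝ) • (1 : Matrix (Fin r) (Fin r) ℝ)
        - (1 / 2 : ℝ) • ((toM x).transpose * toM x))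
        - (1 / 2 : ℝ) • (toM x * ((toM v).transpose * toM x + (toM x).transpose * toM v)))) := by
  simp only [inner_eq_trace, dissolveGrad, toM_ofM, symPart]
  generalize toM x = X
  generalize toM u = U
  generalize toM v = V
  simp only [Matrix.transpose_sub, Matrix.transpose_mul, Matrix.transpose_smul,
    Matrix.transpose_add, Matrix.transpose_transpose, Matrix.sub_mul,
    Matrix.mul_sub, Matrix.mul_add, Matrix.add_mul, Matrix.mul_smul, Matrix.smul_mul,
    Matrix.trace_sub, Matrix.trace_add, Matrix.trace_smul, Matrix.mul_one, smul_eq_mul]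
  have e1 : (X.transpose * X * U.transpose * V).trace
      = (U.transpose * (V * (X.transpose * X))).trace := by
    rw [Matrix.mul_assoc, Matrix.trace_mul_comm, Matrix.mul_assoc]
  have e3 : (X.transpose * U * X.transpose * V).trace
      = (U.transpose * (X * (V.transpose * X))).trace := by
    rw [← Matrix.trace_transpose]
    simp only [Matrix.transpose_mul, Matrix.transpose_transpose, Matrix.mul_assoc]
    rw [Matrix.trace_mul_comm]
    simp only [Matrix.mul_assoc]
    rw [Matrix.trace_mul_comm]
    simp only [Matrix.mul_assoc]
  simp only [Matrix.mul_assoc] at e1 e3 ⊢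
  linarith

theorem constrGrad_constr (x : Mat d r) (a : ℝ) :
    (a / 2) • constrGrad x (constr x) = a • ofM (toM x * toM (constr x)) := by
  rw [constrGrad, ofM_smul, smul_smul]
  congr 1
  ring

theorem transpose_toM_constr (x : Mat d r) : (toM (constr x)).transpose = toM (constr x) := by
  simp [constr, Matrix.transpose_mul]

/-- The gradient of the penalty function in the primal variable. -/
theorem hasGradientAt_pen {m : ℕ} {f : Mat d r → Vec m → ℝ} {x : Mat d r} {y : Vec m} (ρ : ℝ)
    (hf : HasGradientAt (fun u => f u y) (gradX f (dissolve x) y) (dissolve x)) :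
    HasGradientAt (fun x => pen f ρ x y) (penGradX f ρ x y) x := by
  obtain ⟨L, hL, hLv⟩ := hasFDerivAt_dissolve x
  obtain ⟨M, hM, hMv⟩ := hasFDerivAt_constr x
  have h1 : HasFDerivAt (fun x => f (dissolve x) y) _ x := hf.hasFDerivAt.comp x hL
  have h2 := (hM.norm_sq).const_mul (ρ / 4)
  rw [hasGradientAt_iff_hasFDerivAt]
  refine (h1.add h2).congr_fderiv ?_
  ext v
  simp only [_root_.add_apply, ContinuousLinearMap.comp_apply,
    _root_.smul_apply, InnerProductSpace.toDual_apply_apply, hLv, penGradX,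
    inner_add_left, inner_dissolveGrad, constrGrad_constr, inner_smul_left]
  congr 1
  simp only [innerSL_apply_apply, hMv, smul_eq_mul, conj_trivial, inner_eq_trace, toM_ofM,
    transpose_toM_constr, Matrix.transpose_mul]
  rw [Matrix.mul_add, Matrix.trace_add]
  -- Since `c` is symmetric, both halves of the derivative of the Gram matrix contribute equally.
  have : (toM (constr x) * ((toM v).transpose * toM x)).trace =
      (toM (constr x) * ((toM x).transpose * toM v)).trace := by
    rw [← Matrix.trace_transpose, Matrix.transpose_mul, Matrix.transpose_mul,
      Matrix.transpose_transpose, transpose_toM_constr, Matrix.trace_mul_comm]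
  rw [this, Matrix.mul_assoc, nsmul_eq_mul]
  push_cast
  ring

end Matrices

/-! ### Geometry near the Stiefel manifold -/

section Stiefel

variable {d r : ℕ}

theorem mem_stiefel {x : Mat d r} : x ∈ stiefel d r ↔ (toM x).transpose * toM x = 1 := Iff.rfl

theorem norm_sq_of_mem_stiefel {x : Mat d r} (hx : x ∈ stiefel d r) : ‖x‖ ^ 2 = r := by
  rw [norm_sq_eq_trace, mem_stiefel.1 hx, Matrix.trace_one, Fintype.card_fin]

theorem norm_of_mem_stiefel {x : Mat d r} (hx : x ∈ stiefel d r) : ‖x‖ = √r := by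
  rw [← norm_sq_of_mem_stiefel hx, Real.sqrt_sq (norm_nonneg _)]

theorem constr_eq_zero_iff {x : Mat d r} : constr x = 0 ↔ x ∈ stiefel d r := by
  rw [mem_stiefel, ← sub_eq_zero (a := (toM x).transpose * toM x)]
  exact ⟨fun h => congrArg toM h, fun h => congrArg ofM h⟩

theorem isClosed_stiefel : IsClosed (stiefel d r) := by
  have : stiefel d r = constr ⁻¹' {0} := by
    ext x; exact constr_eq_zero_iff.symm
  rw [this]
  exact isClosed_singleton.preimage contDiff_constr.continuous

theorem dissolve_of_mem_stiefel {x : Mat d r} (hx : x ∈ stiefel d r) : dissolve x = x := by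
  rw [dissolve, mem_stiefel.1 hx, ← sub_smul]
  norm_num

theorem dissolveGrad_of_mem_stiefel {x : Mat d r} (hx : x ∈ stiefel d r) (u : Mat d r) :
    dissolveGrad x u = riemGrad x u := by
  rw [dissolveGrad, mem_stiefel.1 hx, ← sub_smul, riemGrad]
  norm_num

theorem sSup_norm_stiefel {z : Mat d r} (hz : z ∈ stiefel d r) :
    sSup ((fun x : Mat d r => ‖x‖) '' stiefel d r) = √r := by
  have : (fun x : Mat d r => ‖x‖) '' stiefel d r = {√r} := by
    ext t
    constructor
    · rintro ⟨x, hx, rfl⟩; exact norm_of_mem_stiefel hx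
    · rintro rfl; exact ⟨z, hz, norm_of_mem_stiefel hz⟩
  rw [this, csSup_singleton]

open scoped MatrixOrder Matrix.Norms.Frobenius in
/-- The polar decomposition of a matrix whose Gram matrix is close to the identity. -/
theorem exists_polar {x : Mat d r} (hx : ‖constr x‖ < 1) :
    ∃ (U : Matrix (Fin d) (Fin r) ℝ) (Q : Matrix (Fin r) (Fin r) ℝ),
      toM x = U * (Q * Q) ∧ U.transpose * U = 1 ∧ Q.transpose = Q ∧ IsUnit Q := by
  set S := (toM x).transpose * toM x with hS
  have hSu : IsUnit S := by
    have h : ‖1 - S‖ < 1 := by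
      rw [← norm_neg, neg_sub, ← norm_ofM_eq]; exact hx
    simpa using isUnit_one_sub_of_norm_lt_one h
  have hSp : S.PosSemidef := by
    have := Matrix.posSemidef_conjTranspose_mul_self (toM x)
    rwa [Matrix.conjTranspose_eq_transpose_of_trivial] at this
  set P := CFC.sqrt S with hP
  have hPP : P * P = S := CFC.sqrt_mul_sqrt_self S hSp.nonneg
  have hPp : P.PosSemidef := Matrix.nonneg_iff_posSemidef.1 (CFC.sqrt_nonneg S)
  have hPu : IsUnit P := by
    rw [Matrix.isUnit_iff_isUnit_det] at hSu ⊢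
    rw [← hPP, Matrix.det_mul] at hSu
    exact isUnit_of_mul_isUnit_left hSu
  -- A square root of the positive polar factor, so that a trace against `P` becomes a squared norm;
  -- its invertibility will give uniqueness of the nearest point.
  set Q := CFC.sqrt P with hQ
  have hQQ : Q * Q = P := CFC.sqrt_mul_sqrt_self P hPp.nonneg
  have hQp : Q.PosSemidef := Matrix.nonneg_iff_posSemidef.1 (CFC.sqrt_nonneg P)
  have hQu : IsUnit Q := by
    rw [Matrix.isUnit_iff_isUnit_det] at hPu ⊢
    rw [← hQQ, Matrix.det_mul] at hPu
    exact isUnit_of_mul_isUnit_left hPu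
  have hPt : P.transpose = P := by
    rw [← Matrix.conjTranspose_eq_transpose_of_trivial]; exact hPp.1
  have hQt : Q.transpose = Q := by
    rw [← Matrix.conjTranspose_eq_transpose_of_trivial]; exact hQp.1
  have hdet : IsUnit P.det := (Matrix.isUnit_iff_isUnit_det P).1 hPu
  refine ⟨toM x * P⁻¹, Q, ?_, ?_, hQt, hQu⟩
  · rw [hQQ, Matrix.mul_assoc, Matrix.nonsing_inv_mul P hdet, Matrix.mul_one]
  · rw [Matrix.transpose_mul, Matrix.transpose_nonsing_inv, hPt, Matrix.mul_assoc,
      ← Matrix.mul_assoc _ (toM x), ← hS, ← hPP, Matrix.mul_assoc, Matrix.mul_nonsing_inv P hdet,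
      Matrix.mul_one, Matrix.nonsing_inv_mul P hdet]

theorem norm_sq_ofM_mul (M : Matrix (Fin d) (Fin r) ℝ) {Q : Matrix (Fin r) (Fin r) ℝ}
    (hQ : Q.transpose = Q) :
    ‖ofM (M * Q)‖ ^ 2 = (M.transpose * M * (Q * Q)).trace := by
  rw [norm_sq_eq_trace, toM_ofM, Matrix.transpose_mul, hQ, Matrix.mul_assoc, Matrix.trace_mul_comm]
  simp only [Matrix.mul_assoc]

/-- Close to the Stiefel manifold the nearest point is unique, and its distance is bounded by the
constraint violation. -/
theorem exists_unique_nearest {x : Mat d r} (hx : ‖constr x‖ < 1) :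
    ∃ u : Mat d r, IsNearest (stiefel d r) x u ∧
      (∀ v : Mat d r, IsNearest (stiefel d r) x v → v = u) ∧ ‖x - u‖ ≤ ‖constr x‖ := by
  obtain ⟨U, Q, hxU, hU, hQ, hQu⟩ := exists_polar hx
  -- Points of the manifold have equal norm, so the difference of squared distances is linear in
  -- `w`; orthonormality of `U` and `w` rewrites it as a weighted square.
  have key : ∀ w ∈ stiefel d r, ‖x - w‖ ^ 2 = ‖x - ofM U‖ ^ 2 + ‖ofM ((U - toM w) * Q)‖ ^ 2 := by
    intro w hw
    have hw' := mem_stiefel.1 hw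
    rw [norm_sq_ofM_mul _ hQ]
    have hn1 := norm_sq_of_mem_stiefel hw
    have hn2 : ‖ofM U‖ ^ 2 = r := norm_sq_of_mem_stiefel (mem_stiefel.2 hU)
    rw [norm_sub_sq_real, norm_sub_sq_real, hn1, hn2, inner_eq_trace, inner_eq_trace, hxU]
    simp only [toM_ofM, Matrix.transpose_sub, Matrix.sub_mul, Matrix.mul_sub, hU, hw',
      Matrix.transpose_mul, hQ, Matrix.trace_sub, Matrix.one_mul]
    have e1 : (Q * Q * U.transpose * toM w).trace = (U.transpose * toM w * (Q * Q)).trace := by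
      rw [Matrix.mul_assoc, Matrix.trace_mul_comm]
    have e2 : ((toM w).transpose * U * (Q * Q)).trace = (U.transpose * toM w * (Q * Q)).trace := by
      rw [← Matrix.trace_transpose]
      simp only [Matrix.transpose_mul, Matrix.transpose_transpose, hQ]
      rw [← Matrix.mul_assoc (Q * Q), e1]
    have e3 : (Q * Q * U.transpose * U).trace = (Q * Q).trace := by
      rw [Matrix.mul_assoc, hU, Matrix.mul_one]
    rw [e1, e2, e3]
    ring
  refine ⟨ofM U, ⟨mem_stiefel.2 hU, fun w hw => ?_⟩, fun v hv => ?_, ?_⟩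
  · refine le_of_sq_le_sq ?_ (norm_nonneg _)
    rw [key w hw]
    exact le_add_of_nonneg_right (sq_nonneg _)
  · have h1 := key v hv.1
    have h2 : ‖x - v‖ ^ 2 ≤ ‖x - ofM U‖ ^ 2 := by
      have := hv.2 (ofM U) (mem_stiefel.2 hU)
      gcongr
    have h3 : ofM ((U - toM v) * Q) = 0 := by
      rw [← norm_eq_zero, ← sq_eq_zero_iff]
      exact le_antisymm (by linarith) (sq_nonneg _)
    have h4 : (U - toM v) * Q = 0 := congrArg toM h3
    have h5 : (U - toM v) * Q * Q⁻¹ = 0 := by rw [h4, Matrix.zero_mul]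
    rw [Matrix.mul_assoc, Matrix.mul_nonsing_inv Q ((Matrix.isUnit_iff_isUnit_det Q).1 hQu),
      Matrix.mul_one, sub_eq_zero] at h5
    exact congrArg ofM h5.symm
  · refine le_of_sq_le_sq ?_ (norm_nonneg _)
    -- With `P = Q * Q` one has `c = P² - 1 = N P + N`, and the cross term `‖N Q‖²` is nonnegative;
    -- hence `‖c‖ ≥ ‖N‖ = ‖x - U‖`.
    set N := Q * Q - 1 with hN
    have hNt : N.transpose = N := by simp [hN, Matrix.transpose_mul, hQ]
    have hPt : (Q * Q).transpose = Q * Q := by simp [Matrix.transpose_mul, hQ]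
    have e1 : x - ofM U = ofM (U * N) := by
      rw [← ofM_toM x, hxU, hN, Matrix.mul_sub, Matrix.mul_one, ofM_sub]
    have e2 : constr x = ofM (N * (Q * Q) + N) := by
      rw [constr, hxU]
      congr 1
      simp only [Matrix.transpose_mul, hQ]
      rw [Matrix.mul_assoc, ← Matrix.mul_assoc U.transpose, hU, hN]
      noncomm_ring
    have h1 : ‖x - ofM U‖ ^ 2 = ‖ofM N‖ ^ 2 := by
      rw [e1, norm_sq_ofM_mul _ hNt, hU, Matrix.one_mul, norm_sq_eq_trace, toM_ofM, hNt]
    rw [h1, e2, ofM_add, norm_add_sq_real]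
    have h2 : inner ℝ (ofM (N * (Q * Q))) (ofM N) = ‖ofM (N * Q)‖ ^ 2 := by
      rw [norm_sq_ofM_mul _ hQ, inner_eq_trace, toM_ofM, toM_ofM, Matrix.transpose_mul, hPt, hNt,
        Matrix.mul_assoc, Matrix.trace_mul_comm]
    rw [h2]
    nlinarith [sq_nonneg ‖ofM (N * (Q * Q))‖, sq_nonneg ‖ofM (N * Q)‖]

/-- Substituting `xᵀ x = 1 + c`, the first-order terms of the derivative of `A` along `x c` cancel
and leave `-(3/2) x c²`. The coupling thus opposes the penalty only to second order in the
violation. -/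
theorem constr_inner_dissolveGrad (x g : Mat d r) :
    inner ℝ (dissolveGrad x g) (ofM (toM x * toM (constr x))) =
      -(3 / 2) * inner ℝ g (ofM (toM x * toM (constr x) * toM (constr x))) := by
  rw [inner_dissolveGrad, ← inner_smul_right, ← ofM_smul]
  congr 2
  simp only [toM_ofM, Matrix.transpose_mul, transpose_toM_constr]
  have hS : (toM x).transpose * toM x = toM (constr x) + 1 := by simp [constr]
  generalize hc : toM (constr x) = c at *
  have e1 : c * (toM x).transpose * toM x = c * (c + 1) := by rw [Matrix.mul_assoc, hS]
  have e2 : (toM x).transpose * (toM x * c) = (c + 1) * c := by rw [← Matrix.mul_assoc, hS]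
  rw [e1, e2, hS]
  simp only [Matrix.mul_sub, Matrix.mul_add, Matrix.add_mul, Matrix.mul_smul, Matrix.mul_one,
    Matrix.one_mul, smul_add, ← Matrix.mul_assoc]
  module

/-- From `‖x c‖² = ‖c‖² + ⟨c, c²⟩ ≥ ‖c‖² / 2`; the factor `3 / 2` is a rational bound for `√2`. -/
theorem norm_constr_le {x : Mat d r} (hx : ‖constr x‖ ≤ 1 / 2) :
    ‖constr x‖ ≤ 3 / 2 * ‖ofM (toM x * toM (constr x))‖ := by
  refine le_of_sq_le_sq ?_ (by positivity)
  set c := constr x with hc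
  have hS : (toM x).transpose * toM x = toM c + 1 := by simp [hc, constr]
  have hct : (toM c).transpose = toM c := transpose_toM_constr x
  have h1 : ‖ofM (toM x * toM c)‖ ^ 2 = ‖c‖ ^ 2 + inner ℝ c (ofM (toM c * toM c)) := by
    rw [norm_sq_ofM_mul _ hct, hS, inner_eq_trace, hct, norm_sq_eq_trace, hct, toM_ofM,
      Matrix.add_mul, Matrix.one_mul, Matrix.trace_add, add_comm]
  have h2 : |inner ℝ c (ofM (toM c * toM c))| ≤ ‖c‖ * (‖c‖ * ‖c‖) :=
    (abs_real_inner_le_norm _ _).trans (mul_le_mul_of_nonneg_left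
      (norm_ofM_mul_le (toM c) (toM c)) (norm_nonneg _))
  have h3 := (abs_le.1 h2).1
  have h4 : ‖c‖ * (‖c‖ * ‖c‖) ≤ 1 / 2 * (‖c‖ * ‖c‖) := by gcongr
  nlinarith

/-- Near the Stiefel manifold, a small gradient of the penalty function forces both the
constraint violation and the tangential gradient to be small. -/
theorem constr_le_of_penalty_gradient {x g : Mat d r} {ρ G ε : ℝ} (hx : ‖constr x‖ ≤ 1 / 2)
    (hg : ‖g‖ ≤ G) (hρ : 0 < ρ) (hρG : 9 / 2 * G ≤ ρ)
    (hε : ‖dissolveGrad x g + (ρ / 2) • constrGrad x (constr x)‖ ≤ ε) :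
    ‖constr x‖ ≤ 3 / ρ * ε ∧ ‖dissolveGrad x g‖ ≤ 3 * ε := by
  rw [constrGrad_constr] at hε
  have h1 := constr_inner_dissolveGrad x g
  have h2 := norm_constr_le hx
  have h3 : ‖ofM (toM x * toM (constr x) * toM (constr x))‖ ≤
    ‖ofM (toM x * toM (constr x))‖ * ‖constr x‖ := norm_ofM_mul_le _ _
  set c := constr x
  set v := ofM (toM x * toM c) with hv
  set D := dissolveGrad x g
  have h4 : ρ * ‖v‖ ^ 2 = inner ℝ (D + ρ • v) v - inner ℝ D v := by
    rw [inner_add_left, inner_smul_left, real_inner_self_eq_norm_sq]; simp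
  have h5 : inner ℝ (D + ρ • v) v ≤ ε * ‖v‖ :=
    (real_inner_le_norm _ _).trans (mul_le_mul_of_nonneg_right hε (norm_nonneg _))
  have h6 : inner ℝ g (ofM (toM x * toM c * toM c)) ≤ G * (‖v‖ * ‖c‖) :=
    (real_inner_le_norm _ _).trans (mul_le_mul hg h3 (norm_nonneg _) ((norm_nonneg _).trans hg))
  have hε0 : 0 ≤ ε := (norm_nonneg _).trans hε
  have hG0 : 0 ≤ G := (norm_nonneg _).trans hg
  have h7 : ρ * ‖v‖ ≤ ε + 3 / 2 * G * ‖c‖ := by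
    rcases (norm_nonneg v).eq_or_lt with h0 | h0
    · rw [← h0, mul_zero]; positivity
    · refine le_of_mul_le_mul_right ?_ h0
      nlinarith
  -- The threshold `9 / 2 * G ≤ ρ` lets half of `ρ * ‖c‖` absorb the coupling term.
  have h8 : 3 / 2 * G * ‖c‖ ≤ ρ / 3 * ‖c‖ := by gcongr; linarith
  have h9 : ρ * ‖c‖ ≤ ρ * (3 / 2 * ‖v‖) := by gcongr
  have h10 : ρ * ‖c‖ ≤ 3 * ε := by linarith
  refine ⟨?_, ?_⟩
  · rw [div_mul_eq_mul_div, le_div_iff₀ hρ]; linarith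
  · have : ‖D‖ ≤ ‖D + ρ • v‖ + ‖ρ • v‖ := by
      have := norm_sub_le (D + ρ • v) (ρ • v)
      rwa [add_sub_cancel_right] at this
    rw [norm_smul, Real.norm_of_nonneg hρ.le] at this
    linarith

end Stiefel

/-! ### Lipschitz constants on the primal ball -/

section Ball

variable {d r : ℕ} {C : ℝ}

theorem ballX_eq : ballX d r C = Metric.closedBall 0 C := by
  ext x; simp [ballX]

theorem isCompact_ballX : IsCompact (ballX d r C) := by
  rw [ballX_eq]; exact isCompact_closedBall _ _

theorem convex_ballX : Convex ℝ (ballX d r C) := by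
  rw [ballX_eq]; exact convex_closedBall _ _

theorem exists_lipschitz_dissolve (d r : ℕ) (C : ℝ) :
    ∃ K : ℝ, 0 ≤ K ∧ ∀ x ∈ ballX d r C, ∀ x' ∈ ballX d r C,
      ‖dissolve x - dissolve x'‖ ≤ K * ‖x - x'‖ := by
  obtain ⟨K, hK⟩ := (contDiff_dissolve (d := d) (r := r)).contDiffOn.exists_lipschitzOnWith
    one_ne_zero (convex_ballX (C := C)) isCompact_ballX
  exact ⟨K, K.2, fun x hx x' hx' => hK.norm_sub_le hx hx'⟩

theorem exists_lipschitz_constr (d r : ℕ) (C : ℝ) :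
    ∃ K : ℝ, 0 ≤ K ∧ ∀ x ∈ ballX d r C, ∀ x' ∈ ballX d r C,
      ‖constr x - constr x'‖ ≤ K * ‖x - x'‖ := by
  obtain ⟨K, hK⟩ := (contDiff_constr (d := d) (r := r)).contDiffOn.exists_lipschitzOnWith
    one_ne_zero (convex_ballX (C := C)) isCompact_ballX
  exact ⟨K, K.2, fun x hx x' hx' => hK.norm_sub_le hx hx'⟩

theorem exists_lipschitz_dissolveGrad (d r : ℕ) (C G : ℝ) :
    ∃ K : ℝ, 0 ≤ K ∧ ∀ x ∈ ballX d r C, ∀ x' ∈ ballX d r C, ∀ u u' : Mat d r, ‖u‖ ≤ G →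
      ‖u'‖ ≤ G → ‖dissolveGrad x u - dissolveGrad x' u'‖ ≤ K * (‖x - x'‖ + ‖u - u'‖) := by
  obtain ⟨K, hK⟩ := (contDiff_dissolveGrad (d := d) (r := r)).contDiffOn.exists_lipschitzOnWith
    one_ne_zero ((convex_ballX (C := C)).prod (convex_ballX (C := G)))
    (isCompact_ballX.prod isCompact_ballX)
  refine ⟨K, K.2, fun x hx x' hx' u u' hu hu' => ?_⟩
  refine (hK.norm_sub_le (x := (x, u)) (y := (x', u')) ⟨hx, hu⟩ ⟨hx', hu'⟩).trans ?_
  gcongr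
  rw [Prod.mk_sub_mk, Prod.norm_mk]
  exact max_le_add_of_nonneg (norm_nonneg _) (norm_nonneg _)

end Ball

/-! ### The penalized problem as an instance of the abstract bounds -/

section Problem

variable {d r m : ℕ}

/-- The real-valued restriction of an extended-valued function. -/
def finVal (h : Vec m → EReal) (y : Vec m) : ℝ := (h y).toReal

/-- The standing assumptions with explicit Lipschitz constants and a selection `yh` of the
maximizers of `f_r(x, ·)`. -/
structure RegularData (f : Mat d r → Vec m → ℝ) (h : Vec m → EReal) (ζ μ C Lxx Lxy Lyx Lyy : ℝ)
    (yh : Mat d r → Vec m) : Prop where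
  reg : RegularizerAssumption h ζ
  mu_pos : 0 < μ
  conc : StronglyConcaveAssumption f h C μ
  Lxx_nonneg : 0 ≤ Lxx
  Lxy_nonneg : 0 ≤ Lxy
  Lyx_nonneg : 0 ≤ Lyx
  Lyy_nonneg : 0 ≤ Lyy
  hasGradX : ∀ x ∈ barX d r C, ∀ y ∈ edom h, HasGradientAt (fun u => f u y) (gradX f x y) x
  hasGradY : ∀ x ∈ barX d r C, ∀ y ∈ edom h, HasGradientAt (fun w => f x w) (gradY f x y) y
  lip : ∀ x₁ ∈ barX d r C, ∀ x₂ ∈ barX d r C, ∀ y₁ ∈ edom h, ∀ y₂ ∈ edom h,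
      ‖gradX f x₁ y₁ - gradX f x₂ y₂‖ ≤ Lxx * ‖x₁ - x₂‖ + Lxy * ‖y₁ - y₂‖ ∧
      ‖gradY f x₁ y₁ - gradY f x₂ y₂‖ ≤ Lyx * ‖x₁ - x₂‖ + Lyy * ‖y₁ - y₂‖
  contF : ContinuousOn (fun q : Mat d r × Vec m => f q.1 q.2) (barX d r C ×ˢ edom h)
  yh_mem : ∀ x ∈ barX d r C, yh x ∈ edom h
  yh_max : ∀ x ∈ barX d r C, ∀ y ∈ edom h, regF f h x y ≤ regF f h x (yh x)
  yh_lip : ∀ x ∈ barX d r C, ∀ x' ∈ barX d r C, ‖yh x - yh x'‖ ≤ Lyx / μ * ‖x - x'‖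

variable {f : Mat d r → Vec m → ℝ} {h : Vec m → EReal} {ζ μ C Lxx Lxy Lyx Lyy : ℝ}
  {yh : Mat d r → Vec m}

theorem RegularizerAssumption.convex_edom (hh : RegularizerAssumption h ζ) :
    Convex ℝ (edom h) := hh.weaklyConvex.1

theorem RegularizerAssumption.continuousOn (hh : RegularizerAssumption h ζ) :
    ContinuousOn (finVal h) (edom h) := hh.locLipschitz.continuousOn

/-- Strong concavity on a closed domain supplies the maximizers. Their Lipschitz constant comes from
adding the two sharp maximality inequalities and applying the mean value inequality to `f x - f x'`.
-/
theorem exists_regularData (hh : RegularizerAssumption h ζ) (hf : SmoothAssumption f h C)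
    (hμ : 0 < μ) (hc : StronglyConcaveAssumption f h C μ) :
    ∃ (Lxx Lxy Lyx Lyy : ℝ) (yh : Mat d r → Vec m),
      RegularData f h ζ μ C Lxx Lxy Lyx Lyy yh := by
  obtain ⟨⟨U, hU, hsub, hdiff⟩, Lxx, Lxy, Lyx, Lyy, h1, h2, h3, h4, hlip⟩ := hf
  have hd : ∀ x ∈ barX d r C, ∀ y ∈ edom h,
      DifferentiableAt ℝ (fun q : Mat d r × Vec m => f q.1 q.2) (x, y) := fun x hx y hy =>
    hdiff.differentiableAt (hU.mem_nhds (hsub ⟨hx, hy⟩))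
  have hgX : ∀ x ∈ barX d r C, ∀ y ∈ edom h,
      HasGradientAt (fun u => f u y) (gradX f x y) x := by
    intro x hx y hy
    have h : DifferentiableAt ℝ (fun u => f u y) x :=
      DifferentiableAt.comp (f := fun u : Mat d r => (u, y)) x (hd x hx y hy) (by fun_prop)
    exact h.hasGradientAt
  have hgY : ∀ x ∈ barX d r C, ∀ y ∈ edom h,
      HasGradientAt (fun w => f x w) (gradY f x y) y := by
    intro x hx y hy
    have h : DifferentiableAt ℝ (fun w => f x w) y :=
      DifferentiableAt.comp (f := fun w : Vec m => (x, w)) y (hd x hx y hy) (by fun_prop)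
    exact h.hasGradientAt
  have hcont : ContinuousOn (fun q : Mat d r × Vec m => f q.1 q.2) (barX d r C ×ˢ edom h) :=
    fun q hq => (hd q.1 hq.1 q.2 hq.2).continuousAt.continuousWithinAt
  have hex : ∀ x ∈ barX d r C, ∃ y ∈ edom h, ∀ w ∈ edom h, regF f h x w ≤ regF f h x y := by
    intro x hx
    refine (hc x hx).exists_isMax hh.closed_dom hh.proper hμ ?_
    exact ContinuousOn.sub (fun y hy => (hgY x hx y hy).differentiableAt.continuousAt.continuousWithinAt)
      hh.continuousOn
  choose! yh hyh using hex
  refine ⟨Lxx, Lxy, Lyx, Lyy, yh, hh, hμ, hc, h1, h2, h3, h4, hgX, hgY, hlip, hcont,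
    fun x hx => (hyh x hx).1, fun x hx => (hyh x hx).2, fun x hx x' hx' => ?_⟩
  obtain ⟨hm, hmax⟩ := hyh x hx
  obtain ⟨hm', hmax'⟩ := hyh x' hx'
  have b1 := (hc x hx).le_sub_of_isMax hm hmax _ hm'
  have b2 := (hc x' hx').le_sub_of_isMax hm' hmax' _ hm
  have b3 := (abs_le.1 (abs_sub_sub_sub_le_of_gradient hh.convex_edom (hgY x hx) (hgY x' hx')
    (M := Lyx * ‖x - x'‖) (fun y hy => by simpa using (hlip x hx x' hx' y hy y hy).2)
    hm' hm)).2
  rw [norm_sub_rev (yh x') (yh x)] at b1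
  simp only [regF] at b1 b2
  have b4 : ‖yh x - yh x'‖ * (μ * ‖yh x - yh x'‖) ≤ ‖yh x - yh x'‖ * (Lyx * ‖x - x'‖) := by
    nlinarith
  rw [div_mul_eq_mul_div, le_div_iff₀ hμ]
  rcases (norm_nonneg (yh x - yh x')).eq_or_lt with h0 | h0
  · rw [← h0, zero_mul]; positivity
  · have := le_of_mul_le_mul_left b4 h0
    linarith

/-- The global weak subgradient inequality is the working notion because it passes to limits
directly; the local Fréchet condition is derived only at the end. -/
theorem mem_subdiff_of_isWeakSubgradient {y g : Vec m}
    (H : IsWeakSubgradient (edom h) (finVal h) ζ y g) : g ∈ subdiff h y := by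
  refine ⟨H.1, fun ε hε => ?_⟩
  have hδ : 0 < ε / (|ζ| / 2 + 1) := by positivity
  filter_upwards [Metric.ball_mem_nhds y hδ] with w hw hwd
  have h1 := H.2 w hwd
  rw [Metric.mem_ball, dist_eq_norm, lt_div_iff₀ (by positivity)] at hw
  have h2 : ζ / 2 * ‖w - y‖ ^ 2 ≤ ε * ‖w - y‖ := by
    have h3 : ζ / 2 * ‖w - y‖ ≤ ε := by
      have : ζ / 2 * ‖w - y‖ ≤ |ζ| / 2 * ‖w - y‖ := by gcongr; exact le_abs_self _
      linarith [norm_nonneg (w - y)]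
    rw [pow_two, ← mul_assoc]
    gcongr
  simp only [finVal] at h1
  linarith

theorem dissolve_mem_barX {x : Mat d r} (hx : x ∈ ballX d r C) : dissolve x ∈ barX d r C :=
  ⟨x, hx, rfl⟩

theorem mem_ballX_of_mem_stiefel (hC : √r < C) {u : Mat d r} (hu : u ∈ stiefel d r) :
    u ∈ ballX d r C := by
  change ‖u‖ ≤ C
  rw [norm_of_mem_stiefel hu]; exact hC.le

theorem mem_barX_of_mem_stiefel (hC : √r < C) {u : Mat d r} (hu : u ∈ stiefel d r) :
    u ∈ barX d r C := by
  have := dissolve_mem_barX (mem_ballX_of_mem_stiefel hC hu)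
  rwa [dissolve_of_mem_stiefel hu] at this

namespace RegularData

/-- The optimality condition that makes the maximizer a fixed point of the prox-gradient map, so
dual steps can be compared with it. -/
theorem isWeakSubgradient_yh (H : RegularData f h ζ μ C Lxx Lxy Lyx Lyy yh) {x : Mat d r}
    (hx : x ∈ barX d r C) :
    IsWeakSubgradient (edom h) (finVal h) ζ (yh x) (gradY f x (yh x)) := by
  refine ⟨H.yh_mem x hx, fun w hw => ?_⟩
  have := (strongConcaveOn_neg_of_weaklyConvex (h := finVal h)
    H.reg.weaklyConvex).le_add_inner_sub (ξ := -gradY f x (yh x)) (K := Lyy / 2) (H.yh_mem x hx)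
    (fun w hw => by
      have h1 := H.yh_max x hx w hw
      have h2 := (abs_le.1 (abs_sub_sub_inner_le H.reg.convex_edom (H.hasGradY x hx) (L := Lyy)
        (fun y hy w hw => by simpa using (H.lip x hx x hx w hw y hy).2) _ (H.yh_mem x hx) w hw)).1
      simp only [regF, finVal, inner_neg_left] at *
      linarith) w hw
  rw [inner_neg_left] at this
  linarith

/-- The penalty does not depend on `y`, so the concavity modulus stays `μ` for every `ρ`. Estimates
relying on `l` hold on the truncated dual set, while concavity holds on the whole domain. -/
theorem couplingBounds (H : RegularData f h ζ μ C Lxx Lxy Lyx Lyy yh) {ρ R l : ℝ}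
    (hl : PenLipschitz f ρ C (edom h ∩ Metric.closedBall 0 R) l) :
    CouplingBounds (ballX d r C) (edom h) (edom h ∩ Metric.closedBall 0 R) (pen f ρ)
      (penGradX f ρ) (penGradY f) (finVal h) l μ ζ := by
  have hconv : Convex ℝ (edom h ∩ Metric.closedBall 0 R) :=
    H.reg.convex_edom.inter (convex_closedBall _ _)
  have hgY : ∀ x ∈ ballX d r C, ∀ y ∈ edom h ∩ Metric.closedBall 0 R,
      HasGradientAt (fun y => pen f ρ x y) (penGradY f x y) y := by
    intro x hx y hy
    have h1 := H.hasGradY _ (dissolve_mem_barX hx) y hy.1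
    rw [hasGradientAt_iff_hasFDerivAt] at h1 ⊢
    exact h1.add_const _
  refine ⟨convex_ballX, inter_subset_left, fun x hx x' hx' y hy => ?_, fun x hx y hy y' hy' => ?_,
    fun x hx x' hx' y hy y' hy' => (hl x hx x' hx' y hy y' hy').2,
    fun x hx x' hx' y hy y' hy' => ?_, fun x hx => ?_, H.reg.weaklyConvex⟩
  · exact abs_sub_sub_inner_le (φ := fun x => pen f ρ x y) (g := fun x => penGradX f ρ x y)
      convex_ballX
      (fun x hx => hasGradientAt_pen ρ (H.hasGradX _ (dissolve_mem_barX hx) y hy.1))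
      (fun x hx w hw => by simpa using (hl w hw x hx y hy y hy).1) x hx x' hx'
  · exact abs_sub_sub_inner_le hconv (hgY x hx)
      (fun y hy w hw => by simpa using (hl x hx x hx w hw y hy).2) y hy y' hy'
  · exact abs_sub_sub_sub_le_of_gradient hconv (hgY x hx) (hgY x' hx')
      (fun y hy => by simpa using (hl x hx x' hx' y hy y hy).2) hy hy'
  · have h1 := H.conc _ (dissolve_mem_barX hx)
    refine ⟨h1.1, fun y hy y' hy' a b ha hb hab => ?_⟩
    have h2 := h1.2 hy hy' ha hb hab
    have : b = 1 - a := by linarith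
    subst this
    simp only [regF, pen, finVal, smul_eq_mul] at h2 ⊢
    linarith

theorem continuousOn_yh (H : RegularData f h ζ μ C Lxx Lxy Lyx Lyy yh) :
    ContinuousOn (fun x => yh (dissolve x)) (ballX d r C) := by
  have h1 : ContinuousOn yh (barX d r C) := by
    have hL : 0 ≤ Lyx / μ := div_nonneg H.Lyx_nonneg H.mu_pos.le
    have : LipschitzOnWith ⟨Lyx / μ, hL⟩ yh (barX d r C) :=
      LipschitzOnWith.of_dist_le_mul fun x hx x' hx' => by
        rw [dist_eq_norm, dist_eq_norm]; exact H.yh_lip x hx x' hx'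
    exact this.continuousOn
  exact h1.comp contDiff_dissolve.continuous.continuousOn fun x hx => dissolve_mem_barX hx

/-- The bound involves neither `ρ` nor `l`, which is why the dual radius can be fixed before them.
-/
theorem exists_bound_yh (H : RegularData f h ζ μ C Lxx Lxy Lyx Lyy yh) :
    ∃ R₀ : ℝ, 0 ≤ R₀ ∧ ∀ x ∈ ballX d r C, ‖yh (dissolve x)‖ ≤ R₀ := by
  obtain ⟨R₀, hR⟩ := isCompact_ballX.exists_bound_of_continuousOn H.continuousOn_yh
  exact ⟨max R₀ 0, le_max_right _ _, fun x hx => (hR x hx).trans (le_max_left _ _)⟩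

theorem continuousOn_regF_yh (H : RegularData f h ζ μ C Lxx Lxy Lyx Lyy yh) :
    ContinuousOn (fun x => regF f h (dissolve x) (yh (dissolve x))) (ballX d r C) := by
  have hm : MapsTo (fun x => yh (dissolve x)) (ballX d r C) (edom h) := fun x hx =>
    H.yh_mem _ (dissolve_mem_barX hx)
  have h1 : ContinuousOn (fun x => f (dissolve x) (yh (dissolve x))) (ballX d r C) :=
    H.contF.comp (f := fun x => (dissolve x, yh (dissolve x)))
      (contDiff_dissolve.continuous.continuousOn.prodMk H.continuousOn_yh)
      fun x hx => ⟨dissolve_mem_barX hx, hm hx⟩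
  exact h1.sub (H.reg.continuousOn.comp H.continuousOn_yh hm)

theorem continuousOn_pen_left (H : RegularData f h ζ μ C Lxx Lxy Lyx Lyy yh) (ρ : ℝ) {y : Vec m}
    (hy : y ∈ edom h) : ContinuousOn (fun x => pen f ρ x y) (ballX d r C) := fun _ hx =>
  (hasGradientAt_pen ρ
    (H.hasGradX _ (dissolve_mem_barX hx) y hy)).differentiableAt.continuousAt.continuousWithinAt

theorem continuousOn_pen_right (H : RegularData f h ζ μ C Lxx Lxy Lyx Lyy yh) (ρ : ℝ)
    {x : Mat d r} (hx : x ∈ ballX d r C) :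
    ContinuousOn (fun y => pen f ρ x y - finVal h y) (edom h) := by
  have h1 : ContinuousOn (fun y => f (dissolve x) y) (edom h) := fun y hy =>
    (H.hasGradY _ (dissolve_mem_barX hx) y hy).differentiableAt.continuousAt.continuousWithinAt
  exact (h1.add continuousOn_const).sub H.reg.continuousOn

theorem exists_innerMin (H : RegularData f h ζ μ C Lxx Lxy Lyx Lyy yh) (hC : 0 ≤ C) (ρ l : ℝ)
    {y : Vec m} (hy : y ∈ edom h) (z : Mat d r) :
    ∃ a, IsInnerMin (ballX d r C) (pen f ρ) (finVal h) l y z a := by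
  have hcont : ContinuousOn (fun x => smoothed (pen f ρ) (finVal h) l x y z) (ballX d r C) := by
    have h2 : ContinuousOn (fun x : Mat d r => l * ‖x - z‖ ^ 2) (ballX d r C) := by fun_prop
    exact ((H.continuousOn_pen_left ρ hy).add h2).sub continuousOn_const
  obtain ⟨a, ha, hmin⟩ := isCompact_ballX.exists_isMinOn ⟨0, by simpa [ballX] using hC⟩ hcont
  exact ⟨a, ha, fun x hx => hmin hx⟩

theorem smoothed_yh (x z : Mat d r) (ρ l : ℝ) (y : Vec m) :
    smoothed (pen f ρ) (finVal h) l x y z =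
      regF f h (dissolve x) y + ρ / 4 * ‖constr x‖ ^ 2 + l * ‖x - z‖ ^ 2 := by
  simp only [smoothed, pen, regF, finVal]; ring

theorem isSaddle_of_argmin (H : RegularData f h ζ μ C Lxx Lxy Lyx Lyy yh) {ρ l R : ℝ}
    (hl0 : 0 ≤ l) (hl : PenLipschitz f ρ C (edom h ∩ Metric.closedBall 0 R) l)
    (hR : ∀ x ∈ ballX d r C, ‖yh (dissolve x)‖ ≤ R) {z a : Mat d r} (ha : a ∈ ballX d r C)
    (hmin : ∀ x ∈ ballX d r C, smoothed (pen f ρ) (finVal h) l a (yh (dissolve a)) z ≤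
      smoothed (pen f ρ) (finVal h) l x (yh (dissolve x)) z) :
    IsSaddle (ballX d r C) (edom h) (edom h ∩ Metric.closedBall 0 R) (pen f ρ) (finVal h) l z a
      (yh (dissolve a)) := by
  refine (H.couplingBounds hl).isSaddle_of_isMin (yhat := fun x => yh (dissolve x))
    (fun x hx => ⟨H.yh_mem _ (dissolve_mem_barX hx), by simpa using hR x hx⟩)
    (fun x hx y hy => ?_) H.continuousOn_yh (fun x hx => H.continuousOn_pen_right ρ hx) ha hmin hl0
  have := H.yh_max _ (dissolve_mem_barX hx) y hy
  simp only [regF, pen, finVal] at this ⊢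
  linarith

theorem exists_saddle (H : RegularData f h ζ μ C Lxx Lxy Lyx Lyy yh) (hC : 0 ≤ C) {ρ l R : ℝ}
    (hl0 : 0 ≤ l) (hl : PenLipschitz f ρ C (edom h ∩ Metric.closedBall 0 R) l)
    (hR : ∀ x ∈ ballX d r C, ‖yh (dissolve x)‖ ≤ R) (z : Mat d r) :
    ∃ a, IsSaddle (ballX d r C) (edom h) (edom h ∩ Metric.closedBall 0 R) (pen f ρ) (finVal h)
      l z a (yh (dissolve a)) := by
  have hcont : ContinuousOn
      (fun x => smoothed (pen f ρ) (finVal h) l x (yh (dissolve x)) z) (ballX d r C) := by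
    simp only [smoothed_yh]
    have h2 : ContinuousOn (fun x : Mat d r => l * ‖x - z‖ ^ 2) (ballX d r C) := by fun_prop
    have h3 : ContinuousOn (fun x : Mat d r => ρ / 4 * ‖constr x‖ ^ 2) (ballX d r C) :=
      (continuous_const.mul (contDiff_constr.continuous.norm.pow 2)).continuousOn
    exact (H.continuousOn_regF_yh.add h3).add h2
  obtain ⟨a, ha, hmin⟩ := isCompact_ballX.exists_isMinOn ⟨0, by simpa [ballX] using hC⟩ hcont
  exact ⟨a, H.isSaddle_of_argmin hl0 hl hR ha fun x hx => hmin hx⟩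

theorem primal_eq (H : RegularData f h ζ μ C Lxx Lxy Lyx Lyy yh) {x : Mat d r}
    (hx : x ∈ barX d r C) : primal f h x = regF f h x (yh x) := by
  apply IsGreatest.csSup_eq
  refine ⟨⟨yh x, H.yh_mem x hx, rfl⟩, ?_⟩
  rintro _ ⟨y, hy, rfl⟩
  exact H.yh_max x hx y hy

theorem auxPrimal_eq (H : RegularData f h ζ μ C Lxx Lxy Lyx Lyy yh) {x : Mat d r}
    (hx : x ∈ ballX d r C) (ρ l : ℝ) (z : Mat d r) : auxPrimal f h ρ (2 * l) x z =
      smoothed (pen f ρ) (finVal h) l x (yh (dissolve x)) z := by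
  have e : ∀ y, fhat f ρ (2 * l) x y z - (h y).toReal
      = smoothed (pen f ρ) (finVal h) l x y z := by
    intro y; simp only [fhat, smoothed, finVal]; ring
  apply IsGreatest.csSup_eq
  simp only [e]
  refine ⟨⟨_, H.yh_mem _ (dissolve_mem_barX hx), rfl⟩, ?_⟩
  rintro _ ⟨y, hy, rfl⟩
  simp only [smoothed_yh]
  have := H.yh_max _ (dissolve_mem_barX hx) y hy
  linarith

theorem auxDual_eq {ρ l : ℝ} {y : Vec m} {z a : Mat d r}
    (ha : IsInnerMin (ballX d r C) (pen f ρ) (finVal h) l y z a) :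
    auxDual f h ρ (2 * l) C y z = smoothed (pen f ρ) (finVal h) l a y z := by
  have : IsLeast ((fun x => fhat f ρ (2 * l) x y z) '' ballX d r C) (fhat f ρ (2 * l) a y z) := by
    refine ⟨⟨a, ha.1, rfl⟩, ?_⟩
    rintro _ ⟨x, hx, rfl⟩
    have := ha.2 x hx
    simp only [fhat, smoothed] at this ⊢
    linarith
  rw [auxDual, this.csInf_eq]
  simp only [fhat, smoothed, finVal]; ring

theorem primalLower_le (H : RegularData f h ζ μ C Lxx Lxy Lyx Lyy yh) {x : Mat d r}
    (hx : x ∈ ballX d r C) : primalLower f h C ≤ regF f h (dissolve x) (yh (dissolve x)) := by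
  obtain ⟨b, hb⟩ := isCompact_ballX.bddBelow_image H.continuousOn_regF_yh
  rw [← H.primal_eq (dissolve_mem_barX hx)]
  refine csInf_le ⟨b, ?_⟩ ⟨x, hx, rfl⟩
  rintro _ ⟨u, hu, rfl⟩
  simp only [H.primal_eq (dissolve_mem_barX hu)]
  exact hb ⟨u, hu, rfl⟩

/-- A maximizer of the dual function is the dual part of the saddle point. -/
theorem argmaxDual_eq (H : RegularData f h ζ μ C Lxx Lxy Lyx Lyy yh) {ρ l R : ℝ}
    (hl : PenLipschitz f ρ C (edom h ∩ Metric.closedBall 0 R) l) {z a xs : Mat d r} {y ys : Vec m}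
    (hy : y ∈ argmaxDual f h ρ (2 * l) C z)
    (ha : IsInnerMin (ballX d r C) (pen f ρ) (finVal h) l y z a)
    (hs : IsSaddle (ballX d r C) (edom h) (edom h ∩ Metric.closedBall 0 R) (pen f ρ)
      (finVal h) l z xs ys) :
    y = ys ∧ smoothed (pen f ρ) (finVal h) l a y z =
      smoothed (pen f ρ) (finVal h) l xs ys z := by
  have hB := H.couplingBounds hl
  have h1 := hy.2 ys (hB.sub hs.memS)
  rw [auxDual_eq hs.min, auxDual_eq ha] at h1
  have h2 := ha.2 xs hs.min.1
  have h3 := hB.saddle_growth hs hy.1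
  have hμ := H.mu_pos
  have h4 : ‖y - ys‖ ^ 2 ≤ 0 := by nlinarith
  have h5 : y = ys := by
    rw [← sub_eq_zero, ← norm_eq_zero]
    exact pow_eq_zero_iff two_ne_zero |>.1 (le_antisymm h4 (sq_nonneg _))
  refine ⟨h5, le_antisymm ?_ h1⟩
  nlinarith [sq_nonneg ‖y - ys‖]

theorem exists_bound_gradX (H : RegularData f h ζ μ C Lxx Lxy Lyx Lyy yh) (R : ℝ) :
    ∃ G : ℝ, 0 ≤ G ∧ ∀ x ∈ ballX d r C, ∀ y ∈ edom h ∩ Metric.closedBall 0 R,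
      ‖gradX f (dissolve x) y‖ ≤ G := by
  have hLxx := H.Lxx_nonneg
  have hLxy := H.Lxy_nonneg
  by_cases hne : (ballX d r C ×ˢ (edom h ∩ Metric.closedBall 0 R)).Nonempty
  · obtain ⟨⟨x₀, y₀⟩, hx₀, hy₀⟩ := hne
    obtain ⟨K, hK0, hK⟩ := exists_lipschitz_dissolve d r C
    have hC0 : 0 ≤ C := (norm_nonneg _).trans hx₀
    have hR0 : 0 ≤ R := by
      have := hy₀.2
      rw [mem_closedBall_zero_iff] at this
      exact (norm_nonneg _).trans this
    refine ⟨‖gradX f (dissolve x₀) y₀‖ + (Lxx * (K * (2 * C)) + Lxy * (2 * R)), by positivity,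
      fun x hx y hy => ?_⟩
    have h1 := (H.lip _ (dissolve_mem_barX hx) _ (dissolve_mem_barX hx₀) y hy.1 y₀ hy₀.1).1
    have h2 : ‖x - x₀‖ ≤ 2 * C := (norm_sub_le _ _).trans (by
      have := show ‖x‖ ≤ C from hx
      have := show ‖x₀‖ ≤ C from hx₀
      linarith)
    have h3 : ‖y - y₀‖ ≤ 2 * R := (norm_sub_le _ _).trans (by
      have := mem_closedBall_zero_iff.1 hy.2
      have := mem_closedBall_zero_iff.1 hy₀.2
      linarith)
    have h4 : ‖dissolve x - dissolve x₀‖ ≤ K * (2 * C) := (hK x hx x₀ hx₀).trans (by gcongr)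
    have h5 : Lxx * ‖dissolve x - dissolve x₀‖ + Lxy * ‖y - y₀‖
        ≤ Lxx * (K * (2 * C)) + Lxy * (2 * R) := by gcongr
    have h6 := norm_le_norm_add_norm_sub' (gradX f (dissolve x) y) (gradX f (dissolve x₀) y₀)
    linarith
  · exact ⟨0, le_rfl, fun x hx y hy => absurd ⟨(x, y), hx, hy⟩ hne⟩

/-- Every Lipschitz constant of the gradient of the penalty function grows linearly in `ρ`. -/
theorem exists_penLipschitz_lower (H : RegularData f h ζ μ C Lxx Lxy Lyx Lyy yh) (hr : 0 < r)
    (hC : √r < C) {z : Mat d r} (hz : z ∈ stiefel d r) {R : ℝ}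
    (hne : (edom h ∩ Metric.closedBall 0 R).Nonempty) :
    ∃ ρ₀ : ℝ, 0 ≤ ρ₀ ∧ ∀ ρ l : ℝ, ρ₀ ≤ ρ →
      PenLipschitz f ρ C (edom h ∩ Metric.closedBall 0 R) l → ρ / 2 ≤ l := by
  obtain ⟨G, hG0, hG⟩ := H.exists_bound_gradX R
  obtain ⟨K, hK0, hK⟩ := exists_lipschitz_dissolveGrad d r C G
  obtain ⟨y, hy⟩ := hne
  have hr1 : (1 : ℝ) ≤ √r := by
    rw [Real.one_le_sqrt]; exact_mod_cast hr
  have hzn := norm_of_mem_stiefel hz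
  have hC0 : 0 < C := by linarith
  have hzX := mem_ballX_of_mem_stiefel hC hz
  -- The penalty gradient vanishes at `z` and equals `-(3/8) ρ z` at `z / 2`, at distance `√r / 2`:
  -- a slope of `3ρ/4`. The coupling part stays bounded, hence `ρ / 2` for large `ρ`.
  set w : Mat d r := (1 / 2 : ℝ) • z with hw
  have hwn : ‖w‖ = √r / 2 := by
    rw [hw, norm_smul, hzn, Real.norm_of_nonneg (by norm_num)]; ring
  have hwX : w ∈ ballX d r C := by
    change ‖w‖ ≤ C
    rw [hwn]; linarith
  set M := ‖dissolveGrad w (gradX f (dissolve w) y) - dissolveGrad z (gradX f (dissolve z) y)‖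
  refine ⟨16 * (K * (2 * C + 2 * G)), by positivity, fun ρ l hρ hl => ?_⟩
  have h1 := (hl w hwX z hzX y hy y hy).1
  have e1 : ofM (toM w * toM (constr w)) = -(3 / 8 : ℝ) • z := by
    have : toM (constr w) = -(3 / 4 : ℝ) • (1 : Matrix (Fin r) (Fin r) ℝ) := by
      simp only [constr, toM_ofM, hw, toM_smul, Matrix.transpose_smul, Matrix.smul_mul,
        Matrix.mul_smul, mem_stiefel.1 hz]
      module
    rw [this, hw, toM_smul, Matrix.smul_mul, Matrix.mul_smul, Matrix.mul_one, ofM_smul, ofM_smul,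
      ofM_toM]
    module
  have e2 : ofM (toM z * toM (constr z)) = 0 := by
    rw [constr_eq_zero_iff.2 hz]
    change ofM (toM z * 0) = 0
    rw [Matrix.mul_zero]; rfl
  have hzw : ‖w - z‖ = √r / 2 := by
    rw [show w - z = -w by rw [hw]; module, norm_neg, hwn]
  have h2 := hK w hwX z hzX _ _ (hG w hwX y hy) (hG z hzX y hy)
  have h3 : K * (‖w - z‖ + ‖gradX f (dissolve w) y - gradX f (dissolve z) y‖)
      ≤ K * (2 * C + 2 * G) := by
    have := norm_sub_le (gradX f (dissolve w) y) (gradX f (dissolve z) y)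
    have := hG w hwX y hy
    have := hG z hzX y hy
    gcongr <;> linarith
  rw [penGradX, penGradX, constrGrad_constr, constrGrad_constr, e1, e2, smul_zero, add_zero,
    sub_self, norm_zero, add_zero, hzw] at h1
  set P := dissolveGrad w (gradX f (dissolve w) y)
  set Q := dissolveGrad z (gradX f (dissolve z) y)
  have hρ0 : 0 ≤ ρ := le_trans (by positivity) hρ
  have h4 : ‖ρ • (-(3 / 8 : ℝ) • z)‖ = ρ * (3 / 8 * √r) := by
    rw [norm_smul, norm_smul, hzn, Real.norm_of_nonneg hρ0]; norm_num
  have h5 := norm_sub_le (P + ρ • (-(3 / 8 : ℝ) • z) - Q) (P - Q)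
  rw [show P + ρ • (-(3 / 8 : ℝ) • z) - Q - (P - Q) = ρ • (-(3 / 8 : ℝ) • z) by abel, h4] at h5
  have h6 : ρ * (3 / 8 * √r) ≤ l * (√r / 2) + ρ / 16 := by linarith
  have h7 : ρ / 16 ≤ ρ / 16 * √r := le_mul_of_one_le_right (by positivity) hr1
  have h8 : 0 ≤ ρ * √r := by positivity
  have h9 : ρ / 2 * √r ≤ l * √r := by linarith
  exact le_of_mul_le_mul_right h9 (by linarith)

end RegularData

end Problem

/-! ### Confinement and potential along a run -/

section Run

variable {d r m : ℕ}

/-- `x` has a unique nearest point `u` in the Stiefel manifold, at distance at most `3 / ρ * ε`,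
and `(u, y)` is `D * ε`-stationary. -/
def GoodIterate (f : Mat d r → Vec m → ℝ) (h : Vec m → EReal) (ζ ρ D ε : ℝ) (x : Mat d r)
    (y : Vec m) : Prop :=
  ∃ u : Mat d r, IsNearest (stiefel d r) x u ∧
    (∀ v : Mat d r, IsNearest (stiefel d r) x v → v = u) ∧
    ‖x - u‖ ≤ 3 / ρ * ε ∧ ‖riemGrad u (gradX f u y)‖ ≤ D * ε ∧
    ∃ g, IsWeakSubgradient (edom h) (finVal h) ζ y g ∧ ‖-gradY f u y + g‖ ≤ D * ε

variable {f : Mat d r → Vec m → ℝ} {h : Vec m → EReal} {ζ μ C Lxx Lxy Lyx Lyy : ℝ}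
  {yh : Mat d r → Vec m}

theorem GoodIterate.isApproxStationary {ρ D ε : ℝ} {x : Mat d r} {y : Vec m}
    (H : GoodIterate f h ζ ρ D ε x y) :
    ∃ u : Mat d r, IsNearest (stiefel d r) x u ∧
      (∀ v : Mat d r, IsNearest (stiefel d r) x v → v = u) ∧
      ‖x - u‖ ≤ 3 / ρ * ε ∧ IsApproxStationary f h (D * ε) u y := by
  obtain ⟨u, h1, h2, h3, h4, g, h5, h6⟩ := H
  exact ⟨u, h1, h2, h3, h1.1, h5.1, h4, g, mem_subdiff_of_isWeakSubgradient h5, h6⟩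

namespace RegularData

/-- Small residuals at a point near the Stiefel manifold give approximate stationarity. -/
theorem goodIterate_of_residual (H : RegularData f h ζ μ C Lxx Lxy Lyx Lyy yh) (hC : √r < C)
    {G KA Kd ρ τ ε : ℝ} {S : Set (Vec m)} (hS : S ⊆ edom h) (hKA0 : 0 ≤ KA) (hKd0 : 0 ≤ Kd)
    (hG : ∀ x ∈ ballX d r C, ∀ y ∈ S, ‖gradX f (dissolve x) y‖ ≤ G)
    (hKA : ∀ x ∈ ballX d r C, ∀ x' ∈ ballX d r C, ‖dissolve x - dissolve x'‖ ≤ KA * ‖x - x'‖)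
    (hKd : ∀ x ∈ ballX d r C, ∀ x' ∈ ballX d r C, ∀ u u' : Mat d r, ‖u‖ ≤ G → ‖u'‖ ≤ G →
      ‖dissolveGrad x u - dissolveGrad x' u'‖ ≤ Kd * (‖x - x'‖ + ‖u - u'‖))
    (hρ : 1 ≤ ρ) (hρG : 9 / 2 * G ≤ ρ) (hτ : 0 < τ) (hτL : τ * Lyy ≤ 1)
    {x : Mat d r} {y y₀ : Vec m} (hx : x ∈ ballX d r C) (hy : y ∈ S) (hy₀ : y₀ ∈ S)
    (hc : ‖constr x‖ ≤ 1 / 2) (hres : ‖penGradX f ρ x y‖ ≤ ε) (hdy : τ⁻¹ * ‖y - y₀‖ ≤ ε)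
    (hsub : IsWeakSubgradient (edom h) (finVal h) ζ y
      (τ⁻¹ • (y₀ + τ • gradY f (dissolve x) y₀ - y))) :
    GoodIterate f h ζ ρ (5 + 3 * Kd * (1 + Lxx * KA) + 3 * Lyx * KA) ε x y := by
  have hLxx := H.Lxx_nonneg
  have hLyx := H.Lyx_nonneg
  have hLyy := H.Lyy_nonneg
  have hε : 0 ≤ ε := (norm_nonneg _).trans hres
  have hρ0 : 0 < ρ := by linarith
  obtain ⟨u, hu, huniq, hdist⟩ := exists_unique_nearest (hc.trans_lt (by norm_num))
  obtain ⟨h1, h2⟩ := constr_le_of_penalty_gradient hc (hG x hx y hy) hρ0 hρG hres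
  have huX := mem_ballX_of_mem_stiefel hC hu.1
  have huB := mem_barX_of_mem_stiefel hC hu.1
  have hAu := dissolve_of_mem_stiefel hu.1
  have hxu : ‖x - u‖ ≤ 3 / ρ * ε := hdist.trans h1
  have hxu3 : ‖x - u‖ ≤ 3 * ε := hxu.trans (by
    gcongr
    exact div_le_self (by norm_num) hρ)
  have hA : ‖dissolve x - u‖ ≤ KA * (3 * ε) := by
    have := hKA x hx u huX
    rw [hAu] at this
    exact this.trans (by gcongr)
  have hxB := dissolve_mem_barX hx
  have hgx : ‖gradX f (dissolve x) y - gradX f u y‖ ≤ Lxx * (KA * (3 * ε)) := by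
    have := (H.lip _ hxB u huB y (hS hy) y (hS hy)).1
    rw [sub_self, norm_zero, mul_zero, add_zero] at this
    exact this.trans (by gcongr)
  have hgu : ‖gradX f u y‖ ≤ G := by have := hG u huX y hy; rwa [hAu] at this
  refine ⟨u, hu, huniq, hxu, ?_, _, hsub, ?_⟩
  · rw [← dissolveGrad_of_mem_stiefel hu.1]
    have h3 := hKd x hx u huX _ _ (hG x hx y hy) hgu
    have h4 : Kd * (‖x - u‖ + ‖gradX f (dissolve x) y - gradX f u y‖) ≤
      Kd * (3 * ε + Lxx * (KA * (3 * ε))) := by gcongr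
    have h5 := norm_le_norm_add_norm_sub (dissolveGrad x (gradX f (dissolve x) y))
      (dissolveGrad u (gradX f u y))
    have h6 : 0 ≤ 3 * Lyx * KA * ε := by positivity
    linarith
  -- The prox subgradient involves the gradient at the previous dual point; `τ * Lyy ≤ 1` pays for
  -- changing `y₀` into `y`.
  · have e : -gradY f u y + τ⁻¹ • (y₀ + τ • gradY f (dissolve x) y₀ - y) =
        (gradY f (dissolve x) y₀ - gradY f u y) - τ⁻¹ • (y - y₀) := by
      rw [show y₀ + τ • gradY f (dissolve x) y₀ - y = -(y - y₀) + τ • gradY f (dissolve x) y₀ by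
        abel, smul_add, smul_smul, inv_mul_cancel₀ hτ.ne', one_smul, smul_neg]
      abel
    rw [e]
    refine (norm_sub_le _ _).trans ?_
    rw [norm_smul, Real.norm_of_nonneg (inv_nonneg.2 hτ.le)]
    have h3 := (H.lip _ hxB u huB y₀ (hS hy₀) y (hS hy)).2
    have h4 : ‖y₀ - y‖ ≤ τ * ε := by
      rw [norm_sub_rev, mul_comm, ← div_le_iff₀ hτ, div_eq_inv_mul]; exact hdy
    have h5 : Lyy * ‖y₀ - y‖ ≤ ε := by
      calc Lyy * ‖y₀ - y‖ ≤ Lyy * (τ * ε) := by gcongr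
        _ = (τ * Lyy) * ε := by ring
        _ ≤ 1 * ε := by gcongr
        _ = ε := one_mul _
    have h6 : Lyx * ‖dissolve x - u‖ ≤ Lyx * (KA * (3 * ε)) := by gcongr
    have h7 : 0 ≤ 3 * Kd * (1 + Lxx * KA) * ε := by positivity
    linarith

/-- Limits of increasingly stationary points are stationary. -/
theorem isMinimaxStationary_of_tendsto (H : RegularData f h ζ μ C Lxx Lxy Lyx Lyy yh) (hC : √r < C)
    {ρ D : ℝ} {x : ℕ → Mat d r} {y : ℕ → Vec m} {ε : ℕ → ℝ} (hε : Tendsto ε atTop (𝓝 0))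
    (hgood : ∀ n, GoodIterate f h ζ ρ D (ε n) (x n) (y n)) {xs : Mat d r} {ys : Vec m}
    (hx : Tendsto x atTop (𝓝 xs)) (hy : Tendsto y atTop (𝓝 ys)) :
    IsMinimaxStationary f h xs ys := by
  choose u hu huniq hdist hgx g hg hgy using hgood
  have hεc : ∀ c : ℝ, Tendsto (fun n => c * ε n) atTop (𝓝 0) := fun c => by
    simpa using hε.const_mul c
  have hux : Tendsto u atTop (𝓝 xs) := by
    have h1 : Tendsto (fun n => x n - u n) atTop (𝓝 0) :=
      squeeze_zero_norm hdist (hεc _)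
    simpa using hx.sub h1
  have hxs : xs ∈ stiefel d r :=
    isClosed_stiefel.mem_of_tendsto hux (Eventually.of_forall fun n => (hu n).1)
  have hys : ys ∈ edom h :=
    H.reg.closed_dom.mem_of_tendsto hy (Eventually.of_forall fun n => (hg n).1)
  have hxsB := mem_barX_of_mem_stiefel hC hxs
  have huB : ∀ n, u n ∈ barX d r C := fun n => mem_barX_of_mem_stiefel hC (hu n).1
  have hlim : ∀ a b : ℝ, Tendsto (fun n => a * ‖u n - xs‖ + b * ‖y n - ys‖) atTop (𝓝 0) := by
    intro a b
    have h1 := ((tendsto_iff_norm_sub_tendsto_zero.1 hux).const_mul a).add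
      ((tendsto_iff_norm_sub_tendsto_zero.1 hy).const_mul b)
    simpa using h1
  have hGX : Tendsto (fun n => gradX f (u n) (y n)) atTop (𝓝 (gradX f xs ys)) := by
    rw [tendsto_iff_norm_sub_tendsto_zero]
    exact squeeze_zero (fun n => norm_nonneg _)
      (fun n => (H.lip _ (huB n) xs hxsB _ (hg n).1 ys hys).1) (hlim _ _)
  have hGY : Tendsto (fun n => gradY f (u n) (y n)) atTop (𝓝 (gradY f xs ys)) := by
    rw [tendsto_iff_norm_sub_tendsto_zero]
    exact squeeze_zero (fun n => norm_nonneg _)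
      (fun n => (H.lip _ (huB n) xs hxsB _ (hg n).1 ys hys).2) (hlim _ _)
  refine ⟨hxs, hys, ?_, gradY f xs ys, ?_, neg_add_cancel _⟩
  · rw [← dissolveGrad_of_mem_stiefel hxs]
    have hc : Continuous fun p : Mat d r × Mat d r => dissolveGrad p.1 p.2 :=
      contDiff_dissolveGrad.continuous
    have hp : Tendsto (fun n => (u n, gradX f (u n) (y n))) atTop (𝓝 (xs, gradX f xs ys)) :=
      hux.prodMk_nhds hGX
    have h1 := (hc.tendsto _).comp hp
    have h2 : Tendsto (fun n => dissolveGrad (u n) (gradX f (u n) (y n))) atTop (𝓝 0) :=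
      squeeze_zero_norm (fun n => by
        rw [dissolveGrad_of_mem_stiefel (hu n).1]; exact hgx n) (hεc D)
    exact tendsto_nhds_unique h1 h2
  · apply mem_subdiff_of_isWeakSubgradient (ζ := ζ)
    have hgl : Tendsto g atTop (𝓝 (gradY f xs ys)) := by
      have h1 : Tendsto (fun n => -gradY f (u n) (y n) + g n) atTop (𝓝 0) :=
        squeeze_zero_norm hgy (hεc D)
      simpa using hGY.add h1
    refine ⟨hys, fun w hw => ?_⟩
    -- Continuity of `h` on its closed domain upgrades lower semicontinuity, as needed to pass to
    -- the limit on the smaller side.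
    have hv : Tendsto (fun n => finVal h (y n)) atTop (𝓝 (finVal h ys)) :=
      (H.reg.continuousOn ys hys).tendsto.comp
        (tendsto_nhdsWithin_iff.2 ⟨hy, Eventually.of_forall fun n => (hg n).1⟩)
    have hwy : Tendsto (fun n => w - y n) atTop (𝓝 (w - ys)) := tendsto_const_nhds.sub hy
    exact le_of_tendsto ((hv.add (hgl.inner hwy)).sub ((hwy.norm.pow 2).const_mul (ζ / 2)))
      (Eventually.of_forall fun n => (hg n).2 w hw)

end RegularData

/-- A run of the method with admissible parameters, confined to a ball on which `l` is a valid
Lipschitz constant. -/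
structure AdmissibleRun (f : Mat d r → Vec m → ℝ) (h : Vec m → EReal)
    (ζ μ C Lxx Lxy Lyx Lyy : ℝ) (yh : Mat d r → Vec m) (α ρ R R₀ l τ₁ τ₂ β : ℝ) (z₀ : Mat d r)
    (x : ℕ → Mat d r) (y : ℕ → Vec m) (z : ℕ → Mat d r) : Prop where
  data : RegularData f h ζ μ C Lxx Lxy Lyx Lyy yh
  radius : √r < C
  start : z₀ ∈ stiefel d r
  alpha_pos : 0 < α
  alpha_lt : α < 1 / 2306
  rho_nonneg : 0 ≤ ρ
  l_pos : 0 < l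
  lip : PenLipschitz f ρ C (edom h ∩ Metric.closedBall 0 R) l
  bound : ∀ x ∈ ballX d r C, ‖yh (dissolve x)‖ ≤ R₀
  dual_radius : 5 * R₀ + 2 * √(2 * (primal f h z₀ - primalLower f h C) / μ) ≤ R
  tau₁_pos : 0 < τ₁
  tau₁_le : τ₁ ≤ 1 / (3 * l)
  tau₂_eq : τ₂ = 1 / 16 * (3 / τ₁ + ζ)⁻¹
  beta_eq : β = α * min μ l * τ₂
  tau₂_Lyy : τ₂ * Lyy ≤ 1 / 8
  z_zero : z 0 = z₀
  y_zero : y 0 ∈ argmaxDual f h ρ (2 * l) C z₀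
  x_zero : x 0 = z₀ ∨ x 0 ∈ argminPrimal f h ρ (2 * l) C z₀
  run : IsSmMGDA f h ρ C (2 * l) τ₁ τ₂ β x y z

namespace AdmissibleRun

variable {α ρ R R₀ l τ₁ τ₂ β : ℝ} {z₀ : Mat d r} {x : ℕ → Mat d r} {y : ℕ → Vec m}
  {z : ℕ → Mat d r}

theorem tau₂_pos (A : AdmissibleRun f h ζ μ C Lxx Lxy Lyx Lyy yh α ρ R R₀ l τ₁ τ₂ β z₀ x y z) :
    0 < τ₂ := by
  have := A.data.reg.zeta_nonneg
  have := A.tau₁_pos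
  rw [A.tau₂_eq]; positivity

theorem inv_tau₂ (A : AdmissibleRun f h ζ μ C Lxx Lxy Lyx Lyy yh α ρ R R₀ l τ₁ τ₂ β z₀ x y z) :
    τ₂⁻¹ = 48 * τ₁⁻¹ + 16 * ζ := by
  have := A.tau₁_pos
  rw [A.tau₂_eq, mul_inv, inv_inv]; field_simp; ring

theorem three_l_le (A : AdmissibleRun f h ζ μ C Lxx Lxy Lyx Lyy yh α ρ R R₀ l τ₁ τ₂ β z₀ x y z) :
    3 * l ≤ τ₁⁻¹ := by
  have := A.l_pos
  rw [le_inv_comm₀ (by positivity) A.tau₁_pos]; simpa using A.tau₁_le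

theorem tau₂_zeta (A : AdmissibleRun f h ζ μ C Lxx Lxy Lyx Lyy yh α ρ R R₀ l τ₁ τ₂ β z₀ x y z) :
    τ₂ * ζ ≤ 1 / 16 := by
  have h1 : τ₂ * τ₂⁻¹ = 1 := mul_inv_cancel₀ A.tau₂_pos.ne'
  have h2 : τ₂ * (16 * ζ) ≤ τ₂ * τ₂⁻¹ := by
    apply mul_le_mul_of_nonneg_left _ A.tau₂_pos.le
    rw [A.inv_tau₂]
    have := inv_pos.2 A.tau₁_pos
    linarith
  linarith

theorem gap_nonneg (A : AdmissibleRun f h ζ μ C Lxx Lxy Lyx Lyy yh α ρ R R₀ l τ₁ τ₂ β z₀ x y z) :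
    0 ≤ primal f h z₀ - primalLower f h C := by
  have h1 := A.data.primalLower_le (mem_ballX_of_mem_stiefel A.radius A.start)
  rw [dissolve_of_mem_stiefel A.start] at h1
  rw [A.data.primal_eq (mem_barX_of_mem_stiefel A.radius A.start)]
  linarith

theorem mem_ballX (A : AdmissibleRun f h ζ μ C Lxx Lxy Lyx Lyy yh α ρ R R₀ l τ₁ τ₂ β z₀ x y z)
    (t : ℕ) : x t ∈ ballX d r C := by
  cases t with
  | zero =>
    rcases A.x_zero with h | h
    · rw [h]; exact mem_ballX_of_mem_stiefel A.radius A.start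
    · exact h.1
  | succ t => exact (A.run t).1.1

theorem mem_edom (A : AdmissibleRun f h ζ μ C Lxx Lxy Lyx Lyy yh α ρ R R₀ l τ₁ τ₂ β z₀ x y z)
    (t : ℕ) : y t ∈ edom h := by
  cases t with
  | zero => exact A.y_zero.1
  | succ t => exact (A.run t).2.1.1

theorem weakSubgradient
    (A : AdmissibleRun f h ζ μ C Lxx Lxy Lyx Lyy yh α ρ R R₀ l τ₁ τ₂ β z₀ x y z) (t : ℕ) :
    IsWeakSubgradient (edom h) (finVal h) ζ (y (t + 1))
      (τ₂⁻¹ • (y t + τ₂ • gradY f (dissolve (x (t + 1))) (y t) - y (t + 1))) :=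
  isWeakSubgradient_of_prox A.tau₂_pos A.data.reg.weaklyConvex (A.run t).2.1.1 (A.run t).2.1.2

/-- The numerical factors are at least `15/16` on the left and at most `9/8` on the right. `Lyy` is
valid on the whole domain, unlike `l`, so the new dual point need not be known to lie in the ball.
-/
theorem dual_contract
    (A : AdmissibleRun f h ζ μ C Lxx Lxy Lyx Lyy yh α ρ R R₀ l τ₁ τ₂ β z₀ x y z) (t : ℕ) :
    ‖y (t + 1) - yh (dissolve (x (t + 1)))‖ ≤ 2 * ‖y t - yh (dissolve (x (t + 1)))‖ := by
  have hx := dissolve_mem_barX (A.mem_ballX (t + 1))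
  have h1 := prox_gradient_dist_le (L := Lyy) A.tau₂_pos (A.weakSubgradient t)
    (A.data.isWeakSubgradient_yh hx) (by
      simpa using (A.data.lip _ hx _ hx _ (A.mem_edom t) _ (A.data.yh_mem _ hx)).2)
  have h2 := A.tau₂_zeta
  have h3 := A.tau₂_Lyy
  nlinarith [norm_nonneg (y (t + 1) - yh (dissolve (x (t + 1)))),
    norm_nonneg (y t - yh (dissolve (x (t + 1))))]

/-- The potential decreases along the run, and controls the distance to the manifold. -/
theorem exists_potential
    (A : AdmissibleRun f h ζ μ C Lxx Lxy Lyx Lyy yh α ρ R R₀ l τ₁ τ₂ β z₀ x y z) :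
    ∃ (V : ℕ → ℝ) (xs : ℕ → Mat d r), V 0 ≤ primal f h z₀ ∧
      ∀ t, primalLower f h C ≤ V t ∧ y t ∈ edom h ∩ Metric.closedBall 0 R ∧
        xs t ∈ ballX d r C ∧
        ρ / 4 * ‖constr (xs t)‖ ^ 2 ≤ primal f h z₀ - primalLower f h C ∧
        l * ‖x t - xs t‖ ^ 2 ≤ 4 * (primal f h z₀ - primalLower f h C) ∧
        τ₁⁻¹ / 8 * ‖x (t + 1) - x t‖ ^ 2 + τ₂⁻¹ / 2 * ‖y (t + 1) - y t‖ ^ 2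
          + l * β / 2 * ‖x (t + 1) - z t‖ ^ 2 ≤ V t - V (t + 1) := by
  have H := A.data
  have hC0 : 0 ≤ C := (Real.sqrt_nonneg _).trans A.radius.le
  have hl := A.l_pos
  have hμ := H.mu_pos
  have hΔ := A.gap_nonneg
  have hz₀X := mem_ballX_of_mem_stiefel A.radius A.start
  have hR₀0 : 0 ≤ R₀ := (norm_nonneg _).trans (A.bound z₀ hz₀X)
  set Δ := primal f h z₀ - primalLower f h C with hΔdef
  have hsq0 : 0 ≤ √(2 * Δ / μ) := Real.sqrt_nonneg _
  have hRdual := A.dual_radius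
  rw [← hΔdef] at hRdual
  have hR₀R : ∀ x ∈ ballX d r C, ‖yh (dissolve x)‖ ≤ R := fun x hx =>
    (A.bound x hx).trans (by linarith)
  have hB := H.couplingBounds A.lip
  have hmin : ∀ y ∈ edom h, ∀ z, ∃ a, IsInnerMin (ballX d r C) (pen f ρ) (finVal h) l y z a :=
    fun y hy z => H.exists_innerMin hC0 ρ l hy z
  choose! a ha using hmin
  choose xs hs using H.exists_saddle hC0 hl.le A.lip hR₀R
  set ys : Mat d r → Vec m := fun z => yh (dissolve (xs z)) with hys
  set φ := smoothed (pen f ρ) (finVal h) l with hφ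
  set V : ℕ → ℝ := fun t => φ (x t) (y t) (z t) - 2 * φ (a (y t) (z t)) (y t) (z t)
    + 2 * φ (xs (z t)) (ys (z t)) (z t) with hV
  have hP : ∀ z, primalLower f h C + ρ / 4 * ‖constr (xs z)‖ ^ 2 ≤ φ (xs z) (ys z) z := by
    intro z
    rw [hφ, RegularData.smoothed_yh]
    have := H.primalLower_le (hs z).min.1
    have : 0 ≤ l * ‖xs z - z‖ ^ 2 := by positivity
    simp only [hys]
    linarith
  have hP' : ∀ z, primalLower f h C ≤ φ (xs z) (ys z) z := by
    intro z
    have := hP z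
    have := A.rho_nonneg
    have : 0 ≤ ρ / 4 * ‖constr (xs z)‖ ^ 2 := by positivity
    linarith
  have hVP : ∀ t, φ (xs (z t)) (ys (z t)) (z t) ≤ V t := by
    intro t
    have h1 := (ha (y t) (A.mem_edom t) (z t)).2 _ (A.mem_ballX t)
    have h2 := (ha (y t) (A.mem_edom t) (z t)).2 _ (hs (z t)).min.1
    have h3 := (hs (z t)).max _ (A.mem_edom t)
    simp only [hV]
    linarith
  -- The dual start is optimal, so `-2 Ψ + 2 P` vanishes; either primal start then costs at most the
  -- value at `z₀`, where both penalty and proximal term are zero.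
  have hV0 : V 0 ≤ primal f h z₀ := by
    obtain ⟨e1, e2⟩ := H.argmaxDual_eq A.lip A.y_zero (ha (y 0) (A.mem_edom 0) z₀) (hs z₀)
    have hz₀φ : φ z₀ (yh (dissolve z₀)) z₀ = primal f h z₀ := by
      rw [hφ, RegularData.smoothed_yh, dissolve_of_mem_stiefel A.start,
        constr_eq_zero_iff.2 A.start,
        H.primal_eq (mem_barX_of_mem_stiefel A.radius A.start)]
      simp
    have h1 : V 0 = φ (x 0) (y 0) z₀ := by
      simp only [hV, A.z_zero]
      have e2' : φ (a (y 0) z₀) (y 0) z₀ = φ (xs z₀) (ys z₀) z₀ := e2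
      rw [e2']; ring
    have h2 : φ (x 0) (y 0) z₀ ≤ φ (x 0) (yh (dissolve (x 0))) z₀ := by
      rw [hφ, RegularData.smoothed_yh, RegularData.smoothed_yh]
      have := H.yh_max _ (dissolve_mem_barX (A.mem_ballX 0)) _ (A.mem_edom 0)
      linarith
    rw [h1]
    refine h2.trans ?_
    rw [← hz₀φ]
    rcases A.x_zero with h | h
    · rw [h]
    · have := h.2 z₀ hz₀X
      rwa [H.auxPrimal_eq (A.mem_ballX 0), H.auxPrimal_eq hz₀X] at this
  have hball : ∀ t, V t ≤ primal f h z₀ → ‖y t‖ ≤ R₀ + √(2 * Δ / μ) := by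
    intro t ht
    have h1 := hB.dual_dist_le_of_potential (A.mem_ballX t) (A.mem_edom t)
      (ha (y t) (A.mem_edom t) (z t)) (hs (z t)) ht (hP' (z t))
    have h2 : ‖y t - ys (z t)‖ ≤ √(2 * Δ / μ) := by
      apply Real.le_sqrt_of_sq_le
      rw [le_div_iff₀ hμ]
      linarith
    have h3 := A.bound _ (hs (z t)).min.1
    have h4 := norm_le_norm_add_norm_sub' (y t) (ys (z t))
    simp only [hys] at h4 h2
    linarith
  have hmemS : ∀ t, ‖y t‖ ≤ R → y t ∈ edom h ∩ Metric.closedBall 0 R := fun t ht =>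
    ⟨A.mem_edom t, by simpa using ht⟩
  have hstep : ∀ t, V t ≤ primal f h z₀ → τ₁⁻¹ / 8 * ‖x (t + 1) - x t‖ ^ 2
      + τ₂⁻¹ / 2 * ‖y (t + 1) - y t‖ ^ 2
      + l * β / 2 * ‖x (t + 1) - z t‖ ^ 2 ≤ V t - V (t + 1) := by
    intro t ht
    have hyt := hball t ht
    -- Doubling `‖y t‖ + R₀` and adding `R₀` again gives `5 * R₀ + 2 * √(2 * Δ / μ)`, the origin of
    -- the dual radius.
    have hyt1 : ‖y (t + 1)‖ ≤ R := by
      have h1 := A.dual_contract t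
      have h2 := A.bound _ (A.mem_ballX (t + 1))
      have h3 := norm_le_norm_add_norm_sub' (y (t + 1)) (yh (dissolve (x (t + 1))))
      have h4 := norm_sub_le (y t) (yh (dissolve (x (t + 1))))
      linarith
    obtain ⟨hr1, hr2, hr3⟩ := A.run t
    have hy1 := hmemS t (by linarith)
    have hy2 := hmemS (t + 1) hyt1
    have ha1 := ha _ (A.mem_edom (t + 1)) (z t)
    exact hB.one_step (M := Lyy / 2) hl hμ H.reg.zeta_nonneg A.alpha_pos A.alpha_lt A.tau₁_pos
      A.tau₁_le A.tau₂_eq A.beta_eq (A.mem_ballX t) hy1 hy2 (ha _ (A.mem_edom t) _) ha1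
      (ha _ (A.mem_edom (t + 1)) _) (hs (z t)) (hs (z (t + 1))) hr1 (A.weakSubgradient t) hr3
      (fun w hw => by
        have hb := dissolve_mem_barX ha1.1
        have := (abs_le.1 (abs_sub_sub_inner_le H.reg.convex_edom (H.hasGradY _ hb) (L := Lyy)
          (fun y hy w hw => by simpa using (H.lip _ hb _ hb w hw y hy).2) _
          (A.mem_edom (t + 1)) w hw)).2
        simp only [pen, penGradY]
        linarith)
  have hβ0 : 0 ≤ β := by
    have := A.alpha_pos
    have := A.tau₂_pos
    have : 0 < min μ l := lt_min hμ hl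
    rw [A.beta_eq]; positivity
  -- The decrease requires both dual points in the ball, and the ball requires the bound on `V t`;
  -- induction breaks the circle.
  have hVle : ∀ t, V t ≤ primal f h z₀ := by
    intro t
    induction t with
    | zero => exact hV0
    | succ t ih =>
      have h1 := hstep t ih
      have := A.tau₁_pos
      have := A.tau₂_pos
      have : 0 ≤ τ₁⁻¹ / 8 * ‖x (t + 1) - x t‖ ^ 2 + τ₂⁻¹ / 2 * ‖y (t + 1) - y t‖ ^ 2
        + l * β / 2 * ‖x (t + 1) - z t‖ ^ 2 := by positivity
      linarith
  refine ⟨V, fun t => xs (z t), hV0, fun t => ?_⟩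
  have hyt := hmemS t ((hball t (hVle t)).trans (by linarith))
  refine ⟨(hP' _).trans (hVP t), hyt, (hs (z t)).min.1, ?_,
    hB.dist_le_of_potential (A.mem_ballX t) hyt (ha _ (A.mem_edom t) _) (hs (z t)) (hVle t)
      (hP' (z t)), hstep t (hVle t)⟩
  have h1 := hP (z t)
  have h2 := hVP t
  have h3 := hVle t
  linarith

end AdmissibleRun

end Run

/-! ### From decrease of the potential to small residuals -/

/-- If every small enough decrease of a bounded potential yields a good iterate, then good
iterates are found quickly after any time. -/
theorem exists_good_of_potential {V : ℕ → ℝ} {a b Γ : ℝ} {P : ℕ → ℝ → Prop} (hΓ : 0 ≤ Γ)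
    (hlow : ∀ t, a ≤ V t) (hup : V 0 ≤ b) (hV : Antitone V)
    (hP : ∀ t ε, 0 < ε → Γ * (V t - V (t + 1)) ≤ ε ^ 2 → P (t + 1) ε) (N : ℕ) {ε : ℝ}
    (hε : 0 < ε) : ∃ t, N ≤ t ∧ (t : ℝ) ≤ N + 1 + Γ * (b - a) / ε ^ 2 ∧ P t ε := by
  have hab : 0 ≤ b - a := by linarith [hlow 0]
  -- Among this many consecutive steps one decrease is at most the average; it certifies the iterate
  -- at the end of that step.
  set n := ⌊Γ * (b - a) / ε ^ 2⌋₊ + 1 with hn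
  have hn1 : Γ * (b - a) / ε ^ 2 ≤ n := by
    rw [hn]; push_cast; exact (Nat.lt_floor_add_one _).le
  have hn2 : (n : ℝ) ≤ 1 + Γ * (b - a) / ε ^ 2 := by
    rw [hn]; push_cast
    have := Nat.floor_le (show 0 ≤ Γ * (b - a) / ε ^ 2 by positivity)
    linarith
  have hn0 : (0 : ℝ) < n := by rw [hn]; positivity
  have hsum : ∑ i ∈ Finset.range n, (V (N + i) - V (N + i + 1)) ≤ b - a := by
    have h1 := Finset.sum_range_sub' (fun i => V (N + i)) n
    simp only [add_zero, ← add_assoc] at h1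
    rw [h1]
    linarith [hV (Nat.zero_le N), hlow (N + n)]
  obtain ⟨i, hi, hle⟩ : ∃ i ∈ Finset.range n, V (N + i) - V (N + i + 1) ≤ (b - a) / n := by
    by_contra! hcon
    have hlt := Finset.sum_lt_sum_of_nonempty (s := Finset.range n)
      (f := fun _ => (b - a) / n) (by rw [Finset.nonempty_range_iff, hn]; omega) hcon
    rw [Finset.sum_const, Finset.card_range, nsmul_eq_mul, mul_div_cancel₀ _ hn0.ne'] at hlt
    linarith
  rw [Finset.mem_range] at hi
  refine ⟨N + i + 1, by omega, ?_, hP _ _ hε ?_⟩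
  · have : ((N + i + 1 : ℕ) : ℝ) ≤ N + n := by exact_mod_cast (by omega : N + i + 1 ≤ N + n)
    linarith
  · calc Γ * (V (N + i) - V (N + i + 1)) ≤ Γ * ((b - a) / n) := by gcongr
      _ = Γ * (b - a) / n := by ring
      _ ≤ ε ^ 2 := by
        rw [div_le_iff₀ hn0]
        rw [div_le_iff₀ (by positivity)] at hn1
        linarith

theorem exists_vanishing_of_potential {V : ℕ → ℝ} {a Γ : ℝ} {P : ℕ → ℝ → Prop} (hΓ : 0 ≤ Γ)
    (hlow : ∀ t, a ≤ V t) (hV : Antitone V)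
    (hP : ∀ t ε, 0 < ε → Γ * (V t - V (t + 1)) ≤ ε ^ 2 → P (t + 1) ε) :
    ∃ e : ℕ → ℝ, Tendsto e atTop (𝓝 0) ∧ ∀ t, P (t + 1) (e t) := by
  have hlim := tendsto_atTop_ciInf hV ⟨a, by rintro _ ⟨t, rfl⟩; exact hlow t⟩
  have hd : Tendsto (fun t => Γ * (V t - V (t + 1))) atTop (𝓝 0) := by
    simpa using (hlim.sub ((tendsto_add_atTop_iff_nat 1).2 hlim)).const_mul Γ
  -- The summand `1 / (t + 1)` keeps the tolerance positive even when the potential stalls.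
  refine ⟨fun t => √(Γ * (V t - V (t + 1))) + 1 / ((t : ℝ) + 1), ?_, fun t => hP t _ ?_ ?_⟩
  · simpa using (Real.continuous_sqrt.tendsto _ |>.comp hd).add
      tendsto_one_div_add_atTop_nhds_zero_nat
  · positivity
  · have h0 : 0 ≤ Γ * (V t - V (t + 1)) :=
      mul_nonneg hΓ (sub_nonneg.2 (hV (Nat.le_succ t)))
    calc Γ * (V t - V (t + 1)) = √(Γ * (V t - V (t + 1))) ^ 2 := (Real.sq_sqrt h0).symm
      _ ≤ _ := by
        gcongr
        exact le_add_of_nonneg_right (by positivity)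

/-- An interior nearest point could still be moved towards `v`, so it is `v` itself. This makes the
projection in the primal step inactive. -/
theorem IsNearest.eq_of_norm_lt {E : Type*} [NormedAddCommGroup E] [InnerProductSpace ℝ E] {C : ℝ}
    {v u : E} (h : IsNearest {x | ‖x‖ ≤ C} v u) (hu : ‖u‖ < C) : u = v := by
  have hconv : Convex ℝ {x : E | ‖x‖ ≤ C} := by
    have : {x : E | ‖x‖ ≤ C} = Metric.closedBall 0 C := by ext; simp
    rw [this]; exact convex_closedBall _ _
  have hd : 0 < (C - ‖u‖) / (‖v - u‖ + 1) := div_pos (by linarith) (by positivity)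
  set δ := (C - ‖u‖) / (‖v - u‖ + 1) with hδ
  have hmem : ‖u + δ • (v - u)‖ ≤ C := by
    refine (norm_add_le _ _).trans ?_
    rw [norm_smul, Real.norm_of_nonneg hd.le]
    have : δ * (‖v - u‖ + 1) = C - ‖u‖ := by rw [hδ]; field_simp
    linarith
  have h1 := h.inner_nonpos hconv _ hmem
  rw [add_sub_cancel_left, inner_smul_right, real_inner_self_eq_norm_sq] at h1
  have h2 : ‖v - u‖ ^ 2 = 0 :=
    le_antisymm (nonpos_of_mul_nonpos_right h1 hd) (sq_nonneg _)
  rw [sq_eq_zero_iff, norm_eq_zero, sub_eq_zero] at h2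
  exact h2.symm

/-- The step residuals are controlled by the decrease of the potential. -/
theorem residual_budget {s q l ζ α μ β κ e k w δ ε : ℝ} (hl : 0 < l) (hs : 0 < s) (hζ : 0 ≤ ζ)
    (hα : 0 < α) (hμ : 0 < μ) (hq : q = 48 * s + 16 * ζ)
    (hβ : β * q = α * min μ l) (hκ : κ = max 1 (l / μ))
    (hε : 0 ≤ ε) (hβ0 : 0 ≤ β)
    (hδ : s / 8 * e ^ 2 + q / 2 * k ^ 2 + l * β / 2 * w ^ 2 ≤ δ)
    (hb : κ * (s + ζ) * (384 + 1152 / α) * δ ≤ ε ^ 2) :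
    2 * s * e + 2 * l * w + q * k ≤ ε := by
  have hq0 : 0 < q := by rw [hq]; positivity
  have hκ1 : 1 ≤ κ := by rw [hκ]; exact le_max_left _ _
  -- The condition number enters here: the centre displacement is controlled only with weight `β`,
  -- which is proportional to `min μ l`.
  have hκm : κ * min μ l = l := by
    rw [hκ]
    rcases le_total μ l with h | h
    · rw [min_eq_left h, max_eq_right ((one_le_div hμ).2 h), div_mul_cancel₀ _ hμ.ne']
    · rw [min_eq_right h, max_eq_left ((div_le_one hμ).2 h), one_mul]
  have b1 : 0 ≤ s / 8 * e ^ 2 := by positivity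
  have b2 : 0 ≤ q / 2 * k ^ 2 := by positivity
  have b3 : 0 ≤ l * β / 2 * w ^ 2 := by positivity
  have hδ0 : 0 ≤ δ := by linarith
  have c1 : s ^ 2 * e ^ 2 ≤ 8 * (κ * (s + ζ) * δ) := by
    calc s ^ 2 * e ^ 2 = 8 * (s * (s / 8 * e ^ 2)) := by ring
      _ ≤ 8 * (κ * (s + ζ) * δ) := by
        gcongr
        · nlinarith
        · linarith
  have hq1 : q ≤ 48 * (s + ζ) := by rw [hq]; linarith
  have c2 : q ^ 2 * k ^ 2 ≤ 96 * (κ * (s + ζ) * δ) := by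
    calc q ^ 2 * k ^ 2 = 2 * (q * (q / 2 * k ^ 2)) := by ring
      _ ≤ 2 * ((48 * (κ * (s + ζ))) * δ) := by
        gcongr
        · nlinarith
        · linarith
      _ = _ := by ring
  have c3 : l ^ 2 * w ^ 2 ≤ 96 / α * (κ * (s + ζ) * δ) := by
    rw [div_mul_eq_mul_div, le_div_iff₀ hα]
    calc l ^ 2 * w ^ 2 * α = l * w ^ 2 * α * (κ * min μ l) := by rw [hκm]; ring
      _ = κ * (l * w ^ 2 * (β * q)) := by rw [hβ]; ring
      _ = 2 * (κ * q * (l * β / 2 * w ^ 2)) := by ring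
      _ ≤ 2 * (κ * (48 * (s + ζ)) * δ) := by
        gcongr
        linarith
      _ = _ := by ring
  refine le_of_sq_le_sq ?_ hε
  refine le_trans ?_ hb
  -- The weights `12, 12, 3` meet `8, 96 / α, 96`, so the constants are `384 = 96 + 288` and `1152 =
  -- 12 * 96`.
  have c4 : (2 * s * e + 2 * l * w + q * k) ^ 2 ≤
      12 * (s ^ 2 * e ^ 2) + 12 * (l ^ 2 * w ^ 2) + 3 * (q ^ 2 * k ^ 2) := by
    nlinarith [sq_nonneg (2 * s * e - 2 * l * w), sq_nonneg (2 * s * e - q * k),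
      sq_nonneg (2 * l * w - q * k)]
  have c5 : κ * (s + ζ) * (384 + 1152 / α) * δ =
      12 * (8 * (κ * (s + ζ) * δ)) + 12 * (96 / α * (κ * (s + ζ) * δ))
        + 3 * (96 * (κ * (s + ζ) * δ)) := by ring
  linarith

/-! ### Approximate stationarity of the iterates -/

section Main

variable {d r m : ℕ} {f : Mat d r → Vec m → ℝ} {h : Vec m → EReal}
  {ζ μ C Lxx Lxy Lyx Lyy : ℝ} {yh : Mat d r → Vec m}
  {α ρ R R₀ l τ₁ τ₂ β : ℝ} {z₀ : Mat d r} {x : ℕ → Mat d r} {y : ℕ → Vec m}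
  {z : ℕ → Mat d r}

/-- With the projection inactive, the step equation expresses the penalty gradient at the old point
through displacements; the Lipschitz bound on the dual ball carries it to the new point. -/
theorem AdmissibleRun.residual_le
    (A : AdmissibleRun f h ζ μ C Lxx Lxy Lyx Lyy yh α ρ R R₀ l τ₁ τ₂ β z₀ x y z) {t : ℕ}
    (hy : y t ∈ edom h ∩ Metric.closedBall 0 R)
    (hy' : y (t + 1) ∈ edom h ∩ Metric.closedBall 0 R) (hx : ‖x (t + 1)‖ < C) {δ ε : ℝ}
    (hδ : τ₁⁻¹ / 8 * ‖x (t + 1) - x t‖ ^ 2 + τ₂⁻¹ / 2 * ‖y (t + 1) - y t‖ ^ 2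
          + l * β / 2 * ‖x (t + 1) - z t‖ ^ 2 ≤ δ) (hε : 0 ≤ ε)
    (hb : max 1 (l / μ) * (τ₁⁻¹ + ζ) * (384 + 1152 / α) * δ ≤ ε ^ 2) :
    ‖penGradX f ρ (x (t + 1)) (y (t + 1))‖ ≤ ε ∧ τ₂⁻¹ * ‖y (t + 1) - y t‖ ≤ ε := by
  have hl := A.l_pos
  have hτ₂ := A.tau₂_pos
  have hα := A.alpha_pos
  have hμ := A.data.mu_pos
  have hs : 0 < τ₁⁻¹ := inv_pos.2 A.tau₁_pos
  have hsl := A.three_l_le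
  have hβ : β * τ₂⁻¹ = α * min μ l := by
    rw [A.beta_eq, mul_assoc, mul_inv_cancel₀ hτ₂.ne', mul_one]
  have hβ0 : 0 ≤ β := by
    have : 0 < min μ l := lt_min hμ hl
    rw [A.beta_eq]; positivity
  have key := residual_budget hl hs A.data.reg.zeta_nonneg hα hμ A.inv_tau₂ hβ rfl
    hε hβ0 hδ hb
  have hqs : τ₁⁻¹ ≤ τ₂⁻¹ := by
    have := A.data.reg.zeta_nonneg
    rw [A.inv_tau₂]; linarith
  have hk : 0 ≤ ‖y (t + 1) - y t‖ := norm_nonneg _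
  have hw : 0 ≤ ‖x (t + 1) - z t‖ := norm_nonneg _
  have he : 0 ≤ ‖x (t + 1) - x t‖ := norm_nonneg _
  refine ⟨?_, le_trans ?_ key⟩
  · have hx1 := (A.run t).1.eq_of_norm_lt hx
    have h1 : penGradX f ρ (x t) (y t) =
        τ₁⁻¹ • (x t - x (t + 1)) - (2 * l) • (x t - z t) := by
      have : x t - x (t + 1) = τ₁ • (penGradX f ρ (x t) (y t) + (2 * l) • (x t - z t)) := by
        rw [hx1]; abel
      rw [this, smul_smul, inv_mul_cancel₀ A.tau₁_pos.ne', one_smul, add_sub_cancel_right]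
    have h2 : ‖penGradX f ρ (x t) (y t)‖ ≤ τ₁⁻¹ * ‖x (t + 1) - x t‖
        + 2 * l * (‖x (t + 1) - x t‖ + ‖x (t + 1) - z t‖) := by
      rw [h1]
      refine (norm_sub_le _ _).trans ?_
      rw [norm_smul, norm_smul, Real.norm_of_nonneg hs.le,
        Real.norm_of_nonneg (show 0 ≤ 2 * l by positivity), norm_sub_rev (x t) (x (t + 1))]
      have : ‖x t - z t‖ ≤ ‖x (t + 1) - x t‖ + ‖x (t + 1) - z t‖ := by
        rw [show x t - z t = (x (t + 1) - z t) - (x (t + 1) - x t) by abel,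
          add_comm ‖x (t + 1) - x t‖]
        exact norm_sub_le _ _
      gcongr
    have h3 := (A.lip _ (A.mem_ballX (t + 1)) _ (A.mem_ballX t) _ hy' _ hy).1
    have h4 := norm_le_norm_add_norm_sub' (penGradX f ρ (x (t + 1)) (y (t + 1)))
      (penGradX f ρ (x t) (y t))
    refine le_trans ?_ key
    have h5 : 3 * l * ‖x (t + 1) - x t‖ ≤ τ₁⁻¹ * ‖x (t + 1) - x t‖ := by gcongr
    have h6 : l * ‖y (t + 1) - y t‖ ≤ τ₂⁻¹ * ‖y (t + 1) - y t‖ := by gcongr; linarith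
    linarith
  · have : 0 ≤ 2 * τ₁⁻¹ * ‖x (t + 1) - x t‖ + 2 * l * ‖x (t + 1) - z t‖ := by positivity
    linarith

/-- For large penalty parameters, a small decrease of the potential gives a good iterate. -/
theorem AdmissibleRun.exists_potential_good
    (A : AdmissibleRun f h ζ μ C Lxx Lxy Lyx Lyy yh α ρ R R₀ l τ₁ τ₂ β z₀ x y z)
    (hC : √r + 1 / 2 < C) {G KA Kd Kc : ℝ} (hKA0 : 0 ≤ KA) (hKd0 : 0 ≤ Kd)
    (hG : ∀ x ∈ ballX d r C, ∀ y ∈ edom h ∩ Metric.closedBall 0 R, ‖gradX f (dissolve x) y‖ ≤ G)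
    (hKA : ∀ x ∈ ballX d r C, ∀ x' ∈ ballX d r C, ‖dissolve x - dissolve x'‖ ≤ KA * ‖x - x'‖)
    (hKd : ∀ x ∈ ballX d r C, ∀ x' ∈ ballX d r C, ∀ u u' : Mat d r, ‖u‖ ≤ G → ‖u'‖ ≤ G →
      ‖dissolveGrad x u - dissolveGrad x' u'‖ ≤ Kd * (‖x - x'‖ + ‖u - u'‖))
    (hKc : ∀ x ∈ ballX d r C, ∀ x' ∈ ballX d r C, ‖constr x - constr x'‖ ≤ Kc * ‖x - x'‖)
    (hρ : 1 ≤ ρ) (hρG : 9 / 2 * G ≤ ρ) (hρl : ρ / 2 ≤ l)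
    (hρ1 : 64 * (primal f h z₀ - primalLower f h C) ≤ ρ)
    (hρ2 : 128 * (Kc ^ 2 * (primal f h z₀ - primalLower f h C)) ≤ ρ) :
    ∃ V : ℕ → ℝ, (∀ t, primalLower f h C ≤ V t) ∧ V 0 ≤ primal f h z₀ ∧ Antitone V ∧
      ∀ t ε, 0 < ε → max 1 (l / μ) * (τ₁⁻¹ + ζ) * (384 + 1152 / α) * (V t - V (t + 1)) ≤ ε ^ 2 →
        GoodIterate f h ζ ρ (5 + 3 * Kd * (1 + Lxx * KA) + 3 * Lyx * KA) ε (x (t + 1))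
          (y (t + 1)) := by
  obtain ⟨V, xs, hV0, hV⟩ := A.exists_potential
  have hτ₁ := A.tau₁_pos
  have hτ₂ := A.tau₂_pos
  have hl := A.l_pos
  have hβ0 : 0 ≤ β := by
    have := A.alpha_pos
    have : 0 < min μ l := lt_min A.data.mu_pos hl
    rw [A.beta_eq]; positivity
  refine ⟨V, fun t => (hV t).1, hV0, antitone_nat_of_succ_le fun t => ?_, fun t ε hε hb => ?_⟩
  · have h1 := (hV t).2.2.2.2.2
    have : 0 ≤ τ₁⁻¹ / 8 * ‖x (t + 1) - x t‖ ^ 2 + τ₂⁻¹ / 2 * ‖y (t + 1) - y t‖ ^ 2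
        + l * β / 2 * ‖x (t + 1) - z t‖ ^ 2 := by positivity
    linarith
  · obtain ⟨-, hy', hxs, h1, h2, -⟩ := hV (t + 1)
    obtain ⟨-, hy, -, -, -, hdec⟩ := hV t
    have hρ0 : 0 < ρ := by linarith
    have hxX := A.mem_ballX (t + 1)
    -- Half of the allowed violation goes to the saddle point and half to the distance from it; the
    -- latter uses `ρ / 2 ≤ l`.
    have c1 : ‖constr (xs (t + 1))‖ ≤ 1 / 4 := by
      refine le_of_sq_le_sq (le_of_mul_le_mul_left ?_ hρ0) (by norm_num)
      linarith
    have c2 : Kc * ‖x (t + 1) - xs (t + 1)‖ ≤ 1 / 4 := by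
      refine le_of_sq_le_sq (le_of_mul_le_mul_left ?_ hρ0) (by norm_num)
      have h3 : ρ / 2 * ‖x (t + 1) - xs (t + 1)‖ ^ 2 ≤
        4 * (primal f h z₀ - primalLower f h C) := le_trans (by gcongr) h2
      have h4 := mul_le_mul_of_nonneg_left h3 (sq_nonneg Kc)
      rw [mul_pow]
      linarith
    have hc : ‖constr (x (t + 1))‖ ≤ 1 / 2 := by
      have h3 := hKc _ hxX _ hxs
      have h4 := norm_le_norm_add_norm_sub' (constr (x (t + 1))) (constr (xs (t + 1)))
      linarith
    -- The nearest manifold point has norm `√r` and is within `1 / 2`, which is exactly the margin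
    -- in the hypothesis on `C`.
    have hxC : ‖x (t + 1)‖ < C := by
      obtain ⟨u, hu, -, hdist⟩ := exists_unique_nearest (hc.trans_lt (by norm_num))
      have h3 := norm_le_norm_add_norm_sub' (x (t + 1)) u
      rw [norm_of_mem_stiefel hu.1] at h3
      linarith
    obtain ⟨hr1, hr2⟩ := A.residual_le hy hy' hxC hdec hε.le hb
    exact A.data.goodIterate_of_residual A.radius inter_subset_left hKA0 hKd0 hG hKA hKd hρ hρG
      hτ₂ (A.tau₂_Lyy.trans (by norm_num)) hxX hy' hy hc hr1 hr2 (A.weakSubgradient t)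

/-- If the primal variable lives in a trivial space, every iterate is stationary. -/
theorem RegularData.goodIterate_of_subsingleton [Subsingleton (Mat d r)]
    (H : RegularData f h ζ μ C Lxx Lxy Lyx Lyy yh) (hC : √r < C) (hz₀ : z₀ ∈ stiefel d r)
    (hl : 0 < l) (hlip : PenLipschitz f ρ C (edom h ∩ Metric.closedBall 0 R) l)
    (hR : ∀ x ∈ ballX d r C, ‖yh (dissolve x)‖ ≤ R) (hτ₁ : 0 < τ₁)
    (hτ₂ : τ₂ = 1 / 16 * (3 / τ₁ + ζ)⁻¹) (hy : y 0 ∈ argmaxDual f h ρ (2 * l) C z₀)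
    (hrun : IsSmMGDA f h ρ C (2 * l) τ₁ τ₂ β x y z) {D ε : ℝ} (hρ : 0 ≤ ρ) (hD : 0 ≤ D)
    (hε : 0 ≤ ε) (t : ℕ) : GoodIterate f h ζ ρ D ε (x t) (y t) := by
  have hC0 : 0 ≤ C := (Real.sqrt_nonneg _).trans hC.le
  have hzB := mem_barX_of_mem_stiefel hC hz₀
  have hζ := H.reg.zeta_nonneg
  have hτ : 0 < τ₂ := by rw [hτ₂]; positivity
  have hτζ : τ₂ * ζ < 1 := by
    have : 0 < 3 / τ₁ := by positivity
    rw [hτ₂, mul_assoc, inv_mul_eq_div, one_div_mul_eq_div, div_div, div_lt_one (by positivity)]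
    linarith
  obtain ⟨a, ha⟩ := H.exists_innerMin hC0 ρ l hy.1 z₀
  obtain ⟨xs, hs⟩ := H.exists_saddle hC0 hl.le hlip hR z₀
  -- The dual start is already the maximizer, which the prox-gradient step fixes.
  have hyt : ∀ t, y t = yh z₀ := by
    intro t
    induction t with
    | zero => rw [(H.argmaxDual_eq hlip hy ha hs).1, Subsingleton.elim (dissolve xs) z₀]
    | succ t ih =>
      have h1 := prox_gradient_dist_le (L := Lyy) hτ
        (isWeakSubgradient_of_prox hτ H.reg.weaklyConvex (hrun t).2.1.1 (hrun t).2.1.2)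
        (H.isWeakSubgradient_yh hzB) (by
          rw [Subsingleton.elim (dissolve (x (t + 1))) z₀, ih, sub_self, norm_zero, sub_self,
            norm_zero, mul_zero])
      rw [ih, sub_self, norm_zero, mul_zero] at h1
      have h2 : ‖y (t + 1) - yh z₀‖ ≤ 0 := nonpos_of_mul_nonpos_right h1 (by linarith)
      rw [← sub_eq_zero, ← norm_eq_zero]
      exact le_antisymm h2 (norm_nonneg _)
  refine ⟨z₀, ⟨hz₀, fun w _ => by rw [Subsingleton.elim w z₀]⟩, fun v _ => Subsingleton.elim _ _,
    ?_, ?_, gradY f z₀ (yh z₀), ?_, ?_⟩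
  · rw [Subsingleton.elim (x t - z₀) 0, norm_zero]; positivity
  · rw [Subsingleton.elim (riemGrad z₀ (gradX f z₀ (y t))) 0, norm_zero]; positivity
  · rw [hyt t]; exact H.isWeakSubgradient_yh hzB
  · rw [hyt t, neg_add_cancel, norm_zero]; positivity

end Main

/-! ### Limit points and the final assembly -/

section Conclusion

variable {d r m : ℕ} {f : Mat d r → Vec m → ℝ} {h : Vec m → EReal}
  {ζ μ C Lxx Lxy Lyx Lyy : ℝ} {yh : Mat d r → Vec m}

theorem RegularData.isMinimaxStationary_of_mapClusterPt
    (H : RegularData f h ζ μ C Lxx Lxy Lyx Lyy yh) (hC : √r < C) {ρ D : ℝ} {x : ℕ → Mat d r}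
    {y : ℕ → Vec m} {e : ℕ → ℝ} (he : Tendsto e atTop (𝓝 0))
    (hgood : ∀ t, GoodIterate f h ζ ρ D (e t) (x (t + 1)) (y (t + 1))) {xs : Mat d r} {ys : Vec m}
    (hcl : MapClusterPt (xs, ys) atTop fun t => (x t, y t)) : IsMinimaxStationary f h xs ys := by
  obtain ⟨ψ, hψ, hlim⟩ := hcl.tendsto_subseq
  -- Tolerances are attached to iterates of positive index, so the first term of the subsequence is
  -- dropped.
  have h1 : ∀ n, ψ (n + 1) = ψ (n + 1) - 1 + 1 := fun n => by
    have := hψ.id_le (n + 1)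
    simp only [id_eq] at this
    omega
  have hlim1 := (tendsto_add_atTop_iff_nat 1).2 hlim
  refine H.isMinimaxStationary_of_tendsto hC (ρ := ρ) (D := D) (ε := fun n => e (ψ (n + 1) - 1))
    (x := fun n => x (ψ (n + 1))) (y := fun n => y (ψ (n + 1))) (he.comp ?_) (fun n => ?_)
    hlim1.fst_nhds hlim1.snd_nhds
  · refine tendsto_atTop_mono (fun n => ?_) tendsto_id
    have := hψ.id_le (n + 1)
    simp only [id_eq] at this ⊢
    omega
  · have := hgood (ψ (n + 1) - 1)
    rwa [← h1 n] at this

end Conclusion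

end

theorem mainTheorem4 (α : ℝ) (hα₀ : 0 < α) (hα₁ : α < 1 / 2306) :
    ∃ K : ℝ, 0 < K ∧
    ∀ (d r m : ℕ) (f : Mat d r → Vec m → ℝ) (h : Vec m → EReal) (ζ μ C : ℝ) (z₀ : Mat d r),
      RegularizerAssumption h ζ →
      SmoothAssumption f h C →
      0 < μ →
      StronglyConcaveAssumption f h C μ →
      1 / 2 + sSup ((fun x : Mat d r => ‖x‖) '' stiefel d r) < C →
      z₀ ∈ stiefel d r →
      ∃ (ρbar R D : ℝ) (T : ℝ → ℕ), 0 < ρbar ∧ 0 < R ∧ 0 < D ∧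
        AntitoneOn T (Set.Ioi ρbar) ∧
        ∀ ρ : ℝ, ρbar < ρ →
        ∀ l : ℝ, 0 < l → PenLipschitz f ρ C (edom h ∩ Metric.closedBall 0 R) l →
        ∀ τ₁ τ₂ β : ℝ, 0 < τ₁ → τ₁ ≤ 1 / (3 * l) →
          τ₂ = 1 / 16 * (3 / τ₁ + ζ)⁻¹ → β = α * min μ l * τ₂ →
        ∀ (x : ℕ → Mat d r) (y : ℕ → Vec m) (z : ℕ → Mat d r),
          z 0 = z₀ →
          y 0 ∈ argmaxDual f h ρ (2 * l) C z₀ →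
          (x 0 = z₀ ∨ x 0 ∈ argminPrimal f h ρ (2 * l) C z₀) →
          IsSmMGDA f h ρ C (2 * l) τ₁ τ₂ β x y z →
          (∀ N : ℕ, T ρ ≤ N → ∀ ε : ℝ, 0 < ε →
            ∃ t : ℕ, N ≤ t ∧
              (gradEvals t : ℝ) ≤ gradEvals N +
                K * (1 + max 1 (l / μ) * (1 / τ₁ + ζ) *
                  (primal f h z₀ - primalLower f h C) / ε ^ 2) ∧
              ∃ u : Mat d r, IsNearest (stiefel d r) (x t) u ∧
                (∀ v : Mat d r, IsNearest (stiefel d r) (x t) v → v = u) ∧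
                ‖x t - u‖ ≤ 3 / ρ * ε ∧
                IsApproxStationary f h (D * ε) u (y t)) ∧
          ∀ (xs : Mat d r) (ys : Vec m),
            MapClusterPt (xs, ys) atTop (fun t => (x t, y t)) →
            IsMinimaxStationary f h xs ys := by
  -- Two gradient evaluations per iteration, the `1` for rounding up the iteration count, and the
  -- constant of `residual_budget`.
  refine ⟨2 * (1 + (384 + 1152 / α)), by positivity, ?_⟩
  intro d r m f h ζ μ C z₀ hh hf hμ hconc hC hz₀
  obtain ⟨Lxx, Lxy, Lyx, Lyy, yh, H⟩ := exists_regularData hh hf hμ hconc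
  rw [sSup_norm_stiefel hz₀] at hC
  have hCr : √r < C := by linarith
  have hLxx := H.Lxx_nonneg
  have hLyx := H.Lyx_nonneg
  have hLyy := H.Lyy_nonneg
  obtain ⟨R₀, hR₀0, hR₀⟩ := H.exists_bound_yh
  have hz₀X := mem_ballX_of_mem_stiefel hCr hz₀
  have hΔ : 0 ≤ primal f h z₀ - primalLower f h C := by
    have h1 := H.primalLower_le hz₀X
    rw [dissolve_of_mem_stiefel hz₀] at h1
    rw [H.primal_eq (mem_barX_of_mem_stiefel hCr hz₀)]
    linarith
  -- For `r = 0` the primal space is a point and `l ≥ ρ / 2` may fail, so this case is treated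
  -- separately.
  rcases Nat.eq_zero_or_pos r with rfl | hr
  · refine ⟨1, R₀ + 1, 1, fun _ => 0, one_pos, by positivity, one_pos, fun _ _ _ _ _ => le_rfl, ?_⟩
    intro ρ hρ l hl hlip τ₁ τ₂ β hτ₁ _ hτ₂ _ x y z _ hy0 _ hrun
    have hsub : Subsingleton (Mat d 0) := ⟨fun a b => by ext i; exact i.2.elim0⟩
    have hgood : ∀ t ε, 0 ≤ ε → GoodIterate f h ζ ρ 1 ε (x t) (y t) := fun t ε hε =>
      H.goodIterate_of_subsingleton hCr hz₀ hl hlip (fun x hx => (hR₀ x hx).trans (by linarith))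
        hτ₁ hτ₂ hy0 hrun (by linarith) zero_le_one hε t
    refine ⟨fun N _ ε hε => ⟨N, le_rfl, ?_, (hgood N ε hε.le).isApproxStationary⟩,
      fun xs ys hcl => H.isMinimaxStationary_of_mapClusterPt hCr tendsto_const_nhds
        (fun t => hgood (t + 1) 0 le_rfl) hcl⟩
    have := hh.zeta_nonneg
    exact le_add_of_nonneg_right (by positivity)
  · set Δ := primal f h z₀ - primalLower f h C with hΔdef
    set R := 5 * R₀ + 2 * √(2 * Δ / μ) + 1 with hR
    have hR0 : 0 < R := by positivity
    have hne : (edom h ∩ Metric.closedBall 0 R).Nonempty := by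
      refine ⟨_, H.yh_mem _ (dissolve_mem_barX hz₀X), ?_⟩
      rw [mem_closedBall_zero_iff]
      have := hR₀ _ hz₀X
      have := Real.sqrt_nonneg (2 * Δ / μ)
      linarith
    obtain ⟨G, hG0, hG⟩ := H.exists_bound_gradX R
    obtain ⟨KA, hKA0, hKA⟩ := exists_lipschitz_dissolve d r C
    obtain ⟨Kc, hKc0, hKc⟩ := exists_lipschitz_constr d r C
    obtain ⟨Kd, hKd0, hKd⟩ := exists_lipschitz_dissolveGrad d r C G
    obtain ⟨ρ₀, hρ₀0, hρ₀⟩ := H.exists_penLipschitz_lower hr hCr hz₀ hne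
    -- Each summand secures one threshold on `ρ`: `ρ ≥ 1`, `l ≥ ρ / 2`, a short dual step, dominance
    -- over the coupling gradient, and the two halves of the violation bound. All iterates are then
    -- near the manifold, so the burn-in is zero.
    refine ⟨1 + ρ₀ + Lyy + 9 / 2 * G + 64 * Δ + 128 * (Kc ^ 2 * Δ), R,
      5 + 3 * Kd * (1 + Lxx * KA) + 3 * Lyx * KA, fun _ => 0, by positivity, hR0, by positivity,
      fun _ _ _ _ _ => le_rfl, ?_⟩
    intro ρ hρ l hl hlip τ₁ τ₂ β hτ₁ hτ₁l hτ₂ hβ x y z hz0 hy0 hx0 hrun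
    have b1 : 0 ≤ Kc ^ 2 * Δ := by positivity
    have hρl : ρ / 2 ≤ l := hρ₀ ρ l (by linarith) hlip
    have hζ := hh.zeta_nonneg
    have hτ₂0 : 0 < τ₂ := by rw [hτ₂]; positivity
    have hτL : τ₂ * Lyy ≤ 1 / 8 := by
      have h1 : 3 * l ≤ τ₁⁻¹ := by
        rw [le_inv_comm₀ (by positivity) hτ₁]; simpa using hτ₁l
      have h2 : τ₂⁻¹ = 48 * τ₁⁻¹ + 16 * ζ := by
        rw [hτ₂, mul_inv, inv_inv]; field_simp; ring
      have h3 : 8 * Lyy ≤ τ₂⁻¹ := by rw [h2]; linarith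
      have h4 : τ₂ * (8 * Lyy) ≤ τ₂ * τ₂⁻¹ := by gcongr
      rw [mul_inv_cancel₀ hτ₂0.ne'] at h4
      linarith
    have A : AdmissibleRun f h ζ μ C Lxx Lxy Lyx Lyy yh α ρ R R₀ l τ₁ τ₂ β z₀ x y z :=
      { data := H
        radius := hCr
        start := hz₀
        alpha_pos := hα₀
        alpha_lt := hα₁
        rho_nonneg := by linarith
        l_pos := hl
        lip := hlip
        bound := hR₀
        dual_radius := by linarith
        tau₁_pos := hτ₁
        tau₁_le := hτ₁l
        tau₂_eq := hτ₂
        beta_eq := hβ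
        tau₂_Lyy := hτL
        z_zero := hz0
        y_zero := hy0
        x_zero := hx0
        run := hrun }
    obtain ⟨V, hlow, hup, hanti, hgood⟩ := A.exists_potential_good (by linarith) hKA0 hKd0 hG hKA
      hKd hKc (by linarith) (by linarith) hρl (by linarith) (by linarith)
    have hΓ : 0 ≤ max 1 (l / μ) * (τ₁⁻¹ + ζ) * (384 + 1152 / α) := by positivity
    constructor
    · intro N _ ε hε
      obtain ⟨t, hNt, ht, hg⟩ := exists_good_of_potential
        (P := fun t ε => GoodIterate f h ζ ρ (5 + 3 * Kd * (1 + Lxx * KA) + 3 * Lyx * KA) ε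
          (x t) (y t)) hΓ hlow hup hanti hgood N hε
      refine ⟨t, hNt, ?_, hg.isApproxStationary⟩
      rw [← hΔdef] at ht
      have hX : 0 ≤ max 1 (l / μ) * (1 / τ₁ + ζ) * Δ / ε ^ 2 := by positivity
      have e1 : max 1 (l / μ) * (τ₁⁻¹ + ζ) * (384 + 1152 / α) * Δ / ε ^ 2 =
          (384 + 1152 / α) * (max 1 (l / μ) * (1 / τ₁ + ζ) * Δ / ε ^ 2) := by
        rw [one_div]; ring
      rw [e1] at ht
      have hα : 0 ≤ 384 + 1152 / α := by positivity
      simp only [gradEvals, Nat.cast_mul, Nat.cast_ofNat]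
      linarith
    · intro xs ys hcl
      obtain ⟨e, he, hge⟩ := exists_vanishing_of_potential
        (P := fun t ε => GoodIterate f h ζ ρ (5 + 3 * Kd * (1 + Lxx * KA) + 3 * Lyx * KA) ε
          (x t) (y t)) hΓ hlow hanti hgood
      exact H.isMinimaxStationary_of_mapClusterPt hCr he hge hcl
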